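/- Let $H$ be a finite-dimensional complex inner product space, let $\Pi,\Delta$ be orthogonal projectors on $H$, let $U=(2\Pi-I)(2\Delta-I)$, and let $\psi\in\ker\Pi$ be a unit vector with $P_{\ker\Pi\cap\ker\Delta}\psi\neq 0$. Put $$\omega=\frac{1}{\|P_{\ker\Pi\cap\ker\Delta}\psi\|^2},\qquad W=\big\|(\Pi-\Pi\Delta\Pi)^+\Delta\psi\big\|^2,$$ where $A^+$ denotes the Moore--Penrose pseudoinverse; $W$ is the transduction complexity (squared norm of the catalyst) of the transduction of $\psi$ by $U$. A quantum algorithm has access to (controlled) $U$, to the known operations (preparing $\psi$, controlled reflections $2\Pi-I$ and $2|\psi\rangle\langle\psi|-I$), to one- and two-qubit gates on ancilla qubits, and to measurements of the ancilla qubits with classical control. Its time complexity is the number of all these operations, calls to $U$ included. Calls and time are counted in expectation. **(1)** There is a universal constant $C>0$ such that for all real $\sigma$ and $\varepsilon>0$ there is a quantum algorithm, depending only on $\sigma$ and $\varepsilon$, with the following property. For all $H,\Pi,\Delta,\psi$ as above with $\sigma\ge\sqrt{\omega W}$ and $\sigma\ge\sqrt{\omega}$, with probability at least $2/3$ it returns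 a number $\tilde\omega$ with $|\tilde\omega-\omega|\le\varepsilon\,\omega$, it makes at most $C N$ calls to $U$, where $$N=\sigma\Big(\frac1\varepsilon+\log\omega\Big),$$ and its time complexity is at most $C\,N\log(2+N)$. **(2)** The same algorithm estimates positive witness sizes of span programs. Let $P$ be a span program on $[q]^n$: finite-dimensional complex inner product spaces $H=H_1\oplus\dots\oplus H_n\oplus H_{\rm true}\oplus H_{\rm false}$ (orthogonal sum) and $V$, subspaces $H_{j,a}\subseteq H_j$ with $\sum_{a}H_{j,a}=H_j$, a target $\tau\in V$ and a linear map $A:H\to V$. Put $H(x)=H_{1,x_1}\oplus\dots\oplus H_{n,x_n}\oplus H_{\rm true}$ and $w_0=A^+\tau$. Assume that $P$ is normalized, $\|w_0\|=1$, and that $x$ is a positive input, $\tau\in A(H(x))$. Define $$w_+(x)=\min\{\|w\|^2: w\in H(x),\ Aw=\tau\},\qquad e_-(x)=\min\{\|\Pi_{H(x)}A^\dagger v\|^2: v\in V,\ \tau^\dagger v=1\},$$ $$\tilde w_-(x)=\min\{\|A^\dagger v\|^2: v^\dagger\tau=1,\ \|\Pi_{H(x)}A^\dagger v\|^2=e_-(x)\}.$$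 With $T=\ker A\oplus\mathrm{span}\{w_0\}$, $\Pi=\Pi_{T^\perp}$, $\Delta=\Pi_{H(x)^\perp}$ and $\psi=w_0$, one has $\omega=w_+(x)$ and $\tilde w_-(x)=1+W$. If $\sigma\ge\sqrt{w_+(x)\,\tilde w_-(x)}$, then with probability at least $2/3$ the algorithm of (1), run with $U=(2\Pi-I)(2\Delta-I)$, returns an estimate of $w_+(x)$ with multiplicative error at most $\varepsilon$, with at most $CN$ calls to $U$ and time complexity at most $CN\log(2+N)$, where $N=\sigma\big(\frac1\varepsilon+\log w_+(x)\big)$. In particular the dependence on the precision is $1/\varepsilon$ (rather than $1/\varepsilon^{3/2}$). -/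

import Mathlib

open scoped InnerProductSpace

namespace WitnessSize

noncomputable section

/-! ### Moore-Penrose pseudoinverse -/

/-- The Moore-Penrose pseudoinverse of a linear map between finite-dimensional inner product
spaces: project orthogonally onto the range of `A`, then invert `A` restricted to `(ker A)ᗮ`. -/
def pinv {E F : Type*} [NormedAddCommGroup E] [InnerProductSpace ℂ E] [FiniteDimensional ℂ E]
    [NormedAddCommGroup F] [InnerProductSpace ℂ F] [FiniteDimensional ℂ F]
    (A : E →ₗ[ℂ] F) : F →ₗ[ℂ] E :=
  (LinearMap.ker A)ᗮ.subtype ∘ₗ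
    (A.kerComplementEquivRange
      (Submodule.isCompl_orthogonal (K := LinearMap.ker A)).symm).symm.toLinearMap ∘ₗ
    (LinearMap.range A).orthogonalProjectionOnto.toLinearMap

/-! ### The estimation problem -/

section Problem

variable {H : Type*} [NormedAddCommGroup H] [InnerProductSpace ℂ H] [FiniteDimensional ℂ H]

/-- The orthogonal projector onto a subspace, as a linear map. -/
def proj (K : Submodule ℂ H) : H →ₗ[ℂ] H := K.starProjection.toLinearMap

/-- The reflection `2 Q - I`. -/
def reflOp (Q : H →ₗ[ℂ] H) : H →ₗ[ℂ] H := (2 : ℂ) • Q - LinearMap.id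

/-- The operator `U = (2Π - I)(2Δ - I)`. -/
def walk (Pi Delta : H →ₗ[ℂ] H) : H →ₗ[ℂ] H := reflOp Pi ∘ₗ reflOp Delta

/-- The vector `P_{ker Π ∩ ker Δ} ψ`. -/
def kerPart (Pi Delta : H →ₗ[ℂ] H) (psi : H) : H :=
  proj (LinearMap.ker Pi ⊓ LinearMap.ker Delta) psi

/-- `ω = 1 / ‖P_{ker Π ∩ ker Δ} ψ‖²`. -/
def omega (Pi Delta : H →ₗ[ℂ] H) (psi : H) : ℝ := 1 / ‖kerPart Pi Delta psi‖ ^ 2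

/-- The catalyst `w = (Π - ΠΔΠ)⁺ Δ ψ`. -/
def catalyst (Pi Delta : H →ₗ[ℂ] H) (psi : H) : H :=
  pinv (Pi - Pi ∘ₗ Delta ∘ₗ Pi) (Delta psi)

/-- The transduction complexity `W = ‖w‖²`. -/
def transductionComplexity (Pi Delta : H →ₗ[ℂ] H) (psi : H) : ℝ :=
  ‖catalyst Pi Delta psi‖ ^ 2

end Problem

/-! ### Quantum algorithms with oracle access

The workspace consists of `m` qubits and one register holding a vector of `H`; its state space
`H ⊗ (ℂ²)^{⊗ m}` is represented by the functions `(Fin m → Bool) → H`, giving for every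
computational basis state of the qubits the corresponding component in `H`. -/

/-- The elementary operations on `m` qubits and the register `H`. They are symbols: their
meaning on the register is fixed only when `Π`, `Δ` and `ψ` are given. -/
inductive Gate (m : ℕ) : Type
  /-- a one-qubit gate -/
  | single (i : Fin m) (u : Matrix.unitaryGroup Bool ℂ) : Gate m
  /-- a two-qubit gate -/
  | two (i j : Fin m) (hij : i ≠ j) (u : Matrix.unitaryGroup (Bool × Bool) ℂ) : Gate m
  /-- a call to `U`, controlled on qubit `c` -/
  | call (c : Fin m) : Gate m
  /-- the reflection `2Π - I`, controlled on qubit `c` -/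
  | reflectPi (c : Fin m) : Gate m
  /-- the reflection `2|ψ⟩⟨ψ| - I`, controlled on qubit `c` -/
  | reflectPsi (c : Fin m) : Gate m

/-- `1` if the gate is a call to `U`, and `0` otherwise. -/
def Gate.calls {m : ℕ} : Gate m → ℕ
  | .call _ => 1
  | _ => 0

/-- A classically controlled quantum algorithm. It either halts with a real output, or prepares
`m` qubits in state `|0…0⟩` and the register in state `ψ`, applies a list of gates (the head
of the list first), measures all qubits in the computational basis, discards the register, and
continues depending on the outcome. -/
inductive Algorithm : Type
  | output (r : ℝ) : Algorithm
  | run (m : ℕ) (circuit : List (Gate m)) (next : (Fin m → Bool) → Algorithm) : Algorithm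

section Semantics

variable {H : Type*} [NormedAddCommGroup H] [InnerProductSpace ℂ H] [FiniteDimensional ℂ H]

/-- Apply the operator `V` to the register, controlled on qubit `c`. -/
def controlled {m : ℕ} (c : Fin m) (V : H →ₗ[ℂ] H) (phi : (Fin m → Bool) → H) :
    (Fin m → Bool) → H :=
  fun b => if b c then V (phi b) else phi b

/-- The action of a gate on a state. -/
def Gate.apply (Pi Delta : H →ₗ[ℂ] H) (psi : H) {m : ℕ} :
    Gate m → ((Fin m → Bool) → H) → ((Fin m → Bool) → H)
  | .single i u, phi => fun b => ∑ p : Bool, u.1 (b i) p • phi (Function.update b i p)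
  | .two i j _ u, phi => fun b => ∑ p : Bool × Bool,
      u.1 (b i, b j) p • phi (Function.update (Function.update b i p.1) j p.2)
  | .call c, phi => controlled c (walk Pi Delta) phi
  | .reflectPi c, phi => controlled c (reflOp Pi) phi
  | .reflectPsi c, phi => controlled c (reflOp (proj (Submodule.span ℂ {psi}))) phi

/-- The state `|0…0⟩ ⊗ ψ`. -/
def initialState (psi : H) (m : ℕ) : (Fin m → Bool) → H :=
  fun b => if b = (fun _ => false) then psi else 0

/-- The state after all gates of a circuit have been applied to `|0…0⟩ ⊗ ψ`. -/
def finalState (Pi Delta : H →ₗ[ℂ] H) (psi : H) {m : ℕ} (circuit : List (Gate m)) :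
    (Fin m → Bool) → H :=
  circuit.foldl (fun phi g => g.apply Pi Delta psi phi) (initialState psi m)

/-- The probability that measuring all qubits yields the outcome `b`. -/
def outcomeProb (Pi Delta : H →ₗ[ℂ] H) (psi : H) {m : ℕ} (circuit : List (Gate m))
    (b : Fin m → Bool) : ℝ :=
  ‖finalState Pi Delta psi circuit b‖ ^ 2

namespace Algorithm

open Classical in
/-- The probability that the output of the algorithm lies in `S`. -/
def prob (Pi Delta : H →ₗ[ℂ] H) (psi : H) (S : Set ℝ) : Algorithm → ℝ
  | output r => if r ∈ S then 1 else 0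
  | run _ circuit next =>
      ∑ b, outcomeProb Pi Delta psi circuit b * prob Pi Delta psi S (next b)

/-- The expected number of calls to `U`. -/
def expectedCalls (Pi Delta : H →ₗ[ℂ] H) (psi : H) : Algorithm → ℝ
  | output _ => 0
  | run _ circuit next => ((circuit.map Gate.calls).sum : ℕ) +
      ∑ b, outcomeProb Pi Delta psi circuit b * expectedCalls Pi Delta psi (next b)

/-- The expected total number of elementary operations: one for the preparation of `ψ`, one for
the initialisation and one for the measurement of each qubit, and one for each gate (calls to
`U` included). -/
def expectedTime (Pi Delta : H →ₗ[ℂ] H) (psi : H) : Algorithm → ℝ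
  | output _ => 0
  | run m circuit next => (1 + 2 * m + circuit.length : ℕ) +
      ∑ b, outcomeProb Pi Delta psi circuit b * expectedTime Pi Delta psi (next b)

/-- On the instance `(Π, Δ, ψ)` the algorithm returns an `ε`-multiplicative estimate of `v` with
probability at least `2/3`, makes at most `q` calls to `U` in expectation and uses at most `t`
elementary operations in expectation. -/
def Estimates (alg : Algorithm) (Pi Delta : H →ₗ[ℂ] H) (psi : H) (v ε q t : ℝ) : Prop :=
  2 / 3 ≤ alg.prob Pi Delta psi {r | |r - v| ≤ ε * v} ∧
  alg.expectedCalls Pi Delta psi ≤ q ∧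
  alg.expectedTime Pi Delta psi ≤ t

end Algorithm

end Semantics

/-! ### Span programs -/

/-- A span program on `[q]^n` with `H = H_1 ⊕ ⋯ ⊕ H_n ⊕ H_true ⊕ H_false`. The summand `H_j` is
`part (inl j)`, and `H_true`, `H_false` are `part (inr true)`, `part (inr false)`. -/
structure SpanProgram (n q : ℕ) (H V : Type*)
    [NormedAddCommGroup H] [InnerProductSpace ℂ H] [FiniteDimensional ℂ H]
    [NormedAddCommGroup V] [InnerProductSpace ℂ V] [FiniteDimensional ℂ V] where
  part : Fin n ⊕ Bool → Submodule ℂ H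
  part_orthogonal : ∀ i k, i ≠ k → part i ⟂ part k
  iSup_part : ⨆ i, part i = ⊤
  /-- the subspaces `H_{j,a} ⊆ H_j` -/
  sub : Fin n → Fin q → Submodule ℂ H
  iSup_sub : ∀ j, ⨆ a, sub j a = part (Sum.inl j)
  /-- the target vector `τ` -/
  target : V
  A : H →ₗ[ℂ] V

namespace SpanProgram

variable {n q : ℕ} {H V : Type*}
  [NormedAddCommGroup H] [InnerProductSpace ℂ H] [FiniteDimensional ℂ H]
  [NormedAddCommGroup V] [InnerProductSpace ℂ V] [FiniteDimensional ℂ V]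

/-- `H(x) = H_{1,x_1} ⊕ ⋯ ⊕ H_{n,x_n} ⊕ H_true`. -/
def space (P : SpanProgram n q H V) (x : Fin n → Fin q) : Submodule ℂ H :=
  (⨆ j, P.sub j (x j)) ⊔ P.part (Sum.inr true)

/-- `x` is a positive input: `τ ∈ im (A Π_{H(x)})`. -/
def IsPositive (P : SpanProgram n q H V) (x : Fin n → Fin q) : Prop :=
  P.target ∈ LinearMap.range (P.A ∘ₗ proj (P.space x))

/-- The positive witness size `w₊(x)`. -/
def posWitnessSize (P : SpanProgram n q H V) (x : Fin n → Fin q) : ℝ :=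
  sInf {r | ∃ w ∈ P.space x, P.A w = P.target ∧ r = ‖w‖ ^ 2}

/-- The negative error `e₋(x)`. -/
def negError (P : SpanProgram n q H V) (x : Fin n → Fin q) : ℝ :=
  sInf {r | ∃ v : V, ⟪P.target, v⟫_ℂ = 1 ∧
    r = ‖proj (P.space x) (LinearMap.adjoint P.A v)‖ ^ 2}

/-- The optimal min-error negative witness size. -/
def negWitnessSize (P : SpanProgram n q H V) (x : Fin n → Fin q) : ℝ :=
  sInf {r | ∃ v : V, ⟪v, P.target⟫_ℂ = 1 ∧
    ‖proj (P.space x) (LinearMap.adjoint P.A v)‖ ^ 2 = P.negError x ∧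
    r = ‖LinearMap.adjoint P.A v‖ ^ 2}

/-- The initial state `w₀ = A⁺ τ`. -/
def w0 (P : SpanProgram n q H V) : H := pinv P.A P.target

/-- The span program is normalized: `w₀` is a unit vector. -/
def IsNormalized (P : SpanProgram n q H V) : Prop := ‖P.w0‖ = 1

/-- `Π = Π_{T^⊥}` with `T = ker A ⊕ span {w₀}`. -/
def Pi (P : SpanProgram n q H V) : H →ₗ[ℂ] H :=
  proj (LinearMap.ker P.A ⊔ Submodule.span ℂ {P.w0})ᗮ

/-- `Δ = Π_{H(x)^⊥}`. -/
def Delta (P : SpanProgram n q H V) (x : Fin n → Fin q) : H →ₗ[ℂ] H := proj (P.space x)ᗮ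

end SpanProgram

end

end WitnessSize

/-! Write g for the projection of ψ to ker Π ∩ ker Δ, p = ‖g‖² = 1/ω, and w for the catalyst. The
walk U fixes g and maps ψ − g + w to −(ψ − g) + w: in the presence of w, it separates the two parts
of ψ by a sign.

To compare a candidate v with ω, let Φ be the phase z = (1 − iτ)/(1 + iτ) on ker Π and 1 on its
complement. Dilute ψ to χ = (cos β ψ, sin β ψ) in H ⊕ H, put S = (−Φ) ⊕ ΦU and let Q be S followed
by the reflection 1 − 2|χ⟩⟨χ|. The equation (1 − S)ζ = χ has an explicit solution, and for the right
β this gives Qζ − ζ = i t χ with t = τ(v/ω − 1) (`detector_witnessVec`). The sign of t tells whether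
v exceeds ω. Telescoping gives t ∑_{k<m} Im⟨χ, Q^k χ⟩ = 1/2 − Re⟨χ, Q^m ζ⟩; after summation over m <
K a second telescoping bounds the remainder by 2‖ζ‖²/|t| (`abs_mul_mul_imSum_sub_le`). With τ =
1/(8σ) the promise yields ‖ζ‖² ≤ (1 + v/ω)/3 (`Promise.norm_witnessVec_sq_le`). Hence Hadamard tests
with O(σ/d) steps distinguish v/ω in [1 − 2d, 1 − d] from v/ω ≥ 1 + d with constant bias, and
majority votes amplify.

The search over v loses no logarithmic factor. The candidates 2^i are tried in turn; an acceptance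
is confirmed by votes of doubling size, so a false acceptance at stage i has probability at most
32^{-(i+1)} although the expected cost of a rejection is O(σ). This phase costs O(σ(1 + log ω)).
Then an interval containing 2^i/ω shrinks by factors 3/4. A test at length l costs O(σ/l), so long
intervals afford more repetitions: errors and costs both have convergent sums, and the total is
O(σ/ε).

For span programs, positive witnesses are the vectors of ker Π ∩ ker Δ with ⟨w₀, ·⟩ = 1, and the
vectors A†v with ⟨τ, v⟩ = 1 are w₀ + y with y in the range of Π (`feasible_iff`,
`exists_adjoint_apply_iff`). Both witness sizes then become least-norm problems solved by g and w.
-/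

namespace WitnessSize

noncomputable section

set_option linter.unusedSectionVars false

/-! ### The Moore-Penrose pseudoinverse and the catalyst -/

section Pseudoinverse

variable {E F : Type*} [NormedAddCommGroup E] [InnerProductSpace ℂ E] [FiniteDimensional ℂ E]
    [NormedAddCommGroup F] [InnerProductSpace ℂ F] [FiniteDimensional ℂ F]

theorem pinv_mem_orthogonal_ker (A : E →ₗ[ℂ] F) (y : F) : pinv A y ∈ (LinearMap.ker A)ᗮ := by
  simp [pinv]

theorem apply_pinv (A : E →ₗ[ℂ] F) (y : F) :
    A (pinv A y) = (LinearMap.range A).starProjection y := by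
  set hc := (Submodule.isCompl_orthogonal (K := LinearMap.ker A)).symm
  set z := (A.kerComplementEquivRange hc).symm ((LinearMap.range A).orthogonalProjectionOnto y)
  have h : A.kerComplementEquivRange hc z = (LinearMap.range A).orthogonalProjectionOnto y :=
    LinearEquiv.apply_symm_apply _ _
  exact congrArg Subtype.val h

theorem apply_pinv_of_mem_range {A : E →ₗ[ℂ] F} {y : F} (hy : y ∈ LinearMap.range A) :
    A (pinv A y) = y := by
  rw [apply_pinv, Submodule.starProjection_eq_self_iff.2 hy]

end Pseudoinverse

/-! ### Orthogonal projectors and their reflections -/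

section Projectors

variable {H : Type*} [NormedAddCommGroup H] [InnerProductSpace ℂ H] [FiniteDimensional ℂ H]

theorem proj_isSymmetricProjection (K : Submodule ℂ H) : (proj K).IsSymmetricProjection :=
  K.isSymmetricProjection_starProjection

theorem proj_apply (K : Submodule ℂ H) (v : H) : proj K v = K.starProjection v := rfl

theorem ker_proj (K : Submodule ℂ H) : LinearMap.ker (proj K) = Kᗮ :=
  K.ker_starProjection

variable {Q : H →ₗ[ℂ] H}

theorem apply_apply_of_isSymmetricProjection (hQ : Q.IsSymmetricProjection) (v : H) :
    Q (Q v) = Q v :=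
  LinearMap.congr_fun hQ.isIdempotentElem v

theorem reflOp_apply (v : H) : reflOp Q v = (2 : ℂ) • Q v - v := rfl

theorem reflOp_reflOp (hQ : Q.IsSymmetricProjection) (v : H) : reflOp Q (reflOp Q v) = v := by
  simp only [reflOp_apply, map_sub, map_smul, apply_apply_of_isSymmetricProjection hQ]
  module

theorem inner_reflOp (hQ : Q.IsSymmetricProjection) (v w : H) :
    ⟪reflOp Q v, w⟫_ℂ = ⟪v, reflOp Q w⟫_ℂ := by
  have h := hQ.isSymmetric v w
  simp only [reflOp_apply, inner_sub_left, inner_sub_right, inner_smul_left, inner_smul_right, h,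
    map_ofNat]

theorem norm_reflOp (hQ : Q.IsSymmetricProjection) (v : H) : ‖reflOp Q v‖ = ‖v‖ := by
  have h : ⟪reflOp Q v, reflOp Q v⟫_ℂ = ⟪v, v⟫_ℂ := by rw [inner_reflOp hQ, reflOp_reflOp hQ]
  rw [inner_self_eq_norm_sq_to_K, inner_self_eq_norm_sq_to_K] at h
  have h' : ‖reflOp Q v‖ ^ 2 = ‖v‖ ^ 2 := by exact_mod_cast h
  exact (sq_eq_sq₀ (norm_nonneg _) (norm_nonneg _)).1 h'

theorem norm_walk {Pi Delta : H →ₗ[ℂ] H} (hPi : Pi.IsSymmetricProjection)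
    (hD : Delta.IsSymmetricProjection) (v : H) : ‖walk Pi Delta v‖ = ‖v‖ := by
  rw [walk, LinearMap.comp_apply, norm_reflOp hPi, norm_reflOp hD]

theorem inner_apply_eq_zero_of_apply_eq_zero (hQ : Q.IsSymmetricProjection) {u v : H}
    (hu : Q u = 0) (hv : Q v = v) : ⟪u, v⟫_ℂ = 0 := by
  rw [← hv, ← hQ.isSymmetric, hu, inner_zero_left]

theorem proj_eq_zero_of_forall {K : Submodule ℂ H} {v : H} (h : ∀ u ∈ K, ⟪u, v⟫_ℂ = 0) :
    proj K v = 0 :=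
  (Submodule.starProjection_apply_eq_zero_iff K).2 ((Submodule.mem_orthogonal _ _).2 h)

theorem inner_proj_self (K : Submodule ℂ H) (v : H) : ⟪v, proj K v⟫_ℂ = (‖proj K v‖ ^ 2 : ℝ) := by
  rw [← apply_apply_of_isSymmetricProjection (proj_isSymmetricProjection K) v,
    ← (proj_isSymmetricProjection K).isSymmetric,
    apply_apply_of_isSymmetricProjection (proj_isSymmetricProjection K),
    inner_self_eq_norm_sq_to_K]
  norm_cast

end Projectors

/-! ### The catalyst equation and the action of the walk -/

section Catalyst

variable {H : Type*} [NormedAddCommGroup H] [InnerProductSpace ℂ H] [FiniteDimensional ℂ H]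
  {Pi Delta : H →ₗ[ℂ] H} {psi : H}

theorem kerPart_mem (Pi Delta : H →ₗ[ℂ] H) (psi : H) :
    kerPart Pi Delta psi ∈ LinearMap.ker Pi ⊓ LinearMap.ker Delta :=
  Submodule.starProjection_apply_mem _ _

theorem apply_kerPart_left (Pi Delta : H →ₗ[ℂ] H) (psi : H) : Pi (kerPart Pi Delta psi) = 0 :=
  (kerPart_mem Pi Delta psi).1

theorem apply_kerPart_right (Pi Delta : H →ₗ[ℂ] H) (psi : H) : Delta (kerPart Pi Delta psi) = 0 :=
  (kerPart_mem Pi Delta psi).2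

theorem inner_kerPart (Pi Delta : H →ₗ[ℂ] H) (psi : H) :
    ⟪psi, kerPart Pi Delta psi⟫_ℂ = (‖kerPart Pi Delta psi‖ ^ 2 : ℝ) :=
  inner_proj_self _ _

theorem kerPart_eq_zero_of_apply_eq_self (hPi : Pi.IsSymmetricProjection) {v : H}
    (hv : Pi v = v) : kerPart Pi Delta v = 0 :=
  proj_eq_zero_of_forall fun _ hu => inner_apply_eq_zero_of_apply_eq_zero hPi hu.1 hv

theorem kerPart_sub_apply (hD : Delta.IsSymmetricProjection) (v : H) :
    kerPart Pi Delta (v - Delta v) = kerPart Pi Delta v := by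
  have h : kerPart Pi Delta (Delta v) = 0 := proj_eq_zero_of_forall fun _ hu =>
    inner_apply_eq_zero_of_apply_eq_zero hD hu.2 (apply_apply_of_isSymmetricProjection hD v)
  rw [kerPart] at h ⊢
  rw [map_sub, h, sub_zero, kerPart]

theorem isSymmetric_sub_comp (hPi : Pi.IsSymmetricProjection) (hD : Delta.IsSymmetricProjection) :
    (Pi - Pi ∘ₗ Delta ∘ₗ Pi).IsSymmetric := by
  intro u v
  simp only [LinearMap.sub_apply, LinearMap.comp_apply, inner_sub_left, inner_sub_right,
    hPi.isSymmetric _ _, hD.isSymmetric _ _]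

/-- Pairing (Π − ΠΔΠ)v = 0 with v gives ‖(1 − Δ)Πv‖² = 0. -/
theorem mem_ker_sub_comp (hPi : Pi.IsSymmetricProjection) (hD : Delta.IsSymmetricProjection)
    {v : H} (hv : v ∈ LinearMap.ker (Pi - Pi ∘ₗ Delta ∘ₗ Pi)) : Delta (Pi v) = Pi v := by
  have h0 : Pi v - Pi (Delta (Pi v)) = 0 := hv
  have h1 : ⟪Pi v - Delta (Pi v), Pi v - Delta (Pi v)⟫_ℂ = 0 := by
    have e1 : ⟪Delta (Pi v), Pi v - Delta (Pi v)⟫_ℂ = 0 := by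
      rw [hD.isSymmetric, map_sub, apply_apply_of_isSymmetricProjection hD, sub_self,
        inner_zero_right]
    rw [inner_sub_left, e1, sub_zero, hPi.isSymmetric, map_sub,
      apply_apply_of_isSymmetricProjection hPi, h0, inner_zero_right]
  exact (sub_eq_zero.1 (inner_self_eq_zero.1 h1)).symm

theorem range_sub_comp (hPi : Pi.IsSymmetricProjection) (hD : Delta.IsSymmetricProjection) :
    LinearMap.range (Pi - Pi ∘ₗ Delta ∘ₗ Pi) = (LinearMap.ker (Pi - Pi ∘ₗ Delta ∘ₗ Pi))ᗮ := by
  rw [← (isSymmetric_sub_comp hPi hD).orthogonal_range, Submodule.orthogonal_orthogonal]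

theorem catalyst_mem_orthogonal (Pi Delta : H →ₗ[ℂ] H) (psi : H) :
    catalyst Pi Delta psi ∈ (LinearMap.ker (Pi - Pi ∘ₗ Delta ∘ₗ Pi))ᗮ :=
  pinv_mem_orthogonal_ker _ _

theorem apply_catalyst_left (hPi : Pi.IsSymmetricProjection) (hD : Delta.IsSymmetricProjection)
    (psi : H) : Pi (catalyst Pi Delta psi) = catalyst Pi Delta psi := by
  have h := catalyst_mem_orthogonal Pi Delta psi
  rw [← range_sub_comp hPi hD] at h
  obtain ⟨u, hu⟩ := h
  rw [← hu, LinearMap.sub_apply, LinearMap.comp_apply, map_sub,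
    apply_apply_of_isSymmetricProjection hPi, apply_apply_of_isSymmetricProjection hPi]

/-- The projection of Δψ to the range of Π − ΠΔΠ is ΠΔψ: the difference Δψ − ΠΔψ is orthogonal to
the range of Π, and a kernel vector v has ΔΠv = Πv, so that ⟨v, ΠΔψ⟩ = ⟨Πv, ψ⟩ = 0. -/
theorem apply_catalyst (hPi : Pi.IsSymmetricProjection) (hD : Delta.IsSymmetricProjection)
    (hpsi : Pi psi = 0) :
    (Pi - Pi ∘ₗ Delta ∘ₗ Pi) (catalyst Pi Delta psi) = Pi (Delta psi) := by
  rw [catalyst, apply_pinv]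
  refine Submodule.eq_starProjection_of_mem_orthogonal ?_ ?_
  · rw [range_sub_comp hPi hD, Submodule.mem_orthogonal]
    intro v hv
    rw [← hPi.isSymmetric, ← hD.isSymmetric, mem_ker_sub_comp hPi hD hv, hPi.isSymmetric, hpsi,
      inner_zero_right]
  · rw [Submodule.mem_orthogonal]
    rintro _ ⟨u, rfl⟩
    have h : (Pi - Pi ∘ₗ Delta ∘ₗ Pi) u = Pi (u - Delta (Pi u)) := by
      rw [map_sub]; rfl
    rw [h, hPi.isSymmetric, map_sub, apply_apply_of_isSymmetricProjection hPi, sub_self,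
      inner_zero_right]

/-- The equation of the catalyst says that Π kills (1 − Δ)(ψ + w), which therefore lies in ker Π ∩
ker Δ. The projection to that space kills w and the range of Δ, so only the part coming from ψ
remains. Both the walk identity and the negative witness sizes rest on this. -/
theorem add_catalyst_sub_apply (hPi : Pi.IsSymmetricProjection)
    (hD : Delta.IsSymmetricProjection) (hpsi : Pi psi = 0) :
    psi + catalyst Pi Delta psi - Delta (psi + catalyst Pi Delta psi) = kerPart Pi Delta psi := by
  set w := catalyst Pi Delta psi with hw
  have hPw : Pi w = w := apply_catalyst_left hPi hD psi
  have h := apply_catalyst hPi hD hpsi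
  rw [← hw, LinearMap.sub_apply, LinearMap.comp_apply, LinearMap.comp_apply, hPw] at h
  have hmem : psi + w - Delta (psi + w) ∈ LinearMap.ker Pi ⊓ LinearMap.ker Delta := by
    refine ⟨?_, ?_⟩
    · change Pi _ = 0
      rw [map_sub, map_add, map_add, map_add, hpsi, hPw, ← h]
      abel
    · change Delta _ = 0
      rw [map_sub, apply_apply_of_isSymmetricProjection hD, sub_self]
  have h1 : kerPart Pi Delta (psi + w - Delta (psi + w)) = psi + w - Delta (psi + w) :=
    Submodule.starProjection_eq_self_iff.2 hmem
  rw [← h1, kerPart_sub_apply hD]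
  have h2 : kerPart Pi Delta w = 0 := kerPart_eq_zero_of_apply_eq_self hPi hPw
  rw [kerPart] at h2 ⊢
  rw [map_add, h2, add_zero, kerPart]

theorem walk_kerPart (Pi Delta : H →ₗ[ℂ] H) (psi : H) :
    walk Pi Delta (kerPart Pi Delta psi) = kerPart Pi Delta psi := by
  simp only [walk, LinearMap.comp_apply, reflOp_apply, apply_kerPart_right, apply_kerPart_left,
    map_sub, map_smul, map_zero]
  module

/-- The vector equals Δ(ψ + w), hence is fixed by 2Δ − I; then 2Π − I negates ψ − g, which lies in
ker Π, and keeps w. -/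
theorem walk_add_catalyst (hPi : Pi.IsSymmetricProjection) (hD : Delta.IsSymmetricProjection)
    (hpsi : Pi psi = 0) :
    walk Pi Delta (psi - kerPart Pi Delta psi + catalyst Pi Delta psi) =
      -(psi - kerPart Pi Delta psi) + catalyst Pi Delta psi := by
  have h := add_catalyst_sub_apply hPi hD hpsi
  have h1 : Delta (psi - kerPart Pi Delta psi + catalyst Pi Delta psi) =
      psi - kerPart Pi Delta psi + catalyst Pi Delta psi := by
    have : psi - kerPart Pi Delta psi + catalyst Pi Delta psi =
        Delta (psi + catalyst Pi Delta psi) := by rw [← h]; abel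
    rw [this, apply_apply_of_isSymmetricProjection hD]
  rw [walk, LinearMap.comp_apply, reflOp_apply (Q := Delta), h1, reflOp_apply]
  simp only [map_sub, map_add, map_smul, hpsi, apply_kerPart_left,
    apply_catalyst_left hPi hD psi]
  module

theorem norm_kerPart_sq_le (hnorm : ‖psi‖ = 1) : ‖kerPart Pi Delta psi‖ ^ 2 ≤ 1 := by
  have h : ‖kerPart Pi Delta psi‖ ≤ ‖psi‖ :=
    (LinearMap.ker Pi ⊓ LinearMap.ker Delta).norm_starProjection_apply_le psi
  rw [hnorm] at h
  exact pow_le_one₀ (norm_nonneg _) h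

theorem one_le_omega (hnorm : ‖psi‖ = 1) (h0 : kerPart Pi Delta psi ≠ 0) :
    1 ≤ omega Pi Delta psi := by
  have h : 0 < ‖kerPart Pi Delta psi‖ ^ 2 := by positivity
  rw [omega, le_div_iff₀ h, one_mul]
  exact norm_kerPart_sq_le hnorm

end Catalyst

/-! ### Span programs -/

section Variational

variable {H : Type*} [NormedAddCommGroup H] [InnerProductSpace ℂ H] [FiniteDimensional ℂ H]
  {Pi Delta : H →ₗ[ℂ] H} {psi : H}

theorem kerPart_add_of_apply_eq_self (hPi : Pi.IsSymmetricProjection) {y : H} (hy : Pi y = y) :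
    kerPart Pi Delta (psi + y) = kerPart Pi Delta psi := by
  have h := kerPart_eq_zero_of_apply_eq_self (Delta := Delta) hPi hy
  rw [kerPart] at h ⊢
  rw [map_add, h, add_zero, kerPart]

/-- Projecting (1 − Δ)(ψ + y) to ker Π ∩ ker Δ gives g for every y in the range of Π, and
projections are contractions. -/
theorem norm_kerPart_le_of_apply_eq_self (hPi : Pi.IsSymmetricProjection)
    (hD : Delta.IsSymmetricProjection) {y : H} (hy : Pi y = y) :
    ‖kerPart Pi Delta psi‖ ≤ ‖psi + y - Delta (psi + y)‖ := by
  rw [← kerPart_add_of_apply_eq_self hPi hy, ← kerPart_sub_apply hD]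
  exact Submodule.norm_starProjection_apply_le _ _

/-- Equality in the contraction bound forces (1 − Δ)(ψ + y) = g, as for y = w. So y − w is fixed by
Π and Δ, lies in the kernel of Π − ΠΔΠ, and is orthogonal to w. Hence w is the shortest minimiser.
-/
theorem inner_catalyst_sub_eq_zero (hPi : Pi.IsSymmetricProjection)
    (hD : Delta.IsSymmetricProjection) (hpsi : Pi psi = 0) {y : H} (hy : Pi y = y)
    (h : ‖psi + y - Delta (psi + y)‖ ^ 2 = ‖kerPart Pi Delta psi‖ ^ 2) :
    ⟪catalyst Pi Delta psi, y - catalyst Pi Delta psi⟫_ℂ = 0 := by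
  have e1 : kerPart Pi Delta (psi + y - Delta (psi + y)) = kerPart Pi Delta psi := by
    rw [kerPart_sub_apply hD, kerPart_add_of_apply_eq_self hPi hy]
  have e2 : psi + y - Delta (psi + y) = kerPart Pi Delta psi := by
    rw [← e1]
    symm
    refine Submodule.starProjection_eq_self_iff.2
      ((Submodule.mem_iff_norm_starProjection _ _).2 ?_)
    refine ((sq_eq_sq₀ (norm_nonneg _) (norm_nonneg _)).1 ?_).symm
    rw [h, ← e1]
    rfl
  have e3 := add_catalyst_sub_apply hPi hD hpsi
  have hw := apply_catalyst_left hPi hD psi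
  set w := catalyst Pi Delta psi with hwdef
  have hm : y - w ∈ LinearMap.ker (Pi - Pi ∘ₗ Delta ∘ₗ Pi) := by
    have e4 : Delta (y - w) = y - w := by
      have : (psi + y - Delta (psi + y)) - (psi + w - Delta (psi + w)) = 0 := by
        rw [e2, e3, sub_self]
      rw [map_add, map_add] at this
      rw [map_sub]
      rw [← sub_eq_zero, ← neg_eq_zero, ← this]
      abel
    change Pi (y - w) - Pi (Delta (Pi (y - w))) = 0
    rw [map_sub Pi, hy, hw, e4, map_sub, hy, hw, sub_self]
  exact (Submodule.mem_orthogonal' _ _).1 (catalyst_mem_orthogonal Pi Delta psi) _ hm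

end Variational

/-! ### Witness sizes in terms of the two projectors -/

namespace SpanProgram

variable {n q : ℕ} {H V : Type*}
  [NormedAddCommGroup H] [InnerProductSpace ℂ H] [FiniteDimensional ℂ H]
  [NormedAddCommGroup V] [InnerProductSpace ℂ V] [FiniteDimensional ℂ V]
  {P : SpanProgram n q H V} {x : Fin n → Fin q}

theorem ker_Pi (P : SpanProgram n q H V) :
    LinearMap.ker P.Pi = LinearMap.ker P.A ⊔ Submodule.span ℂ {P.w0} := by
  rw [Pi, ker_proj, Submodule.orthogonal_orthogonal]

theorem ker_Delta (P : SpanProgram n q H V) (x : Fin n → Fin q) :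
    LinearMap.ker (P.Delta x) = P.space x := by
  rw [Delta, ker_proj, Submodule.orthogonal_orthogonal]

theorem proj_space_apply (P : SpanProgram n q H V) (x : Fin n → Fin q) (v : H) :
    proj (P.space x) v = v - P.Delta x v := by
  rw [Delta, proj_apply, proj_apply, Submodule.starProjection_orthogonal_val, sub_sub_cancel]

theorem Pi_w0 (P : SpanProgram n q H V) : P.Pi P.w0 = 0 := by
  have : P.w0 ∈ LinearMap.ker P.Pi := by
    rw [ker_Pi]
    exact Submodule.mem_sup_right (Submodule.mem_span_singleton_self _)
  exact this

theorem IsPositive.A_w0 (hx : P.IsPositive x) : P.A P.w0 = P.target := by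
  refine apply_pinv_of_mem_range ?_
  obtain ⟨w, hw⟩ := hx
  exact ⟨_, hw⟩

theorem inner_w0_of_mem_ker (P : SpanProgram n q H V) {k : H} (hk : P.A k = 0) :
    ⟪P.w0, k⟫_ℂ = 0 :=
  (Submodule.mem_orthogonal' _ _).1 (pinv_mem_orthogonal_ker P.A P.target) _ hk

theorem IsNormalized.inner_w0_self (hP : P.IsNormalized) : ⟪P.w0, P.w0⟫_ℂ = 1 := by
  rw [inner_self_eq_norm_sq_to_K, hP]
  norm_num

/-- The solutions of Aw = τ form w₀ + ker A. As w₀ is a unit vector orthogonal to ker A, this is the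
slice ⟨w₀, ·⟩ = 1 of T. -/
theorem feasible_iff (hP : P.IsNormalized) (hx : P.IsPositive x) {w : H} :
    w ∈ P.space x ∧ P.A w = P.target ↔
      w ∈ LinearMap.ker P.Pi ⊓ LinearMap.ker (P.Delta x) ∧ ⟪P.w0, w⟫_ℂ = 1 := by
  rw [ker_Pi, ker_Delta]
  constructor
  · rintro ⟨hw, hA⟩
    have hk : P.A (w - P.w0) = 0 := by rw [map_sub, hA, hx.A_w0, sub_self]
    have e : w = (w - P.w0) + P.w0 := by abel
    refine ⟨⟨?_, hw⟩, ?_⟩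
    · rw [e]
      exact Submodule.add_mem_sup hk (Submodule.mem_span_singleton_self _)
    · rw [e, inner_add_right, P.inner_w0_of_mem_ker hk, hP.inner_w0_self, zero_add]
  · rintro ⟨⟨hT, hw⟩, h1⟩
    refine ⟨hw, ?_⟩
    obtain ⟨k, hk, c, hc, rfl⟩ := Submodule.mem_sup.1 hT
    obtain ⟨c, rfl⟩ := Submodule.mem_span_singleton.1 hc
    rw [inner_add_right, P.inner_w0_of_mem_ker hk, inner_smul_right, hP.inner_w0_self,
      zero_add, mul_one] at h1
    have hk' : P.A k = 0 := hk
    rw [map_add, hk', h1, one_smul, hx.A_w0, zero_add]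

theorem inner_kerPart_w0 {w : H}
    (hw : w ∈ LinearMap.ker P.Pi ⊓ LinearMap.ker (P.Delta x)) :
    ⟪kerPart P.Pi (P.Delta x) P.w0, w⟫_ℂ = ⟪P.w0, w⟫_ℂ := by
  rw [kerPart, (proj_isSymmetricProjection _).isSymmetric]
  congr 1
  exact Submodule.starProjection_eq_self_iff.2 hw

theorem kerPart_w0_ne_zero (hP : P.IsNormalized) (hx : P.IsPositive x) :
    kerPart P.Pi (P.Delta x) P.w0 ≠ 0 := by
  obtain ⟨u, hu⟩ := id hx
  have hw := (feasible_iff hP hx (w := proj (P.space x) u)).1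
    ⟨Submodule.starProjection_apply_mem _ _, hu⟩
  intro h
  have h1 := inner_kerPart_w0 hw.1
  rw [h, inner_zero_left, hw.2] at h1
  exact zero_ne_one h1

/-- The minimum is attained at g/‖g‖²; every feasible w has ⟨g, w⟩ = ⟨w₀, w⟩ = 1, so Cauchy–Schwarz
gives the lower bound. -/
theorem omega_eq_posWitnessSize (hP : P.IsNormalized) (hx : P.IsPositive x) :
    omega P.Pi (P.Delta x) P.w0 = P.posWitnessSize x := by
  symm
  refine IsLeast.csInf_eq ⟨?_, ?_⟩
  · set g := kerPart P.Pi (P.Delta x) P.w0 with hg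
    have h0 : 0 < ‖g‖ := norm_pos_iff.2 (kerPart_w0_ne_zero hP hx)
    have hf := (feasible_iff hP hx (w := ((1 / ‖g‖ ^ 2 : ℝ) : ℂ) • g)).2
      ⟨Submodule.smul_mem _ _ (kerPart_mem _ _ _), by
        rw [inner_smul_right, hg, inner_kerPart, ← hg, ← Complex.ofReal_mul,
          one_div_mul_cancel (by positivity), Complex.ofReal_one]⟩
    refine ⟨_, hf.1, hf.2, ?_⟩
    rw [norm_smul, omega, ← hg, Complex.norm_real, Real.norm_of_nonneg (by positivity)]
    field_simp
  · rintro r ⟨w, hw, hA, rfl⟩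
    obtain ⟨hm, h1⟩ := (feasible_iff hP hx).1 ⟨hw, hA⟩
    have h2 := inner_kerPart_w0 hm
    have h3 := norm_inner_le_norm (𝕜 := ℂ) (kerPart P.Pi (P.Delta x) P.w0) w
    rw [h2, h1, norm_one] at h3
    have h0 : 0 < ‖kerPart P.Pi (P.Delta x) P.w0‖ :=
      norm_pos_iff.2 (kerPart_w0_ne_zero hP hx)
    rw [omega, div_le_iff₀ (by positivity), ← mul_pow, mul_comm]
    exact one_le_pow₀ h3

/-- The range of A† is (ker A)ᗮ, and ⟨τ, v⟩ = ⟨w₀, A†v⟩ since τ = A w₀. The condition ⟨τ, v⟩ = 1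
thus fixes the component along w₀ and leaves y free in Tᗮ. -/
theorem exists_adjoint_apply_iff (hP : P.IsNormalized) (hx : P.IsPositive x) (y : H) :
    (∃ v : V, ⟪P.target, v⟫_ℂ = 1 ∧ LinearMap.adjoint P.A v = P.w0 + y) ↔ P.Pi y = y := by
  have hmem : P.Pi y = y ↔ y ∈ (LinearMap.ker P.A ⊔ Submodule.span ℂ {P.w0})ᗮ :=
    Submodule.starProjection_eq_self_iff
  rw [hmem, ← Submodule.inf_orthogonal]
  constructor
  · rintro ⟨v, hv, hA⟩
    have e : y = LinearMap.adjoint P.A v - P.w0 := by rw [hA]; abel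
    refine ⟨(Submodule.mem_orthogonal _ _).2 fun k hk => ?_,
      Submodule.mem_orthogonal_singleton_iff_inner_right.2 ?_⟩
    · have hk' : P.A k = 0 := hk
      rw [e, inner_sub_right, LinearMap.adjoint_inner_right, hk', inner_zero_left,
        inner_eq_zero_symm.1 (P.inner_w0_of_mem_ker hk), sub_zero]
    · rw [e, inner_sub_right, LinearMap.adjoint_inner_right, hx.A_w0, hv, hP.inner_w0_self,
        sub_self]
  · rintro ⟨h1, h2⟩
    have h2' := Submodule.mem_orthogonal_singleton_iff_inner_right.1 h2
    have h3 : P.w0 + y ∈ (LinearMap.ker P.A)ᗮ :=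
      Submodule.add_mem _ (pinv_mem_orthogonal_ker P.A P.target) h1
    rw [LinearMap.orthogonal_ker] at h3
    obtain ⟨v, hv⟩ := h3
    refine ⟨v, ?_, hv⟩
    rw [← hx.A_w0, ← LinearMap.adjoint_inner_right, hv, inner_add_right, hP.inner_w0_self, h2',
      add_zero]

theorem negError_eq (hP : P.IsNormalized) (hx : P.IsPositive x) :
    P.negError x = ‖kerPart P.Pi (P.Delta x) P.w0‖ ^ 2 := by
  have hPi : P.Pi.IsSymmetricProjection := proj_isSymmetricProjection _
  have hD : (P.Delta x).IsSymmetricProjection := proj_isSymmetricProjection _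
  refine IsLeast.csInf_eq ⟨?_, ?_⟩
  · obtain ⟨v, hv, hA⟩ := (exists_adjoint_apply_iff hP hx _).2
      (apply_catalyst_left hPi hD P.w0)
    refine ⟨v, hv, ?_⟩
    rw [hA, proj_space_apply, add_catalyst_sub_apply hPi hD P.Pi_w0]
  · rintro r ⟨v, hv, rfl⟩
    have hy : P.Pi (LinearMap.adjoint P.A v - P.w0) = LinearMap.adjoint P.A v - P.w0 :=
      (exists_adjoint_apply_iff hP hx _).1 ⟨v, hv, by abel⟩
    have h := norm_kerPart_le_of_apply_eq_self (psi := P.w0) hPi hD hy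
    rw [add_sub_cancel, ← proj_space_apply] at h
    exact pow_le_pow_left₀ (norm_nonneg _) h 2

theorem norm_w0_add_sq (hP : P.IsNormalized) {y : H} (hy : P.Pi y = y) :
    ‖P.w0 + y‖ ^ 2 = 1 + ‖y‖ ^ 2 := by
  have h : ⟪P.w0, y⟫_ℂ = 0 :=
    inner_apply_eq_zero_of_apply_eq_zero (proj_isSymmetricProjection _) P.Pi_w0 hy
  have h2 := norm_add_sq_eq_norm_sq_add_norm_sq_of_inner_eq_zero P.w0 y h
  rw [← sq, ← sq, ← sq, hP] at h2
  rw [h2, one_pow]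

theorem negWitnessSize_eq (hP : P.IsNormalized) (hx : P.IsPositive x) :
    P.negWitnessSize x = 1 + transductionComplexity P.Pi (P.Delta x) P.w0 := by
  have hPi : P.Pi.IsSymmetricProjection := proj_isSymmetricProjection _
  have hD : (P.Delta x).IsSymmetricProjection := proj_isSymmetricProjection _
  have hw := apply_catalyst_left hPi hD P.w0
  refine IsLeast.csInf_eq ⟨?_, ?_⟩
  · obtain ⟨v, hv, hA⟩ := (exists_adjoint_apply_iff hP hx _).2 hw
    refine ⟨v, ?_, ?_, ?_⟩
    · rw [← inner_conj_symm, hv, map_one]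
    · rw [hA, proj_space_apply, add_catalyst_sub_apply hPi hD P.Pi_w0, negError_eq hP hx]
    · rw [hA, norm_w0_add_sq hP hw, transductionComplexity]
  · rintro r ⟨v, hv, he, rfl⟩
    have hv' : ⟪P.target, v⟫_ℂ = 1 := by rw [← inner_conj_symm, hv, map_one]
    set y := LinearMap.adjoint P.A v - P.w0 with hydef
    have hvy : LinearMap.adjoint P.A v = P.w0 + y := by rw [hydef]; abel
    have hy : P.Pi y = y := (exists_adjoint_apply_iff hP hx _).1 ⟨v, hv', hvy⟩
    rw [hvy, proj_space_apply, negError_eq hP hx] at he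
    have h := inner_catalyst_sub_eq_zero hPi hD P.Pi_w0 hy he
    have h2 := norm_add_sq_eq_norm_sq_add_norm_sq_of_inner_eq_zero _ _ h
    rw [add_sub_cancel] at h2
    rw [hvy, norm_w0_add_sq hP hy, transductionComplexity]
    nlinarith [norm_nonneg (y - catalyst P.Pi (P.Delta x) P.w0)]

end SpanProgram

/-! ### The sign of a shift read off from the autocorrelation of an isometry -/

section Autocorrelation

variable {E : Type*} [NormedAddCommGroup E] [InnerProductSpace ℂ E]

/-- The sum of `Im ⟨χ, Q ^ k χ⟩` over all pairs `k < m < K`. -/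
def imSum (Q : E →ₗ[ℂ] E) (chi : E) (K : ℕ) : ℝ :=
  ∑ m ∈ Finset.range K, ∑ k ∈ Finset.range m, (⟪chi, (Q ^ k) chi⟫_ℂ).im

variable {Q : E →ₗ[ℂ] E} {chi zeta : E} {t : ℝ}

/-- Since Q^{m+1}ζ = Q^m ζ + i t Q^m χ, each step lowers Re⟨χ, Q^m ζ⟩ by t Im⟨χ, Q^m χ⟩; the
starting value is 1/2. -/
theorem mul_sum_im_inner (hz : Q zeta - zeta = (Complex.I * t) • chi)
    (hc : ⟪chi, zeta⟫_ℂ = (1 - Complex.I * t) / 2) (m : ℕ) :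
    t * ∑ k ∈ Finset.range m, (⟪chi, (Q ^ k) chi⟫_ℂ).im =
      1 / 2 - (⟪chi, (Q ^ m) zeta⟫_ℂ).re := by
  induction m with
  | zero => simp [hc]
  | succ m ih =>
    have h1 : (Q ^ (m + 1)) zeta = (Q ^ m) zeta + (Complex.I * t) • (Q ^ m) chi := by
      rw [← map_smul, ← hz, map_sub, pow_succ, Module.End.mul_apply]
      abel
    rw [Finset.sum_range_succ, mul_add, ih, h1, inner_add_right, inner_smul_right]
    simp
    ring

theorem mul_imSum (hz : Q zeta - zeta = (Complex.I * t) • chi)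
    (hc : ⟪chi, zeta⟫_ℂ = (1 - Complex.I * t) / 2) (K : ℕ) :
    t * imSum Q chi K = K / 2 - (⟪chi, ∑ m ∈ Finset.range K, (Q ^ m) zeta⟫_ℂ).re := by
  rw [imSum, Finset.mul_sum, inner_sum, Complex.re_sum]
  simp_rw [mul_sum_im_inner hz hc]
  rw [Finset.sum_sub_distrib, Finset.sum_const, Finset.card_range, nsmul_eq_mul]
  ring

theorem inner_map_map_of_norm (hQ : ∀ v, ‖Q v‖ = ‖v‖) (u v : E) : ⟪Q u, Q v⟫_ℂ = ⟪u, v⟫_ℂ :=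
  (⟨Q, hQ⟩ : E →ₗᵢ[ℂ] E).inner_map_map u v

theorem norm_pow_apply (hQ : ∀ v, ‖Q v‖ = ‖v‖) (k : ℕ) (v : E) : ‖(Q ^ k) v‖ = ‖v‖ := by
  induction k with
  | zero => simp
  | succ k ih => rw [pow_succ', Module.End.mul_apply, hQ, ih]

/-- Replace i t χ by Qζ − ζ. For an isometry the sum telescopes, and two inner products of vectors
of norm ‖ζ‖ remain. -/
theorem abs_mul_norm_inner_sum_le (hQ : ∀ v, ‖Q v‖ = ‖v‖)
    (hz : Q zeta - zeta = (Complex.I * t) • chi) (K : ℕ) :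
    |t| * ‖⟪chi, ∑ m ∈ Finset.range K, (Q ^ m) zeta⟫_ℂ‖ ≤ 2 * ‖zeta‖ ^ 2 := by
  have h1 : |t| * ‖⟪chi, ∑ m ∈ Finset.range K, (Q ^ m) zeta⟫_ℂ‖ =
      ‖⟪Q zeta - zeta, ∑ m ∈ Finset.range K, (Q ^ m) zeta⟫_ℂ‖ := by
    rw [hz, inner_smul_left, norm_mul, RCLike.norm_conj, norm_mul, Complex.norm_I, one_mul,
      Complex.norm_real, Real.norm_eq_abs]
  rw [h1]
  have h2 : ∀ K : ℕ, ⟪Q zeta - zeta, ∑ m ∈ Finset.range (K + 1), (Q ^ m) zeta⟫_ℂ =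
      ⟪Q zeta, zeta⟫_ℂ - ⟪zeta, (Q ^ K) zeta⟫_ℂ := by
    intro K
    induction K with
    | zero => simp
    | succ K ih =>
      have h3 : (Q ^ (K + 1)) zeta = Q ((Q ^ K) zeta) := by
        rw [pow_succ', Module.End.mul_apply]
      have h4 : ⟪Q zeta, (Q ^ (K + 1)) zeta⟫_ℂ = ⟪zeta, (Q ^ K) zeta⟫_ℂ := by
        rw [h3, inner_map_map_of_norm hQ]
      rw [Finset.sum_range_succ, inner_add_right, ih, inner_sub_left, h4]
      ring
  cases K with
  | zero => simp
  | succ K =>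
    rw [h2]
    refine (norm_sub_le _ _).trans ?_
    have a1 := norm_inner_le_norm (𝕜 := ℂ) (Q zeta) zeta
    have a2 := norm_inner_le_norm (𝕜 := ℂ) zeta ((Q ^ K) zeta)
    rw [hQ] at a1
    rw [norm_pow_apply hQ] at a2
    linarith [sq ‖zeta‖]

/-- As soon as K|t| is large compared with ‖ζ‖², the main term K/2 wins and the double sum has the
sign of t. -/
theorem abs_mul_mul_imSum_sub_le (hQ : ∀ v, ‖Q v‖ = ‖v‖)
    (hz : Q zeta - zeta = (Complex.I * t) • chi)
    (hc : ⟪chi, zeta⟫_ℂ = (1 - Complex.I * t) / 2) (K : ℕ) :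
    |t| * |t * imSum Q chi K - K / 2| ≤ 2 * ‖zeta‖ ^ 2 := by
  refine le_trans ?_ (abs_mul_norm_inner_sum_le hQ hz K)
  rw [mul_imSum hz hc]
  refine mul_le_mul_of_nonneg_left ?_ (abs_nonneg _)
  rw [sub_sub_cancel_left, abs_neg]
  exact Complex.abs_re_le_norm _

/-- If `t` is negative of the right order of magnitude, the imaginary parts average to a
negative constant. -/
theorem imSum_le (hQ : ∀ v, ‖Q v‖ = ‖v‖)
    (hz : Q zeta - zeta = (Complex.I * t) • chi)
    (hc : ⟪chi, zeta⟫_ℂ = (1 - Complex.I * t) / 2) {K : ℕ} (hK : 6 ≤ K * -t) (hK' : K * -t ≤ 24)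
    (hB : ‖zeta‖ ^ 2 ≤ 2 / 3) : imSum Q chi K ≤ -(K ^ 2 / 96) := by
  have h := abs_mul_mul_imSum_sub_le hQ hz hc K
  have hKn : (0 : ℝ) ≤ K := Nat.cast_nonneg K
  have ht : t < 0 := by
    by_contra ht
    nlinarith [mul_nonneg hKn (not_lt.1 ht)]
  rw [abs_of_neg ht] at h
  have h1 := neg_abs_le (t * imSum Q chi K - K / 2)
  have h2 : -t * -(t * imSum Q chi K - K / 2) ≤ 4 / 3 := by
    nlinarith [mul_le_mul_of_nonneg_left (neg_le_abs (t * imSum Q chi K - K / 2))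
      (neg_nonneg.2 ht.le)]
  -- in terms of `s = -t > 0`
  set s := -t with hs
  have hs0 : 0 < s := by linarith
  have hts : t = -s := by rw [hs, neg_neg]
  rw [hts] at h2
  have hK0 : (0 : ℝ) < K := by
    by_contra hneg
    nlinarith [mul_nonpos_of_nonpos_of_nonneg (not_lt.1 hneg) hs0.le]
  -- K s ≥ 6 gives 4/3 ≤ K s / 4, so half of the main term K s / 2 survives the error.
  have h3 : s * (s * imSum Q chi K) ≤ -(K * s / 4) := by nlinarith
  have h4 : s * imSum Q chi K ≤ -(K / 4) := by
    by_contra hneg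
    nlinarith [mul_lt_mul_of_pos_left (not_le.1 hneg) hs0]
  have h5 : K * s * imSum Q chi K ≤ -(K ^ 2 / 4) := by
    nlinarith [mul_le_mul_of_nonneg_left h4 hK0.le]
  by_contra hneg
  have h6 := not_le.1 hneg
  have hKs : 0 < K * s := mul_pos hK0 hs0
  nlinarith [mul_lt_mul_of_pos_left h6 hKs, mul_le_mul_of_nonneg_right hK' (sq_nonneg (K : ℝ))]

/-- If `t` is positive and not too small, the imaginary parts average to a nonnegative number. -/
theorem imSum_nonneg (hQ : ∀ v, ‖Q v‖ = ‖v‖)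
    (hz : Q zeta - zeta = (Complex.I * t) • chi)
    (hc : ⟪chi, zeta⟫_ℂ = (1 - Complex.I * t) / 2) {K : ℕ} (ht : 0 < t)
    (hB : 4 * ‖zeta‖ ^ 2 ≤ K * t) : 0 ≤ imSum Q chi K := by
  have h := abs_mul_mul_imSum_sub_le hQ hz hc K
  rw [abs_of_pos ht] at h
  have h1 : t * -(t * imSum Q chi K - K / 2) ≤ 2 * ‖zeta‖ ^ 2 :=
    le_trans (mul_le_mul_of_nonneg_left (neg_le_abs _) ht.le) h
  have h2 : 0 ≤ t * (t * imSum Q chi K) := by nlinarith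
  have h3 := nonneg_of_mul_nonneg_right (b := t * imSum Q chi K) (a := t) h2 ht
  exact nonneg_of_mul_nonneg_right h3 ht

end Autocorrelation

/-! ### The phase-detection unitary -/

section Detector

variable {H : Type*} [NormedAddCommGroup H] [InnerProductSpace ℂ H] [FiniteDimensional ℂ H]

/-- The operator acting as `1` on the range of a projector and as `z` on its kernel. -/
def phaseOp (z : ℂ) (Q : H →ₗ[ℂ] H) : H →ₗ[ℂ] H := Q + z • (LinearMap.id - Q)

theorem phaseOp_apply (z : ℂ) (Q : H →ₗ[ℂ] H) (v : H) : phaseOp z Q v = Q v + z • (v - Q v) := rfl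

theorem norm_phaseOp {z : ℂ} (hz : ‖z‖ = 1) {Q : H →ₗ[ℂ] H} (hQ : Q.IsSymmetricProjection)
    (v : H) : ‖phaseOp z Q v‖ = ‖v‖ := by
  have h0 : ⟪Q v, v - Q v⟫_ℂ = 0 := by
    rw [hQ.isSymmetric, map_sub, apply_apply_of_isSymmetricProjection hQ, sub_self,
      inner_zero_right]
  have h1 : ⟪Q v, z • (v - Q v)⟫_ℂ = 0 := by rw [inner_smul_right, h0, mul_zero]
  have e1 := norm_add_sq_eq_norm_sq_add_norm_sq_of_inner_eq_zero _ _ h0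
  have e2 := norm_add_sq_eq_norm_sq_add_norm_sq_of_inner_eq_zero _ _ h1
  rw [norm_smul, hz, one_mul] at e2
  rw [add_sub_cancel] at e1
  rw [← e1] at e2
  exact (mul_self_inj (norm_nonneg _) (norm_nonneg _)).1 e2

/-- The phase `(1 - iτ) / (1 + iτ)`. -/
def cayley (tau : ℝ) : ℂ := (1 - Complex.I * tau) / (1 + Complex.I * tau)

theorem one_add_I_mul_ne_zero (tau : ℝ) : (1 + Complex.I * tau : ℂ) ≠ 0 := by
  intro h
  simpa using congrArg Complex.re h

theorem norm_cayley (tau : ℝ) : ‖cayley tau‖ = 1 := by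
  have h : (1 - Complex.I * tau : ℂ) = starRingEnd ℂ (1 + Complex.I * tau) := by simp; ring
  rw [cayley, norm_div, h, RCLike.norm_conj,
    div_self (norm_ne_zero_iff.2 (one_add_I_mul_ne_zero tau))]

/-- This scalar and the next one invert 1 − S on the eigenvalues −z and z. -/
theorem one_add_cayley_mul (tau : ℝ) : (1 + cayley tau) * ((1 + Complex.I * tau) / 2) = 1 := by
  have := one_add_I_mul_ne_zero tau
  rw [cayley]
  field_simp
  ring

theorem one_sub_cayley_mul {tau : ℝ} (htau : tau ≠ 0) :
    (1 - cayley tau) * ((1 - Complex.I / tau) / 2) = 1 := by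
  have := one_add_I_mul_ne_zero tau
  have h2 : (tau : ℂ) ≠ 0 := by exact_mod_cast htau
  rw [cayley]
  field_simp
  ring_nf
  simp

/-- The diluted initial state `(cos β ψ, sin β ψ)`. -/
def chi (cb sb : ℝ) (psi : H) : WithLp 2 (H × H) := WithLp.toLp 2 ((cb : ℂ) • psi, (sb : ℂ) • psi)

/-- The operator `(u, v) ↦ (-Φ u, Φ U v)`, where `Φ` is `1` on the range of `Π` and `z` on its
kernel. -/
def stepOp (z : ℂ) (Pi Delta : H →ₗ[ℂ] H) : WithLp 2 (H × H) →ₗ[ℂ] WithLp 2 (H × H) where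
  toFun x := WithLp.toLp 2 (-phaseOp z Pi x.fst, phaseOp z Pi (walk Pi Delta x.snd))
  map_add' x y := by
    apply (WithLp.equiv 2 (H × H)).injective
    simp [add_comm]
  map_smul' c x := by
    apply (WithLp.equiv 2 (H × H)).injective
    simp

/-- The reflection `1 - 2|χ⟩⟨χ|`. -/
def houseOp {E : Type*} [NormedAddCommGroup E] [InnerProductSpace ℂ E] (c : E) : E →ₗ[ℂ] E where
  toFun x := x - (2 * ⟪c, x⟫_ℂ) • c
  map_add' x y := by
    rw [inner_add_right]
    module
  map_smul' a x := by
    rw [inner_smul_right, RingHom.id_apply]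
    module

/-- The phase-detection unitary. -/
def detector (tau cb sb : ℝ) (Pi Delta : H →ₗ[ℂ] H) (psi : H) :
    WithLp 2 (H × H) →ₗ[ℂ] WithLp 2 (H × H) :=
  houseOp (chi cb sb psi) ∘ₗ stepOp (cayley tau) Pi Delta

variable {Pi Delta : H →ₗ[ℂ] H} {psi : H} {tau cb sb : ℝ}

theorem norm_chi (hcs : cb ^ 2 + sb ^ 2 = 1) (hnorm : ‖psi‖ = 1) : ‖chi cb sb psi‖ = 1 := by
  have h : ‖chi cb sb psi‖ ^ 2 = 1 := by
    rw [WithLp.prod_norm_sq_eq_of_L2, chi]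
    simp [norm_smul, hnorm, hcs]
  exact (pow_eq_one_iff_of_nonneg (norm_nonneg _) two_ne_zero).1 h

theorem norm_houseOp {E : Type*} [NormedAddCommGroup E] [InnerProductSpace ℂ E] {c : E}
    (hc : ‖c‖ = 1) (x : E) : ‖houseOp c x‖ = ‖x‖ := by
  have hcc : ⟪c, c⟫_ℂ = 1 := by rw [inner_self_eq_norm_sq_to_K, hc]; norm_num
  have h : ⟪houseOp c x, houseOp c x⟫_ℂ = ⟪x, x⟫_ℂ := by
    change ⟪x - (2 * ⟪c, x⟫_ℂ) • c, x - (2 * ⟪c, x⟫_ℂ) • c⟫_ℂ = _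
    rw [inner_sub_left, inner_sub_right, inner_sub_right, inner_smul_left, inner_smul_left,
      inner_smul_right, inner_smul_right, hcc, map_mul, inner_conj_symm, map_ofNat]
    ring
  rw [inner_self_eq_norm_sq_to_K, inner_self_eq_norm_sq_to_K] at h
  have h' : ‖houseOp c x‖ ^ 2 = ‖x‖ ^ 2 := by exact_mod_cast h
  exact (sq_eq_sq₀ (norm_nonneg _) (norm_nonneg _)).1 h'

theorem norm_stepOp {z : ℂ} (hz : ‖z‖ = 1) (hPi : Pi.IsSymmetricProjection)
    (hD : Delta.IsSymmetricProjection) (x : WithLp 2 (H × H)) :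
    ‖stepOp z Pi Delta x‖ = ‖x‖ := by
  refine (sq_eq_sq₀ (norm_nonneg _) (norm_nonneg _)).1 ?_
  rw [WithLp.prod_norm_sq_eq_of_L2, WithLp.prod_norm_sq_eq_of_L2]
  simp [stepOp, norm_phaseOp hz hPi, norm_walk hPi hD]

theorem norm_detector (hPi : Pi.IsSymmetricProjection) (hD : Delta.IsSymmetricProjection)
    (hcs : cb ^ 2 + sb ^ 2 = 1) (hnorm : ‖psi‖ = 1) (x : WithLp 2 (H × H)) :
    ‖detector tau cb sb Pi Delta psi x‖ = ‖x‖ := by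
  rw [detector, LinearMap.comp_apply, norm_houseOp (norm_chi hcs hnorm),
    norm_stepOp (norm_cayley tau) hPi hD]

/-- The vector `ζ` with `(1 - U'') ζ = χ`. -/
def witnessVec (tau cb sb : ℝ) (Pi Delta : H →ₗ[ℂ] H) (psi : H) : WithLp 2 (H × H) :=
  WithLp.toLp 2 (((1 + Complex.I * tau) / 2 * cb) • psi,
    (sb : ℂ) • (((1 - Complex.I / tau) / 2) • kerPart Pi Delta psi +
      ((1 + Complex.I * tau) / 2) •
        (psi - kerPart Pi Delta psi + catalyst Pi Delta psi)))

theorem stepOp_toLp (z : ℂ) (Pi Delta : H →ₗ[ℂ] H) (u v : H) :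
    stepOp z Pi Delta (WithLp.toLp 2 (u, v)) =
      WithLp.toLp 2 (-phaseOp z Pi u, phaseOp z Pi (walk Pi Delta v)) := rfl

/-- S multiplies g by z, and ψ in the first summand and ψ − g in the second by −z. The accompanying
catalyst is in the range of Π, where Φ is 1, so it is returned unchanged and cancels. -/
theorem witnessVec_sub_stepOp (hPi : Pi.IsSymmetricProjection) (hD : Delta.IsSymmetricProjection)
    (hpsi : Pi psi = 0) (htau : tau ≠ 0) :
    witnessVec tau cb sb Pi Delta psi -
      stepOp (cayley tau) Pi Delta (witnessVec tau cb sb Pi Delta psi) = chi cb sb psi := by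
  have h1 := one_add_cayley_mul tau
  have h2 := one_sub_cayley_mul htau
  have hU1 := walk_kerPart Pi Delta psi
  have hU2 := walk_add_catalyst hPi hD hpsi
  rw [witnessVec, stepOp_toLp, ← WithLp.toLp_sub, Prod.mk_sub_mk, chi]
  set w := catalyst Pi Delta psi with hw
  set g := kerPart Pi Delta psi with hg
  have hPw : Pi w = w := apply_catalyst_left hPi hD psi
  have hPg : Pi g = 0 := apply_kerPart_left Pi Delta psi
  congr 2
  · rw [phaseOp_apply, map_smul, hpsi]
    match_scalars
    linear_combination (cb : ℂ) * h1
  · have e : walk Pi Delta ((sb : ℂ) • (((1 - Complex.I / tau) / 2) • g +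
        ((1 + Complex.I * tau) / 2) • (psi - g + w))) =
        (sb : ℂ) • (((1 - Complex.I / tau) / 2) • g +
        ((1 + Complex.I * tau) / 2) • (-(psi - g) + w)) := by
      rw [map_smul, map_add, map_smul, map_smul, hU1, hU2]
    rw [e]
    simp only [phaseOp_apply, map_add, map_smul, map_neg, map_sub, hpsi, hPg, hPw]
    match_scalars
    · linear_combination (sb : ℂ) * h2 - (sb : ℂ) * h1
    · linear_combination (sb : ℂ) * h1
    · ring

theorem inner_catalyst_of_apply_eq_zero (hPi : Pi.IsSymmetricProjection)
    (hD : Delta.IsSymmetricProjection) {v : H} (hv : Pi v = 0) :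
    ⟪v, catalyst Pi Delta psi⟫_ℂ = 0 :=
  inner_apply_eq_zero_of_apply_eq_zero hPi hv (apply_catalyst_left hPi hD psi)

/-- The real part is 1/2 because S is an isometry taking ζ to ζ − χ. In the imaginary part the
contribution −1/τ of g competes with the contribution τ of everything else; `hy` makes them balance
at y = 1. -/
theorem inner_chi_witnessVec (hPi : Pi.IsSymmetricProjection) (hD : Delta.IsSymmetricProjection)
    (hpsi : Pi psi = 0) (hnorm : ‖psi‖ = 1) (htau : tau ≠ 0) (hcs : cb ^ 2 + sb ^ 2 = 1)
    {y : ℝ} (hy : sb ^ 2 * (1 + tau ^ 2) * ‖kerPart Pi Delta psi‖ ^ 2 = y * tau ^ 2) :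
    ⟪chi cb sb psi, witnessVec tau cb sb Pi Delta psi⟫_ℂ =
      (1 - Complex.I * (tau * (y - 1) : ℝ)) / 2 := by
  have h1 : ⟪psi, psi⟫_ℂ = 1 := by rw [inner_self_eq_norm_sq_to_K, hnorm]; norm_num
  have htau' : (tau : ℂ) ≠ 0 := by exact_mod_cast htau
  have hcs' : (cb : ℂ) ^ 2 + (sb : ℂ) ^ 2 = 1 := by exact_mod_cast hcs
  rw [WithLp.prod_inner_apply, chi, witnessVec]
  simp only [inner_smul_left, inner_smul_right, inner_add_right, inner_sub_right, h1,
    inner_kerPart, inner_catalyst_of_apply_eq_zero hPi hD hpsi, Complex.conj_ofReal]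
  set p := ‖kerPart Pi Delta psi‖ ^ 2
  have hy' : (sb : ℂ) ^ 2 * (1 + (tau : ℂ) ^ 2) * (p : ℂ) = y * (tau : ℂ) ^ 2 := by
    exact_mod_cast hy
  have hI := Complex.I_sq
  push_cast
  field_simp
  linear_combination (tau : ℂ) * (1 + tau * Complex.I) * hcs' - Complex.I * hy'

/-- As Sζ = ζ − χ, the reflection gives Qζ = ζ + (1 − 2⟨χ, ζ⟩)χ, and the real part of the
coefficient vanishes. -/
theorem detector_witnessVec (hPi : Pi.IsSymmetricProjection) (hD : Delta.IsSymmetricProjection)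
    (hpsi : Pi psi = 0) (hnorm : ‖psi‖ = 1) (htau : tau ≠ 0) (hcs : cb ^ 2 + sb ^ 2 = 1)
    {y : ℝ} (hy : sb ^ 2 * (1 + tau ^ 2) * ‖kerPart Pi Delta psi‖ ^ 2 = y * tau ^ 2) :
    detector tau cb sb Pi Delta psi (witnessVec tau cb sb Pi Delta psi) -
      witnessVec tau cb sb Pi Delta psi =
        (Complex.I * (tau * (y - 1) : ℝ)) • chi cb sb psi := by
  have h1 := witnessVec_sub_stepOp (cb := cb) (sb := sb) hPi hD hpsi htau
  have h2 := inner_chi_witnessVec hPi hD hpsi hnorm htau hcs hy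
  have h3 : stepOp (cayley tau) Pi Delta (witnessVec tau cb sb Pi Delta psi) =
      witnessVec tau cb sb Pi Delta psi - chi cb sb psi := by rw [← h1]; abel
  have h4 : ⟪chi cb sb psi, chi cb sb psi⟫_ℂ = 1 := by
    rw [inner_self_eq_norm_sq_to_K, norm_chi hcs hnorm]; norm_num
  rw [detector, LinearMap.comp_apply, h3]
  change _ - chi cb sb psi - (2 * ⟪chi cb sb psi, _⟫_ℂ) • chi cb sb psi - _ = _
  rw [inner_sub_right, h2, h4]
  module

theorem norm_toLp_sq (u v : H) : ‖WithLp.toLp 2 (u, v)‖ ^ 2 = ‖u‖ ^ 2 + ‖v‖ ^ 2 :=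
  WithLp.prod_norm_sq_eq_of_L2 _

/-- The vectors g, ψ − g and w are pairwise orthogonal. -/
theorem norm_witnessVec_sq (hPi : Pi.IsSymmetricProjection) (hD : Delta.IsSymmetricProjection)
    (hpsi : Pi psi = 0) (hnorm : ‖psi‖ = 1) (htau : tau ≠ 0) :
    ‖witnessVec tau cb sb Pi Delta psi‖ ^ 2 = (1 + tau ^ 2) / 4 *
      (cb ^ 2 + sb ^ 2 * (‖kerPart Pi Delta psi‖ ^ 2 / tau ^ 2 +
        (1 - ‖kerPart Pi Delta psi‖ ^ 2) + transductionComplexity Pi Delta psi)) := by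
  set g := kerPart Pi Delta psi with hg
  set w := catalyst Pi Delta psi with hw
  have hPg : Pi g = 0 := apply_kerPart_left Pi Delta psi
  have n1 : ‖(1 + Complex.I * tau) / 2‖ ^ 2 = (1 + tau ^ 2) / 4 := by
    rw [← Complex.normSq_eq_norm_sq, Complex.normSq_apply]
    simp
    ring
  have n2 : ‖(1 - Complex.I / tau) / 2‖ ^ 2 = (1 + tau ^ 2) / 4 / tau ^ 2 := by
    rw [← Complex.normSq_eq_norm_sq, Complex.normSq_apply]
    simp
    field_simp
    ring
  have hgg : ⟪g, g⟫_ℂ = (‖g‖ ^ 2 : ℝ) := by rw [inner_self_eq_norm_sq_to_K]; norm_cast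
  have hgp : ⟪g, psi⟫_ℂ = (‖g‖ ^ 2 : ℝ) := by
    rw [← inner_conj_symm, inner_kerPart, Complex.conj_ofReal]
  have o1 : ⟪psi - g, w⟫_ℂ = 0 :=
    inner_catalyst_of_apply_eq_zero hPi hD (by rw [map_sub, hpsi, hPg, sub_zero])
  have o2 : ⟪g, psi - g⟫_ℂ = 0 := by rw [inner_sub_right, hgp, hgg, sub_self]
  have o3 : ⟪g, w⟫_ℂ = 0 := inner_catalyst_of_apply_eq_zero hPi hD hPg
  have e1 : ‖psi - g‖ ^ 2 = 1 - ‖g‖ ^ 2 := by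
    have := norm_add_sq_eq_norm_sq_add_norm_sq_of_inner_eq_zero _ _ o2
    rw [add_sub_cancel, hnorm] at this
    linarith
  have e2 : ‖psi - g + w‖ ^ 2 = 1 - ‖g‖ ^ 2 + ‖w‖ ^ 2 := by
    have := norm_add_sq_eq_norm_sq_add_norm_sq_of_inner_eq_zero _ _ o1
    rw [← e1]
    linarith
  have o4 : ⟪((1 - Complex.I / tau) / 2) • g, ((1 + Complex.I * tau) / 2) • (psi - g + w)⟫_ℂ = 0 := by
    rw [inner_smul_left, inner_smul_right, inner_add_right, o2, o3]
    simp
  have e3 := norm_add_sq_eq_norm_sq_add_norm_sq_of_inner_eq_zero _ _ o4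
  rw [← sq, ← sq, ← sq, norm_smul, norm_smul, mul_pow, mul_pow, n1, n2, e2] at e3
  rw [witnessVec, norm_toLp_sq, norm_smul, norm_mul, mul_pow, mul_pow, n1, hnorm,
    norm_smul (sb : ℂ), mul_pow, ← hg, ← hw, e3, transductionComplexity, ← hw,
    Complex.norm_real, Complex.norm_real, Real.norm_eq_abs, Real.norm_eq_abs, sq_abs, sq_abs]
  ring

end Detector

/-! ### The test of a candidate under the promise on σ -/

section Promise

variable {H : Type*} [NormedAddCommGroup H] [InnerProductSpace ℂ H] [FiniteDimensional ℂ H]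
  {Pi Delta : H →ₗ[ℂ] H} {psi : H} {sigma : ℝ}

/-- The promise on an instance of the estimation problem. -/
structure Promise (sigma : ℝ) (Pi Delta : H →ₗ[ℂ] H) (psi : H) : Prop where
  isSymmetricProjection_left : Pi.IsSymmetricProjection
  isSymmetricProjection_right : Delta.IsSymmetricProjection
  norm_eq_one : ‖psi‖ = 1
  apply_eq_zero : Pi psi = 0
  kerPart_ne_zero : kerPart Pi Delta psi ≠ 0
  sqrt_omega_mul_le : √(omega Pi Delta psi * transductionComplexity Pi Delta psi) ≤ sigma
  sqrt_omega_le : √(omega Pi Delta psi) ≤ sigma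

theorem Promise.norm_kerPart_sq_pos (h : Promise sigma Pi Delta psi) :
    0 < ‖kerPart Pi Delta psi‖ ^ 2 :=
  pow_pos (norm_pos_iff.2 h.kerPart_ne_zero) 2

theorem Promise.omega_mul (h : Promise sigma Pi Delta psi) :
    omega Pi Delta psi * ‖kerPart Pi Delta psi‖ ^ 2 = 1 :=
  one_div_mul_cancel h.norm_kerPart_sq_pos.ne'

theorem Promise.one_le_omega (h : Promise sigma Pi Delta psi) : 1 ≤ omega Pi Delta psi :=
  WitnessSize.one_le_omega h.norm_eq_one h.kerPart_ne_zero

theorem Promise.one_le (h : Promise sigma Pi Delta psi) : 1 ≤ sigma :=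
  (Real.one_le_sqrt.2 h.one_le_omega).trans h.sqrt_omega_le

theorem Promise.omega_le (h : Promise sigma Pi Delta psi) : omega Pi Delta psi ≤ sigma ^ 2 :=
  (Real.sqrt_le_left (by linarith [h.one_le])).1 h.sqrt_omega_le

theorem Promise.omega_mul_le (h : Promise sigma Pi Delta psi) :
    omega Pi Delta psi * transductionComplexity Pi Delta psi ≤ sigma ^ 2 :=
  (Real.sqrt_le_left (by linarith [h.one_le])).1 h.sqrt_omega_mul_le

/-- The parameter `τ = 1 / (8 σ)`. -/
def scale (sigma : ℝ) : ℝ := 1 / (8 * sigma)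

/-- The amplitude `sin β` used to test the candidate value `v` for `ω`. -/
def sinAmp (sigma v : ℝ) : ℝ := √(v * scale sigma ^ 2 / (1 + scale sigma ^ 2))

/-- The amplitude `cos β` used to test the candidate value `v` for `ω`. -/
def cosAmp (sigma v : ℝ) : ℝ := √(1 - sinAmp sigma v ^ 2)

theorem sinAmp_sq {v : ℝ} (hv : 0 ≤ v) :
    sinAmp sigma v ^ 2 = v * scale sigma ^ 2 / (1 + scale sigma ^ 2) :=
  Real.sq_sqrt (by positivity)

/-- The bound 64σ² is 1/τ²: up to there the prescribed sin² β does not exceed 1. -/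
theorem sinAmp_sq_le_one {v : ℝ} (hs : 1 ≤ sigma) (hv : 0 ≤ v) (hv' : v ≤ 64 * sigma ^ 2) :
    sinAmp sigma v ^ 2 ≤ 1 := by
  rw [sinAmp_sq hv, div_le_one (by positivity), scale]
  have h0 : 0 < sigma := by linarith
  have : v * (1 / (8 * sigma)) ^ 2 ≤ 1 := by
    rw [one_div, inv_pow, ← div_eq_mul_inv, div_le_iff₀ (by positivity)]
    linarith
  linarith [sq_nonneg (1 / (8 * sigma))]

theorem cosAmp_sq_add_sinAmp_sq {v : ℝ} (hs : 1 ≤ sigma) (hv : 0 ≤ v)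
    (hv' : v ≤ 64 * sigma ^ 2) : cosAmp sigma v ^ 2 + sinAmp sigma v ^ 2 = 1 := by
  rw [cosAmp, Real.sq_sqrt (by linarith [sinAmp_sq_le_one hs hv hv'])]
  ring

/-- The catalyst has weight sin² β ≈ vτ² and W ≤ σ²p by the promise. As τσ = 1/8, it contributes at
most vp/256; g contributes vp/4, and the rest is about 1/4. -/
theorem Promise.norm_witnessVec_sq_le (h : Promise sigma Pi Delta psi) {v : ℝ} (hv : 0 ≤ v)
    (hv' : v ≤ 64 * sigma ^ 2) :
    ‖witnessVec (scale sigma) (cosAmp sigma v) (sinAmp sigma v) Pi Delta psi‖ ^ 2 ≤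
      (1 + v * ‖kerPart Pi Delta psi‖ ^ 2) / 3 := by
  have h1 := h.one_le
  have ht : 0 < scale sigma := by rw [scale]; positivity
  have hcs := cosAmp_sq_add_sinAmp_sq h1 hv hv'
  rw [norm_witnessVec_sq h.isSymmetricProjection_left h.isSymmetricProjection_right
    h.apply_eq_zero h.norm_eq_one ht.ne']
  have hp := h.norm_kerPart_sq_pos
  have hom := h.omega_mul
  have hW := h.omega_mul_le
  set p := ‖kerPart Pi Delta psi‖ ^ 2
  set W := transductionComplexity Pi Delta psi
  set t := scale sigma with htdef
  have hss : sinAmp sigma v ^ 2 * (1 + t ^ 2) = v * t ^ 2 := by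
    rw [sinAmp_sq hv, ← htdef]; field_simp
  have hts : t ^ 2 * sigma ^ 2 = 1 / 64 := by
    rw [htdef, scale]; field_simp; norm_num
  have ht2 : t ^ 2 ≤ 1 / 64 := by nlinarith [sq_nonneg t, one_le_pow₀ (n := 2) h1]
  have hWp : W ≤ sigma ^ 2 * p := by
    have := mul_le_mul_of_nonneg_right hW hp.le
    calc W = omega Pi Delta psi * p * W := by rw [hom, one_mul]
      _ = omega Pi Delta psi * W * p := by ring
      _ ≤ _ := this
  have e : (1 + t ^ 2) / 4 * (cosAmp sigma v ^ 2 + sinAmp sigma v ^ 2 * (p / t ^ 2 + (1 - p) + W)) =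
      (1 + t ^ 2) / 4 * (cosAmp sigma v ^ 2 + sinAmp sigma v ^ 2) + v * p / 4
        - (sinAmp sigma v ^ 2 * (1 + t ^ 2)) * p / 4 + v * (t ^ 2 * W) / 4 := by
    have : v * p = sinAmp sigma v ^ 2 * (1 + t ^ 2) * (p / t ^ 2) := by rw [hss]; field_simp
    have h2 : v * (t ^ 2 * W) = sinAmp sigma v ^ 2 * (1 + t ^ 2) * W := by rw [hss]; ring
    rw [this, h2]
    ring
  rw [e, hcs, hss]
  have h3 : t ^ 2 * W ≤ p / 64 := by
    calc t ^ 2 * W ≤ t ^ 2 * (sigma ^ 2 * p) := mul_le_mul_of_nonneg_left hWp (sq_nonneg t)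
      _ = p / 64 := by rw [← mul_assoc, hts]; ring
  have h4 : v * (t ^ 2 * W) ≤ v * (p / 64) := mul_le_mul_of_nonneg_left h3 hv
  have h5 : 0 ≤ v * t ^ 2 * p := by positivity
  have h6 : 0 ≤ v * p := by positivity
  linarith

/-- The unitary that tests the candidate value `v` for `ω`. -/
def tester (sigma v : ℝ) (Pi Delta : H →ₗ[ℂ] H) (psi : H) :
    WithLp 2 (H × H) →ₗ[ℂ] WithLp 2 (H × H) :=
  detector (scale sigma) (cosAmp sigma v) (sinAmp sigma v) Pi Delta psi

/-- The normalised signal obtained from `tester`. -/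
def signal (sigma v : ℝ) (Pi Delta : H →ₗ[ℂ] H) (psi : H) (K : ℕ) : ℝ :=
  imSum (tester sigma v Pi Delta psi) (chi (cosAmp sigma v) (sinAmp sigma v) psi) K / K ^ 2

/-- Here t = τ(y − 1) with y = v/ω. For y < 1 the lower end 1 − 2d keeps K|t| ≤ 24, since the
average decays like 1/(K|t|). For y > 1 only the sign is claimed, so no upper end is required. -/
theorem Promise.signal_bounds (h : Promise sigma Pi Delta psi) {v d : ℝ} (hv : 0 ≤ v)
    (hv' : v ≤ 64 * sigma ^ 2) (hd : 0 < d) (hd' : d ≤ 1 / 2) {K : ℕ}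
    (hK : 6 ≤ K * (scale sigma * d)) (hK' : K * (scale sigma * d) ≤ 12) :
    (v * ‖kerPart Pi Delta psi‖ ^ 2 ≤ 1 - d → 1 - 2 * d ≤ v * ‖kerPart Pi Delta psi‖ ^ 2 →
      signal sigma v Pi Delta psi K ≤ -(1 / 96)) ∧
    (1 + d ≤ v * ‖kerPart Pi Delta psi‖ ^ 2 → 0 ≤ signal sigma v Pi Delta psi K) := by
  have h1 := h.one_le
  have ht : 0 < scale sigma := by rw [scale]; positivity
  have ht8 : scale sigma ≤ 1 / 8 := by
    rw [scale]; exact one_div_le_one_div_of_le (by norm_num) (by linarith)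
  have hcs := cosAmp_sq_add_sinAmp_sq h1 hv hv'
  have hB := h.norm_witnessVec_sq_le hv hv'
  have hK0 : (0 : ℝ) < K := by
    by_contra hneg
    nlinarith [mul_nonneg (neg_nonneg.2 (not_lt.1 hneg)) (mul_pos ht hd).le]
  set y := v * ‖kerPart Pi Delta psi‖ ^ 2 with hy
  have hyy : sinAmp sigma v ^ 2 * (1 + scale sigma ^ 2) * ‖kerPart Pi Delta psi‖ ^ 2 =
      y * scale sigma ^ 2 := by
    rw [sinAmp_sq hv, hy]; field_simp
  have hQ := norm_detector (tau := scale sigma) h.isSymmetricProjection_left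
    h.isSymmetricProjection_right hcs h.norm_eq_one
  have hz := detector_witnessVec h.isSymmetricProjection_left h.isSymmetricProjection_right
    h.apply_eq_zero h.norm_eq_one ht.ne' hcs hyy
  have hc := inner_chi_witnessVec h.isSymmetricProjection_left h.isSymmetricProjection_right
    h.apply_eq_zero h.norm_eq_one ht.ne' hcs hyy
  have hKt : 0 < K * scale sigma := mul_pos hK0 ht
  constructor
  · intro hy1 hy2
    rw [signal, div_le_iff₀ (by positivity)]
    refine (imSum_le hQ hz hc ?_ ?_ ?_).trans (by linarith)
    · nlinarith [mul_le_mul_of_nonneg_left (show d ≤ 1 - y by linarith) hKt.le]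
    · nlinarith [mul_le_mul_of_nonneg_left (show 1 - y ≤ 2 * d by linarith) hKt.le]
    · linarith
  · intro hy1
    refine div_nonneg (imSum_nonneg hQ hz hc (mul_pos ht (by linarith)) ?_) (sq_nonneg _)
    have h2 : 0 ≤ (K * scale sigma) * (y - 1 - d) := mul_nonneg hKt.le (by linarith)
    -- From Kτd ≥ 6 and d ≤ 1/2: Kt then grows faster in y than the bound 4(1 + y)/3 for 4‖ζ‖².
    have h12 : 12 ≤ K * scale sigma := by nlinarith
    have h3 : 6 * (y - 1) ≤ 6 * (y - 1 - d) + K * (scale sigma * d) := by linarith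
    have h4 : 12 * (y - 1 - d) ≤ (K * scale sigma) * (y - 1 - d) :=
      mul_le_mul_of_nonneg_right h12 (by linarith)
    nlinarith

end Promise

/-! ### Values of algorithms and randomised branching -/

section Value

variable {H : Type*} [NormedAddCommGroup H] [InnerProductSpace ℂ H] [FiniteDimensional ℂ H]
  {Pi Delta : H →ₗ[ℂ] H} {psi : H}

/-- The expectation of `a` times the number of operations plus `g` of the output. -/
def Algorithm.value (Pi Delta : H →ₗ[ℂ] H) (psi : H) (a : ℝ) (g : ℝ → ℝ) : Algorithm → ℝ
  | .output r => g r
  | .run m circuit next => a * (1 + 2 * m + circuit.length : ℕ) +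
      ∑ b, outcomeProb Pi Delta psi circuit b * value Pi Delta psi a g (next b)

theorem Algorithm.expectedTime_eq_value (alg : Algorithm) :
    alg.expectedTime Pi Delta psi = alg.value Pi Delta psi 1 (fun _ => 0) := by
  induction alg with
  | output r => rfl
  | run m circuit next ih => simp only [expectedTime, value, ih, one_mul]

open Classical in
theorem Algorithm.prob_eq_value (S : Set ℝ) (alg : Algorithm) :
    alg.prob Pi Delta psi S = alg.value Pi Delta psi 0 (fun r => if r ∈ S then 1 else 0) := by
  induction alg with
  | output r => rfl
  | run m circuit next ih => simp only [prob, value, ih, zero_mul, zero_add]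

theorem Gate.sum_calls_le {m : ℕ} (circuit : List (Gate m)) :
    (circuit.map Gate.calls).sum ≤ circuit.length := by
  induction circuit with
  | nil => simp
  | cons g l ih =>
    have : g.calls ≤ 1 := by cases g <;> simp [Gate.calls]
    simp only [List.map_cons, List.sum_cons, List.length_cons]
    omega

/-- Lets the time bound serve as the query bound. -/
theorem Algorithm.expectedCalls_le_expectedTime (alg : Algorithm) :
    alg.expectedCalls Pi Delta psi ≤ alg.expectedTime Pi Delta psi := by
  induction alg with
  | output r => exact le_rfl
  | run m circuit next ih =>
    refine add_le_add ?_ (Finset.sum_le_sum fun b _ =>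
      mul_le_mul_of_nonneg_left (ih b) (sq_nonneg _))
    exact_mod_cast (Gate.sum_calls_le circuit).trans (by omega)

/-- `F` is a procedure with a binary outcome, which is `true` with probability `q`, and with
expected number of operations `T`; `F k` continues with `k b` after the outcome `b`. -/
structure IsBranch (Pi Delta : H →ₗ[ℂ] H) (psi : H) (F : (Bool → Algorithm) → Algorithm)
    (q T : ℝ) : Prop where
  prob_nonneg : 0 ≤ q
  prob_le_one : q ≤ 1
  time_nonneg : 0 ≤ T
  value_eq : ∀ (a : ℝ) (g : ℝ → ℝ) (k : Bool → Algorithm),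
    (F k).value Pi Delta psi a g = a * T + q * (k true).value Pi Delta psi a g +
      (1 - q) * (k false).value Pi Delta psi a g

theorem isBranch_run {m : ℕ} (circuit : List (Gate m)) (i : Fin m) {q : ℝ}
    (h1 : ∑ b : Fin m → Bool, (if b i then outcomeProb Pi Delta psi circuit b else 0) = q)
    (h0 : ∑ b : Fin m → Bool, (if b i then 0 else outcomeProb Pi Delta psi circuit b) = 1 - q) :
    IsBranch Pi Delta psi (fun k => .run m circuit fun b => k (b i)) q
      (1 + 2 * m + circuit.length : ℕ) where
  prob_nonneg := by
    rw [← h1]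
    exact Finset.sum_nonneg fun b _ => by split_ifs; exacts [sq_nonneg _, le_rfl]
  prob_le_one := by
    have : 0 ≤ 1 - q := by
      rw [← h0]
      exact Finset.sum_nonneg fun b _ => by split_ifs; exacts [le_rfl, sq_nonneg _]
    linarith
  time_nonneg := Nat.cast_nonneg _
  value_eq a g k := by
    rw [Algorithm.value, add_assoc (a * _), ← h0, ← h1, Finset.sum_mul, Finset.sum_mul,
      ← Finset.sum_add_distrib]
    congr 1
    refine Finset.sum_congr rfl fun b _ => ?_
    cases b i <;> simp

theorem IsBranch.trans_left {F G : (Bool → Algorithm) → Algorithm} {q q' T T' : ℝ}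
    (hF : IsBranch Pi Delta psi F q T) (hG : IsBranch Pi Delta psi G q' T') :
    IsBranch Pi Delta psi (fun k => F fun b => if b then G k else k false) (q * q')
      (T + q * T') where
  prob_nonneg := mul_nonneg hF.prob_nonneg hG.prob_nonneg
  prob_le_one := mul_le_one₀ hF.prob_le_one hG.prob_nonneg hG.prob_le_one
  time_nonneg := add_nonneg hF.time_nonneg (mul_nonneg hF.prob_nonneg hG.time_nonneg)
  value_eq a g k := by
    rw [hF.value_eq]
    simp only [if_true, Bool.false_eq_true, if_false]
    rw [hG.value_eq]
    ring

theorem IsBranch.trans_right {F G : (Bool → Algorithm) → Algorithm} {q q' T T' : ℝ}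
    (hF : IsBranch Pi Delta psi F q T) (hG : IsBranch Pi Delta psi G q' T') :
    IsBranch Pi Delta psi (fun k => F fun b => if b then k true else G k) (q + (1 - q) * q')
      (T + (1 - q) * T') where
  prob_nonneg := add_nonneg hF.prob_nonneg
    (mul_nonneg (sub_nonneg.2 hF.prob_le_one) hG.prob_nonneg)
  prob_le_one := by
    nlinarith [mul_le_mul_of_nonneg_left hG.prob_le_one (sub_nonneg.2 hF.prob_le_one)]
  time_nonneg := add_nonneg hF.time_nonneg
    (mul_nonneg (sub_nonneg.2 hF.prob_le_one) hG.time_nonneg)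
  value_eq a g k := by
    rw [hF.value_eq]
    simp only [if_true, Bool.false_eq_true, if_false]
    rw [hG.value_eq]
    ring

end Value

/-! ### Gates -/

section Gates

/-- The matrix with rows `(a, b)` and `(c, d)`. -/
def mat2 (a b c d : ℂ) : Matrix Bool Bool ℂ :=
  Matrix.of fun i j => if i then (if j then d else c) else (if j then b else a)

theorem mat2_mem_unitaryGroup {a b c d : ℂ} (h1 : a * starRingEnd ℂ a + b * starRingEnd ℂ b = 1)
    (h2 : c * starRingEnd ℂ c + d * starRingEnd ℂ d = 1)
    (h3 : a * starRingEnd ℂ c + b * starRingEnd ℂ d = 0) :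
    mat2 a b c d ∈ Matrix.unitaryGroup Bool ℂ := by
  have h4 : c * starRingEnd ℂ a + d * starRingEnd ℂ b = 0 := by
    have := congrArg (starRingEnd ℂ) h3
    simp only [map_add, map_mul, Complex.conj_conj, map_zero] at this
    linear_combination this
  rw [Matrix.mem_unitaryGroup_iff]
  ext i j
  cases i <;> cases j <;>
    simp only [Matrix.mul_apply, mat2, Matrix.star_apply, Fintype.sum_bool, Matrix.of_apply,
      if_true, Bool.false_eq_true, if_false, Matrix.one_apply, reduceCtorEq, RCLike.star_def]
  · linear_combination h1
  · linear_combination h3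
  · linear_combination h4
  · linear_combination h2

/-- A unitary matrix viewed as an element of the unitary group. -/
def toUnitary {n : Type*} [Fintype n] [DecidableEq n] (M : Matrix n n ℂ) :
    Matrix.unitaryGroup n ℂ :=
  -- The value 1 is a default; the identities below concern matrices proved to be unitary.
  open Classical in if h : M ∈ Matrix.unitaryGroup n ℂ then ⟨M, h⟩ else 1

theorem toUnitary_val {n : Type*} [Fintype n] [DecidableEq n] {M : Matrix n n ℂ}
    (h : M ∈ Matrix.unitaryGroup n ℂ) : (toUnitary M).1 = M := by
  rw [toUnitary, dif_pos h]

theorem toUnitary_apply {n : Type*} [Fintype n] [DecidableEq n] {M : Matrix n n ℂ}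
    (h : M ∈ Matrix.unitaryGroup n ℂ) (i j : n) : (toUnitary M).1 i j = M i j := by
  rw [toUnitary_val h]

/-- The matrix applying `M₁` to the first qubit if the second one is `true`, and `M₀`
otherwise. -/
def ctl (M0 M1 : Matrix Bool Bool ℂ) : Matrix (Bool × Bool) (Bool × Bool) ℂ :=
  Matrix.blockDiagonal fun c => if c then M1 else M0

theorem ctl_mem_unitaryGroup {M0 M1 : Matrix Bool Bool ℂ}
    (h0 : M0 ∈ Matrix.unitaryGroup Bool ℂ) (h1 : M1 ∈ Matrix.unitaryGroup Bool ℂ) :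
    ctl M0 M1 ∈ Matrix.unitaryGroup (Bool × Bool) ℂ := by
  rw [Matrix.mem_unitaryGroup_iff, ctl, Matrix.star_eq_conjTranspose,
    Matrix.blockDiagonal_conjTranspose, ← Matrix.blockDiagonal_mul, ← Matrix.blockDiagonal_one]
  congr 1
  funext c
  cases c
  · exact Matrix.mem_unitaryGroup_iff.1 h0
  · exact Matrix.mem_unitaryGroup_iff.1 h1

theorem ctl_apply (M0 M1 : Matrix Bool Bool ℂ) (i c j c' : Bool) :
    ctl M0 M1 (i, c) (j, c') = if c = c' then (if c then M1 else M0) i j else 0 := by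
  simp [ctl, Matrix.blockDiagonal_apply]

/-- `1 / √2` as a complex number. -/
def invSqrt2 : ℂ := ((1 / √2 : ℝ) : ℂ)

theorem invSqrt2_mul_self : invSqrt2 * invSqrt2 = 1 / 2 := by
  rw [invSqrt2, ← Complex.ofReal_mul, div_mul_div_comm, Real.mul_self_sqrt (by norm_num)]
  norm_num

theorem conj_invSqrt2 : starRingEnd ℂ invSqrt2 = invSqrt2 := Complex.conj_ofReal _

/-- The Hadamard matrix. -/
def hadMat : Matrix Bool Bool ℂ := mat2 invSqrt2 invSqrt2 invSqrt2 (-invSqrt2)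

theorem hadMat_mem : hadMat ∈ Matrix.unitaryGroup Bool ℂ := by
  refine mat2_mem_unitaryGroup ?_ ?_ ?_ <;> simp only [map_neg, conj_invSqrt2]
  · linear_combination 2 * invSqrt2_mul_self
  · linear_combination 2 * invSqrt2_mul_self
  · ring

/-- The matrix `P diag(1, z) P` with the Hadamard matrix `P`. -/
def midMat (z : ℂ) : Matrix Bool Bool ℂ :=
  mat2 ((1 + z) / 2) ((1 - z) / 2) ((1 - z) / 2) ((1 + z) / 2)

theorem mul_conj_of_norm_eq_one {z : ℂ} (hz : ‖z‖ = 1) : z * starRingEnd ℂ z = 1 := by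
  rw [Complex.mul_conj, Complex.normSq_eq_norm_sq, hz]
  norm_num

theorem midMat_mem {z : ℂ} (hz : ‖z‖ = 1) : midMat z ∈ Matrix.unitaryGroup Bool ℂ := by
  have h := mul_conj_of_norm_eq_one hz
  refine mat2_mem_unitaryGroup ?_ ?_ ?_ <;>
    simp only [map_div₀, map_add, map_sub, map_one, map_ofNat]
  · linear_combination h / 2
  · linear_combination h / 2
  · linear_combination -h / 2

/-- The scalar matrix `conj z`. -/
def phaseMat (z : ℂ) : Matrix Bool Bool ℂ := mat2 (starRingEnd ℂ z) 0 0 (starRingEnd ℂ z)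

theorem phaseMat_mem {z : ℂ} (hz : ‖z‖ = 1) : phaseMat z ∈ Matrix.unitaryGroup Bool ℂ := by
  have h := mul_conj_of_norm_eq_one hz
  refine mat2_mem_unitaryGroup ?_ ?_ ?_ <;>
    simp only [Complex.conj_conj, map_zero, mul_zero, zero_mul, add_zero, zero_add]
  · linear_combination h
  · linear_combination h

/-- The matrix of a reflection of the plane. -/
def planeMat (a b : ℝ) : Matrix Bool Bool ℂ := mat2 a b b (-a)

theorem planeMat_mem {a b : ℝ} (h : a ^ 2 + b ^ 2 = 1) :
    planeMat a b ∈ Matrix.unitaryGroup Bool ℂ := by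
  have h' : (a : ℂ) ^ 2 + (b : ℂ) ^ 2 = 1 := by exact_mod_cast h
  refine mat2_mem_unitaryGroup ?_ ?_ ?_ <;> simp only [map_neg, Complex.conj_ofReal]
  · linear_combination h'
  · linear_combination h'
  · ring

/-- The matrix of the final rotation of the Hadamard test for imaginary parts. -/
def imMat : Matrix Bool Bool ℂ :=
  mat2 invSqrt2 (Complex.I * invSqrt2) invSqrt2 (-(Complex.I * invSqrt2))

theorem imMat_mem : imMat ∈ Matrix.unitaryGroup Bool ℂ := by
  refine mat2_mem_unitaryGroup ?_ ?_ ?_ <;>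
    simp only [map_neg, map_mul, conj_invSqrt2, Complex.conj_I]
  · linear_combination 2 * invSqrt2_mul_self - invSqrt2 ^ 2 * Complex.I_sq
  · linear_combination 2 * invSqrt2_mul_self - invSqrt2 ^ 2 * Complex.I_sq
  · linear_combination invSqrt2 ^ 2 * Complex.I_sq

theorem one_mem_unitaryGroup : mat2 1 0 0 1 ∈ Matrix.unitaryGroup Bool ℂ := by
  refine mat2_mem_unitaryGroup ?_ ?_ ?_ <;> simp

end Gates

/-! ### The Hadamard test -/

section HadamardTest

variable {H : Type*} [NormedAddCommGroup H] [InnerProductSpace ℂ H] [FiniteDimensional ℂ H]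
  {Pi Delta : H →ₗ[ℂ] H} {psi : H}

/-- The state of three qubits and the register with given components. -/
def state3 (f : Bool → Bool → Bool → H) : (Fin 3 → Bool) → H := fun b => f (b 0) (b 1) (b 2)

theorem apply_single_zero (u : Matrix.unitaryGroup Bool ℂ) (f : Bool → Bool → Bool → H) :
    (Gate.single 0 u).apply Pi Delta psi (state3 f) =
      state3 fun c d e => ∑ p, u.1 c p • f p d e := by
  funext b
  simp [Gate.apply, state3]

theorem apply_single_two (u : Matrix.unitaryGroup Bool ℂ) (f : Bool → Bool → Bool → H) :
    (Gate.single 2 u).apply Pi Delta psi (state3 f) =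
      state3 fun c d e => ∑ p, u.1 e p • f c d p := by
  funext b
  simp [Gate.apply, state3]

theorem apply_two {M0 M1 : Matrix Bool Bool ℂ}
    (h0 : M0 ∈ Matrix.unitaryGroup Bool ℂ) (h1 : M1 ∈ Matrix.unitaryGroup Bool ℂ)
    (hij : (1 : Fin 3) ≠ 0) (f : Bool → Bool → Bool → H) :
    (Gate.two 1 0 hij (toUnitary (ctl M0 M1))).apply Pi Delta psi (state3 f) =
      state3 fun c d e => ∑ p, (if c then M1 else M0) d p • f c p e := by
  funext b
  simp only [Gate.apply, state3, toUnitary_apply (ctl_mem_unitaryGroup h0 h1), ctl_apply,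
    Fintype.sum_prod_type]
  refine Finset.sum_congr rfl fun p _ => ?_
  cases hb : b 0 <;> simp [Function.update]

theorem apply_call (f : Bool → Bool → Bool → H) :
    (Gate.call (1 : Fin 3)).apply Pi Delta psi (state3 f) =
      state3 fun c d e => if d then walk Pi Delta (f c d e) else f c d e := rfl

theorem apply_reflectPi (f : Bool → Bool → Bool → H) :
    (Gate.reflectPi (2 : Fin 3)).apply Pi Delta psi (state3 f) =
      state3 fun c d e => if e then reflOp Pi (f c d e) else f c d e := rfl

theorem apply_reflectPsi (f : Bool → Bool → Bool → H) :
    (Gate.reflectPsi (1 : Fin 3)).apply Pi Delta psi (state3 f) =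
      state3 fun c d e => if d then reflOp (proj (Submodule.span ℂ {psi})) (f c d e)
        else f c d e := rfl

/-- Five gates that apply `phaseOp z Π` to the register. -/
def phaseGates (z : ℂ) : List (Gate 3) :=
  [.single 2 (toUnitary hadMat), .reflectPi 2, .single 2 (toUnitary (midMat z)), .reflectPi 2,
    .single 2 (toUnitary hadMat)]

/-- One application of `detector`, controlled on the first qubit. -/
def detectorGates (z : ℂ) (cb sb : ℝ) : List (Gate 3) :=
  .call 1 :: (phaseGates z ++
    [.two 1 0 (by decide) (toUnitary (ctl (phaseMat z) (planeMat (-sb) (-cb)))), .reflectPsi 1,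
      .two 1 0 (by decide) (toUnitary (ctl (mat2 1 0 0 1) (planeMat sb (-cb))))])

/-- The circuit of the Hadamard test for `Im ⟨χ, Q ^ k χ⟩`. -/
def hadamardCircuit (z : ℂ) (cb sb : ℝ) (k : ℕ) : List (Gate 3) :=
  [.single 0 (toUnitary hadMat),
    .two 1 0 (by decide) (toUnitary (ctl (mat2 1 0 0 1) (planeMat cb sb)))] ++
  (List.replicate k (detectorGates z cb sb)).flatten ++
  [.two 1 0 (by decide) (toUnitary (ctl (mat2 1 0 0 1) (planeMat cb sb))),
    .single 0 (toUnitary imMat)]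

/-- Apply a list of gates. -/
def applyGates (Pi Delta : H →ₗ[ℂ] H) (psi : H) {m : ℕ} (l : List (Gate m))
    (phi : (Fin m → Bool) → H) : (Fin m → Bool) → H :=
  l.foldl (fun phi g => g.apply Pi Delta psi phi) phi

theorem applyGates_append {m : ℕ} (l l' : List (Gate m)) (phi : (Fin m → Bool) → H) :
    applyGates Pi Delta psi (l ++ l') phi =
      applyGates Pi Delta psi l' (applyGates Pi Delta psi l phi) :=
  List.foldl_append

theorem applyGates_cons {m : ℕ} (g : Gate m) (l : List (Gate m)) (phi : (Fin m → Bool) → H) :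
    applyGates Pi Delta psi (g :: l) phi =
      applyGates Pi Delta psi l (g.apply Pi Delta psi phi) := rfl

theorem applyGates_nil {m : ℕ} (phi : (Fin m → Bool) → H) :
    applyGates Pi Delta psi [] phi = phi := rfl

/-- The state with the third qubit `false` and given components on the other qubits. -/
def state2 (f : Bool → Bool → H) : (Fin 3 → Bool) → H :=
  state3 fun c d e => if e then 0 else f c d

/-- Hadamard, controlled reflection and Hadamard write the eigenvalue of 2Π − I into the third
qubit. There diag(1, z) acts, and the reversed half erases the record. The middle gate merges the
two inner Hadamards with diag(1, z). -/
theorem applyGates_phaseGates {z : ℂ} (hz : ‖z‖ = 1) (hPi : Pi.IsSymmetricProjection)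
    (f : Bool → Bool → H) :
    applyGates Pi Delta psi (phaseGates z) (state2 f) =
      state2 fun c d => phaseOp z Pi (f c d) := by
  have h2 := invSqrt2_mul_self
  simp only [phaseGates, applyGates_cons, applyGates_nil, state2, apply_single_two,
    apply_reflectPi, Fintype.sum_bool, toUnitary_apply hadMat_mem,
    toUnitary_apply (midMat_mem hz)]
  congr 1
  funext c d e
  have hr : ∀ v, reflOp Pi v = (2 : ℂ) • Pi v - v := fun v => rfl
  have hp := apply_apply_of_isSymmetricProjection hPi (f c d)
  cases e <;>
    simp only [hadMat, midMat, mat2, Matrix.of_apply, if_true, Bool.false_eq_true, if_false, hr,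
      map_add, map_smul, map_sub, map_zero, phaseOp_apply, hp]
  · match_scalars
    · linear_combination (2 : ℂ) * (1 - z) * h2
    · linear_combination (2 : ℂ) * z * h2
  · match_scalars
    · ring
    · ring

end HadamardTest

/-! ### The controlled detector and the outcome probabilities -/

section HadamardProbability

variable {H : Type*} [NormedAddCommGroup H] [InnerProductSpace ℂ H] [FiniteDimensional ℂ H]
  {Pi Delta : H →ₗ[ℂ] H} {psi : H}

theorem apply_call_state2 (f : Bool → Bool → H) :
    (Gate.call (1 : Fin 3)).apply Pi Delta psi (state2 f) =
      state2 fun c d => if d then walk Pi Delta (f c d) else f c d := by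
  rw [state2, apply_call, state2]
  congr 1
  funext c d e
  cases e <;> cases d <;> simp

theorem apply_reflectPsi_state2 (f : Bool → Bool → H) :
    (Gate.reflectPsi (1 : Fin 3)).apply Pi Delta psi (state2 f) =
      state2 fun c d => if d then reflOp (proj (Submodule.span ℂ {psi})) (f c d) else f c d := by
  rw [state2, apply_reflectPsi, state2]
  congr 1
  funext c d e
  cases e <;> cases d <;> simp

theorem apply_two_state2 {M0 M1 : Matrix Bool Bool ℂ}
    (h0 : M0 ∈ Matrix.unitaryGroup Bool ℂ) (h1 : M1 ∈ Matrix.unitaryGroup Bool ℂ)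
    (hij : (1 : Fin 3) ≠ 0) (f : Bool → Bool → H) :
    (Gate.two 1 0 hij (toUnitary (ctl M0 M1))).apply Pi Delta psi (state2 f) =
      state2 fun c d => ∑ p, (if c then M1 else M0) d p • f c p := by
  rw [state2, apply_two h0 h1, state2]
  congr 1
  funext c d e
  cases e <;> simp

theorem apply_single_zero_state2 (u : Matrix.unitaryGroup Bool ℂ) (f : Bool → Bool → H) :
    (Gate.single 0 u).apply Pi Delta psi (state2 f) =
      state2 fun c d => ∑ p, u.1 c p • f p d := by
  rw [state2, apply_single_zero, state2]
  congr 1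
  funext c d e
  cases e <;> simp

/-- The state with the vector `r` in the reference branch and `x` in the other one. -/
def branchState (r : H) (x : WithLp 2 (H × H)) : (Fin 3 → Bool) → H :=
  state2 fun c d => if c then (if d then x.snd else x.fst) else (if d then 0 else r)

theorem proj_span_singleton_apply (hnorm : ‖psi‖ = 1) (v : H) :
    proj (Submodule.span ℂ {psi}) v = ⟪psi, v⟫_ℂ • psi :=
  Submodule.starProjection_unit_singleton ℂ hnorm v

theorem inner_chi (cb sb : ℝ) (psi : H) (x : WithLp 2 (H × H)) :
    ⟪chi cb sb psi, x⟫_ℂ = cb * ⟪psi, x.fst⟫_ℂ + sb * ⟪psi, x.snd⟫_ℂ := by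
  rw [WithLp.prod_inner_apply, chi]
  simp only [inner_smul_left, Complex.conj_ofReal]
  rfl

/-- The reference branch is untouched by the controlled gates; it picks up z from Φ because r ∈ ker
Π, and `phaseMat` removes it. In the other branch the first plane matrix moves the component along
(cos β, sin β) to qubit value `true`, where the reflection in ψ acts, and the second moves it back.
Their signs supply the −1 on the first summand and the one between 2|ψ⟩⟨ψ| − I and I − 2|ψ⟩⟨ψ|. -/
theorem applyGates_detectorGates {tau cb sb : ℝ} (hPi : Pi.IsSymmetricProjection)
    (hnorm : ‖psi‖ = 1) (hcs : cb ^ 2 + sb ^ 2 = 1) {r : H} (hr : Pi r = 0)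
    (x : WithLp 2 (H × H)) :
    applyGates Pi Delta psi (detectorGates (cayley tau) cb sb) (branchState r x) =
      branchState r (detector tau cb sb Pi Delta psi x) := by
  have hz := norm_cayley tau
  have hzc := mul_conj_of_norm_eq_one hz
  have m1 : planeMat (-sb) (-cb) ∈ Matrix.unitaryGroup Bool ℂ := planeMat_mem (by linarith)
  have m2 : planeMat sb (-cb) ∈ Matrix.unitaryGroup Bool ℂ := planeMat_mem (by linarith)
  have hcs' : (cb : ℂ) ^ 2 + (sb : ℂ) ^ 2 = 1 := by exact_mod_cast hcs
  have hD : detector tau cb sb Pi Delta psi x =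
      WithLp.toLp 2 (-phaseOp (cayley tau) Pi x.fst, phaseOp (cayley tau) Pi (walk Pi Delta x.snd))
      - (2 * ⟪chi cb sb psi, WithLp.toLp 2
        (-phaseOp (cayley tau) Pi x.fst, phaseOp (cayley tau) Pi (walk Pi Delta x.snd))⟫_ℂ) •
          chi cb sb psi := rfl
  rw [hD, inner_chi]
  have hr' : phaseOp (cayley tau) Pi r = cayley tau • r := by
    rw [phaseOp_apply, hr, sub_zero, zero_add]
  simp only [detectorGates, applyGates_cons, applyGates_append, applyGates_nil, branchState,
    apply_call_state2, applyGates_phaseGates hz hPi, apply_two_state2 (phaseMat_mem hz) m1,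
    apply_two_state2 one_mem_unitaryGroup m2, apply_reflectPsi_state2]
  congr 1
  funext c d
  generalize hu : phaseOp (cayley tau) Pi x.fst = u
  generalize hv : phaseOp (cayley tau) Pi (walk Pi Delta x.snd) = v
  have hR : ∀ y, reflOp (proj (Submodule.span ℂ {psi})) y = (2 * ⟪psi, y⟫_ℂ) • psi - y := by
    intro y
    rw [reflOp_apply, proj_span_singleton_apply hnorm, smul_smul]
  cases c
  · cases d <;>
      simp [phaseMat, mat2, hr', smul_smul, mul_comm _ (cayley tau), hzc]
  · cases d <;>
      simp only [if_true, Bool.false_eq_true, if_false, Fintype.sum_bool, planeMat, mat2,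
        Matrix.of_apply, hu, hv, hR, inner_add_right, inner_smul_right, WithLp.sub_fst,
        WithLp.smul_fst, WithLp.sub_snd, WithLp.smul_snd, chi, WithLp.toLp_fst, WithLp.toLp_snd,
        inner_neg_right] <;>
      match_scalars <;>
      first
      | ring1
      | linear_combination hcs'
      | linear_combination -hcs'

theorem applyGates_replicate {tau cb sb : ℝ} (hPi : Pi.IsSymmetricProjection)
    (hnorm : ‖psi‖ = 1) (hcs : cb ^ 2 + sb ^ 2 = 1) {r : H} (hr : Pi r = 0) (k : ℕ)
    (x : WithLp 2 (H × H)) :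
    applyGates Pi Delta psi (List.replicate k (detectorGates (cayley tau) cb sb)).flatten
      (branchState r x) = branchState r ((detector tau cb sb Pi Delta psi ^ k) x) := by
  induction k generalizing x with
  | zero => rfl
  | succ k ih =>
    rw [List.replicate_succ, List.flatten_cons, applyGates_append,
      applyGates_detectorGates hPi hnorm hcs hr, ih, pow_succ, Module.End.mul_apply]

/-- The last plane rotation puts the component of y along (cos β, sin β) at qubit value `false`,
where it interferes with the reference ψ; the factors ±i select the imaginary part. -/
theorem finalState_hadamardCircuit {tau cb sb : ℝ} (hPi : Pi.IsSymmetricProjection)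
    (hnorm : ‖psi‖ = 1) (hpsi : Pi psi = 0) (hcs : cb ^ 2 + sb ^ 2 = 1) (k : ℕ)
    {y : WithLp 2 (H × H)} (hy : (detector tau cb sb Pi Delta psi ^ k) (chi cb sb psi) = y) :
    finalState Pi Delta psi (hadamardCircuit (cayley tau) cb sb k) =
      state2 fun c d => ((1 / 2 : ℝ) : ℂ) •
        ((if d then 0 else psi) + (if c then -Complex.I else Complex.I) •
          (if d then (sb : ℂ) • y.fst - (cb : ℂ) • y.snd
            else (cb : ℂ) • y.fst + (sb : ℂ) • y.snd)) := by
  have m := planeMat_mem hcs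
  have h0 : initialState psi 3 =
      state2 fun c d => if c then 0 else if d then 0 else psi := by
    funext b
    rw [initialState, state2, state3]
    have : (b = fun _ => false) ↔ b 0 = false ∧ b 1 = false ∧ b 2 = false := by
      constructor
      · rintro rfl
        exact ⟨rfl, rfl, rfl⟩
      · rintro ⟨h0, h1, h2⟩
        funext i
        fin_cases i
        exacts [h0, h1, h2]
    simp only [this]
    cases b 0 <;> cases b 1 <;> cases b 2 <;> simp
  have h1 : applyGates Pi Delta psi [Gate.single 0 (toUnitary hadMat),
      .two 1 0 (by decide) (toUnitary (ctl (mat2 1 0 0 1) (planeMat cb sb)))]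
        (initialState psi 3) = branchState (invSqrt2 • psi) (invSqrt2 • chi cb sb psi) := by
    simp only [h0, applyGates_cons, applyGates_nil, apply_single_zero_state2,
      apply_two_state2 one_mem_unitaryGroup m, branchState, toUnitary_apply hadMat_mem]
    congr 1
    funext c d
    cases c <;> cases d <;>
      simp [hadMat, mat2, planeMat, chi, smul_smul, mul_comm invSqrt2, -Complex.coe_smul]
  change applyGates Pi Delta psi (hadamardCircuit (cayley tau) cb sb k) (initialState psi 3) = _
  rw [hadamardCircuit, applyGates_append, applyGates_append, h1,
    applyGates_replicate hPi hnorm hcs (by rw [map_smul, hpsi, smul_zero]), map_smul, hy]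
  simp only [applyGates_cons, applyGates_nil, apply_single_zero_state2,
      apply_two_state2 one_mem_unitaryGroup m, branchState, toUnitary_apply imMat_mem]
  have hs := invSqrt2_mul_self
  congr 1
  funext c d
  cases c <;> cases d <;>
    simp only [if_true, Bool.false_eq_true, if_false, Fintype.sum_bool, planeMat, mat2, imMat,
      Matrix.of_apply, WithLp.smul_fst, WithLp.smul_snd] <;>
    match_scalars <;>
    first
    | ring1
    | linear_combination hs
    | linear_combination (cb : ℂ) * Complex.I * hs
    | linear_combination (sb : ℂ) * Complex.I * hs
    | linear_combination (-cb : ℂ) * Complex.I * hs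
    | linear_combination (-sb : ℂ) * Complex.I * hs

theorem sum_state3 {M : Type*} [AddCommMonoid M] (F : Bool → Bool → Bool → M) :
    ∑ b : Fin 3 → Bool, F (b 0) (b 1) (b 2) = ∑ c, ∑ d, ∑ e, F c d e := by
  simp_rw [← Fintype.sum_prod_type']
  refine Fintype.sum_equiv ⟨fun b => (b 0, b 1, b 2), fun p => ![p.1, p.2.1, p.2.2], ?_, ?_⟩ _ _
    fun b => rfl
  · intro b
    funext i
    fin_cases i <;> rfl
  · rintro ⟨c, d, e⟩
    rfl

/-- The plane rotation preserves the norm of y, so apart from 1 + 1 only the interference term with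
ψ is left. -/
theorem norm_I_branch {cb sb : ℝ} (hcs : cb ^ 2 + sb ^ 2 = 1) (hnorm : ‖psi‖ = 1)
    {y : WithLp 2 (H × H)} (hy : ‖y‖ = 1) {z : ℂ} (hz : ‖z‖ = 1) :
    ‖psi + z • ((cb : ℂ) • y.fst + (sb : ℂ) • y.snd)‖ ^ 2 +
      ‖z • ((sb : ℂ) • y.fst - (cb : ℂ) • y.snd)‖ ^ 2 =
        2 + 2 * (z * ⟪chi cb sb psi, y⟫_ℂ).re := by
  have h1 : ‖y.fst‖ ^ 2 + ‖y.snd‖ ^ 2 = 1 := by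
    rw [← WithLp.prod_norm_sq_eq_of_L2, hy, one_pow]
  have e1 := norm_add_sq (𝕜 := ℂ) ((cb : ℂ) • y.fst) ((sb : ℂ) • y.snd)
  have e2 := norm_sub_sq (𝕜 := ℂ) ((sb : ℂ) • y.fst) ((cb : ℂ) • y.snd)
  have e3 : ⟪(cb : ℂ) • y.fst, (sb : ℂ) • y.snd⟫_ℂ = ⟪(sb : ℂ) • y.fst, (cb : ℂ) • y.snd⟫_ℂ := by
    simp only [inner_smul_left, inner_smul_right, Complex.conj_ofReal]
    ring
  rw [norm_smul, norm_smul, mul_pow, mul_pow, Complex.norm_real, Complex.norm_real,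
    Real.norm_eq_abs, Real.norm_eq_abs, sq_abs, sq_abs, e3] at e1
  rw [norm_smul, norm_smul, mul_pow, mul_pow, Complex.norm_real, Complex.norm_real,
    Real.norm_eq_abs, Real.norm_eq_abs, sq_abs, sq_abs] at e2
  rw [norm_add_sq (𝕜 := ℂ), norm_smul z, norm_smul z, hz, one_mul, one_mul, hnorm, e1, e2,
    inner_smul_right, inner_add_right, inner_smul_right, inner_smul_right, inner_chi]
  have h2 : (cb ^ 2 + sb ^ 2) * (‖y.fst‖ ^ 2 + ‖y.snd‖ ^ 2) = 1 := by rw [hcs, h1, one_mul]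
  simp only [RCLike.re_eq_complex_re]
  linear_combination h2

/-- The Hadamard test. -/
def hadamardTest (z : ℂ) (cb sb : ℝ) (k : ℕ) (next : Bool → Algorithm) : Algorithm :=
  .run 3 (hadamardCircuit z cb sb k) fun b => next (b 0)

theorem length_hadamardCircuit (z : ℂ) (cb sb : ℝ) (k : ℕ) :
    (hadamardCircuit z cb sb k).length = 9 * k + 4 := by
  simp [hadamardCircuit, detectorGates, phaseGates]
  omega

theorem isBranch_hadamardTest {tau cb sb : ℝ} (hPi : Pi.IsSymmetricProjection)
    (hD : Delta.IsSymmetricProjection) (hnorm : ‖psi‖ = 1) (hpsi : Pi psi = 0)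
    (hcs : cb ^ 2 + sb ^ 2 = 1) (k : ℕ) :
    IsBranch Pi Delta psi (hadamardTest (cayley tau) cb sb k)
      ((1 + (⟪chi cb sb psi, (detector tau cb sb Pi Delta psi ^ k) (chi cb sb psi)⟫_ℂ).im) / 2)
      (11 + 9 * k : ℕ) := by
  have hlen : 1 + 2 * 3 + (hadamardCircuit (cayley tau) cb sb k).length = 11 + 9 * k := by
    rw [length_hadamardCircuit]; ring
  rw [← hlen]
  have hy : ‖(detector tau cb sb Pi Delta psi ^ k) (chi cb sb psi)‖ = 1 := by
    rw [norm_pow_apply (norm_detector hPi hD hcs hnorm), norm_chi hcs hnorm]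
  have hfin := finalState_hadamardCircuit (k := k) (tau := tau) (Delta := Delta) hPi hnorm hpsi
    hcs rfl
  have hI : ‖Complex.I‖ = 1 := Complex.norm_I
  have hI' : ‖-Complex.I‖ = 1 := by rw [norm_neg, hI]
  have b1 := norm_I_branch hcs hnorm hy hI
  have b2 := norm_I_branch hcs hnorm hy hI'
  generalize (detector tau cb sb Pi Delta psi ^ k) (chi cb sb psi) = y at *
  refine isBranch_run _ 0 ?_ ?_
  · simp only [outcomeProb, hfin, state2, state3]
    rw [sum_state3 fun c d e => if c = true then ‖(if e = true then (0 : H) else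
      ((1 / 2 : ℝ) : ℂ) • ((if d = true then 0 else psi) + (if c = true then -Complex.I else
        Complex.I) • if d = true then (sb : ℂ) • y.fst - (cb : ℂ) • y.snd
          else (cb : ℂ) • y.fst + (sb : ℂ) • y.snd))‖ ^ 2 else 0]
    simp only [Fintype.sum_bool, if_true, Bool.false_eq_true, if_false, norm_zero, norm_smul _ (_ + _),
      zero_add, Complex.norm_real, mul_pow]
    norm_num at b1 b2 ⊢
    linarith
  · simp only [outcomeProb, hfin, state2, state3]
    rw [sum_state3 fun c d e => if c = true then 0 else ‖(if e = true then (0 : H) else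
      ((1 / 2 : ℝ) : ℂ) • ((if d = true then 0 else psi) + (if c = true then -Complex.I else
        Complex.I) • if d = true then (sb : ℂ) • y.fst - (cb : ℂ) • y.snd
          else (cb : ℂ) • y.fst + (sb : ℂ) • y.snd))‖ ^ 2]
    simp only [Fintype.sum_bool, if_true, Bool.false_eq_true, if_false, norm_zero, norm_smul _ (_ + _),
      zero_add, Complex.norm_real, mul_pow]
    norm_num at b1 b2 ⊢
    linarith

end HadamardProbability

/-! ### Classical coins -/

section Coins

variable {H : Type*} [NormedAddCommGroup H] [InnerProductSpace ℂ H] [FiniteDimensional ℂ H]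
  {Pi Delta : H →ₗ[ℂ] H} {psi : H}

/-- A coin that shows `true` with probability `q`. -/
def coin (q : ℝ) (next : Bool → Algorithm) : Algorithm :=
  .run 1 [.single 0 (toUnitary (planeMat √(1 - q) √q))] fun b => next (b 0)

theorem isBranch_coin (hnorm : ‖psi‖ = 1) {q : ℝ} (h0 : 0 ≤ q) (h1 : q ≤ 1) :
    IsBranch Pi Delta psi (coin q) q 4 := by
  have hm : planeMat √(1 - q) √q ∈ Matrix.unitaryGroup Bool ℂ := planeMat_mem (by
    rw [Real.sq_sqrt h0, Real.sq_sqrt (by linarith)]; ring)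
  have hf : ∀ b : Fin 1 → Bool, outcomeProb Pi Delta psi
      [Gate.single 0 (toUnitary (planeMat √(1 - q) √q))] b = if b 0 then q else 1 - q := by
    intro b
    have e : ∀ p, Function.update b 0 p = (fun _ => false) ↔ p = false := by
      intro p
      constructor
      · intro h
        simpa using congrFun h 0
      · rintro rfl
        funext i
        fin_cases i
        simp
    simp only [outcomeProb, finalState, List.foldl_cons, List.foldl_nil, Gate.apply, initialState,
      e, Fintype.sum_bool, toUnitary_apply hm, reduceCtorEq, if_false, smul_zero, zero_add, if_true,
      norm_smul, hnorm, mul_one]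
    cases b 0 <;> simp [planeMat, mat2, sq_abs, Real.sq_sqrt, h0, h1]
  have hsum : ∀ F : Bool → ℝ, ∑ b : Fin 1 → Bool, F (b 0) = F true + F false := by
    intro F
    rw [← Fintype.sum_bool]
    exact Fintype.sum_equiv (Equiv.funUnique (Fin 1) Bool) _ _ fun b => rfl
  have := isBranch_run (Pi := Pi) (Delta := Delta) (psi := psi) (q := q)
    [Gate.single 0 (toUnitary (planeMat √(1 - q) √q))] (0 : Fin 1)
    (by simp only [hf]; rw [hsum fun c => if c = true then (if c = true then q else 1 - q) else 0]
        simp)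
    (by simp only [hf]; rw [hsum fun c => if c = true then 0 else (if c = true then q else 1 - q)]
        simp)
  have h4 : ((1 + 2 * 1 + [Gate.single (0 : Fin 1)
    (toUnitary (planeMat √(1 - q) √q))].length : ℕ) : ℝ) = 4 := by norm_num
  rwa [h4] at this

/-- Draw a uniformly random number below `2 ^ j`, and add it to `acc * 2 ^ j`. -/
def sample (next : ℕ → Algorithm) : ℕ → ℕ → Algorithm
  | 0, acc => next acc
  | j + 1, acc => coin (1 / 2) fun b => sample next j (2 * acc + if b then 1 else 0)

theorem value_sample (hnorm : ‖psi‖ = 1) (a : ℝ) (g : ℝ → ℝ) (next : ℕ → Algorithm) (j acc : ℕ) :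
    (sample next j acc).value Pi Delta psi a g = a * (4 * j) +
      (∑ i ∈ Finset.range (2 ^ j), (next (acc * 2 ^ j + i)).value Pi Delta psi a g) / 2 ^ j := by
  induction j generalizing acc with
  | zero => simp [sample]
  | succ j ih =>
    have e : ∑ i ∈ Finset.range (2 ^ (j + 1)), (next (acc * 2 ^ (j + 1) + i)).value Pi Delta psi a g =
        ∑ i ∈ Finset.range (2 ^ j), (next (2 * acc * 2 ^ j + i)).value Pi Delta psi a g +
        ∑ i ∈ Finset.range (2 ^ j), (next ((2 * acc + 1) * 2 ^ j + i)).value Pi Delta psi a g := by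
      rw [pow_succ, mul_two, Finset.sum_range_add]
      congr 1
      · refine Finset.sum_congr rfl fun i _ => ?_
        congr 2
        ring
      · refine Finset.sum_congr rfl fun i _ => ?_
        congr 2
        ring
    rw [sample, (isBranch_coin hnorm (by norm_num) (by norm_num)).value_eq, e]
    simp only [if_true, Bool.false_eq_true, if_false, add_zero, ih]
    push_cast
    rw [pow_succ]
    field_simp
    ring

end Coins

/-! ### Majority votes -/

section Votes

variable {H : Type*} [NormedAddCommGroup H] [InnerProductSpace ℂ H] [FiniteDimensional ℂ H]
  {Pi Delta : H →ₗ[ℂ] H} {psi : H}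

theorem isBranch_sample (hnorm : ‖psi‖ = 1) {F : ℕ → (Bool → Algorithm) → Algorithm}
    {q T : ℕ → ℝ} {j : ℕ} (hF : ∀ i, IsBranch Pi Delta psi (F i) (q i) (T i)) :
    IsBranch Pi Delta psi (fun next => sample (fun i => F i next) j 0)
      ((∑ i ∈ Finset.range (2 ^ j), q i) / 2 ^ j)
      (4 * j + (∑ i ∈ Finset.range (2 ^ j), T i) / 2 ^ j) where
  prob_nonneg := div_nonneg (Finset.sum_nonneg fun i _ => (hF i).prob_nonneg) (by positivity)
  prob_le_one := by
    rw [div_le_one (by positivity)]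
    refine (Finset.sum_le_sum fun i _ => (hF i).prob_le_one).trans ?_
    simp
  time_nonneg := add_nonneg (by positivity)
    (div_nonneg (Finset.sum_nonneg fun i _ => (hF i).time_nonneg) (by positivity))
  value_eq a g k := by
    have e : ∑ i ∈ Finset.range (2 ^ j), (F (0 * 2 ^ j + i) k).value Pi Delta psi a g =
        a * ∑ i ∈ Finset.range (2 ^ j), T i +
        (∑ i ∈ Finset.range (2 ^ j), q i) * (k true).value Pi Delta psi a g +
        (2 ^ j - ∑ i ∈ Finset.range (2 ^ j), q i) * (k false).value Pi Delta psi a g := by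
      have e1 : (2 ^ j : ℝ) - ∑ i ∈ Finset.range (2 ^ j), q i =
          ∑ i ∈ Finset.range (2 ^ j), (1 - q i) := by
        rw [Finset.sum_sub_distrib]; simp
      rw [e1, Finset.mul_sum, Finset.sum_mul, Finset.sum_mul, ← Finset.sum_add_distrib,
        ← Finset.sum_add_distrib]
      refine Finset.sum_congr rfl fun i _ => ?_
      rw [zero_mul, zero_add, (hF i).value_eq]
    rw [value_sample hnorm, e]
    field_simp
    ring

/-- One run of the randomised test of the candidate value `v` for `ω`. The outcome is biased
towards `true` if `v` is too large, and towards `false` if `v` is too small. -/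
def trial (sigma v : ℝ) (j : ℕ) (next : Bool → Algorithm) : Algorithm :=
  coin (1 / 400) fun b => if b then next true else
    sample (fun m => sample (fun k => if k < m then
      hadamardTest (cayley (scale sigma)) (cosAmp sigma v) (sinAmp sigma v) k next
      else coin (1 / 2) next) j 0) j 0

/-- Averaging over uniform pairs (m, k), with a fair coin unless k < m, gives exactly `imSum`
divided by 2K² as bias. The preliminary coin of weight 1/400 shifts the threshold, so that a signal
≥ 0 also has a definite bias. -/
theorem Promise.exists_isBranch_trial {sigma v : ℝ} (h : Promise sigma Pi Delta psi)
    (hv : 0 ≤ v) (hv' : v ≤ 64 * sigma ^ 2) (j : ℕ) :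
    ∃ T ≤ 32 * 2 ^ j, IsBranch Pi Delta psi (trial sigma v j)
      (1 / 400 + (1 - 1 / 400) * (1 / 2 + signal sigma v Pi Delta psi (2 ^ j) / 2)) T := by
  have hcs := cosAmp_sq_add_sinAmp_sq h.one_le hv hv'
  set f : ℕ → ℝ := fun k => (⟪chi (cosAmp sigma v) (sinAmp sigma v) psi,
    (tester sigma v Pi Delta psi ^ k) (chi (cosAmp sigma v) (sinAmp sigma v) psi)⟫_ℂ).im with hf
  have hbase : ∀ m k : ℕ, IsBranch Pi Delta psi (fun next => if k < m then
      hadamardTest (cayley (scale sigma)) (cosAmp sigma v) (sinAmp sigma v) k next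
      else coin (1 / 2) next) (1 / 2 + if k < m then f k / 2 else 0)
      (if k < m then (11 + 9 * k : ℕ) else 4) := by
    intro m k
    by_cases hkm : k < m
    · simp only [hkm, if_true]
      have e : 1 / 2 + f k / 2 = (1 + f k) / 2 := by ring
      rw [e]
      exact isBranch_hadamardTest h.isSymmetricProjection_left h.isSymmetricProjection_right
        h.norm_eq_one h.apply_eq_zero hcs k
    · simp only [hkm, if_false, add_zero]
      exact isBranch_coin h.norm_eq_one (by norm_num) (by norm_num)
  have h2 := isBranch_sample (j := j) h.norm_eq_one fun m =>
    isBranch_sample (j := j) h.norm_eq_one (hbase m)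
  have h3 := (isBranch_coin (Pi := Pi) (Delta := Delta) h.norm_eq_one (q := 1 / 400)
    (by norm_num) (by norm_num)).trans_right h2
  have hp : (0 : ℝ) < 2 ^ j := by positivity
  have hq : (∑ m ∈ Finset.range (2 ^ j), (∑ k ∈ Finset.range (2 ^ j),
      (1 / 2 + if k < m then f k / 2 else 0)) / 2 ^ j) / 2 ^ j =
      1 / 2 + signal sigma v Pi Delta psi (2 ^ j) / 2 := by
    have e : ∀ m ∈ Finset.range (2 ^ j), (∑ k ∈ Finset.range (2 ^ j),
        (1 / 2 + if k < m then f k / 2 else 0)) / 2 ^ j =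
        1 / 2 + (∑ k ∈ Finset.range m, f k) / (2 * 2 ^ j) := by
      intro m hm
      have hm' := Finset.mem_range.1 hm
      have e2 : (Finset.range (2 ^ j)).filter (· < m) = Finset.range m := by
        ext k
        simp only [Finset.mem_filter, Finset.mem_range]
        omega
      have e3 : ∑ k ∈ Finset.range m, f k / 2 = (∑ k ∈ Finset.range m, f k) / 2 :=
        (Finset.sum_div _ _ _).symm
      rw [Finset.sum_add_distrib, ← Finset.sum_filter, e2, e3]
      simp only [Finset.sum_const, Finset.card_range, nsmul_eq_mul]
      push_cast
      field_simp
    have e3 : ∑ m ∈ Finset.range (2 ^ j), (∑ k ∈ Finset.range m, f k) / (2 * 2 ^ j) =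
        imSum (tester sigma v Pi Delta psi) (chi (cosAmp sigma v) (sinAmp sigma v) psi) (2 ^ j) /
          (2 * 2 ^ j) := (Finset.sum_div _ _ _).symm
    rw [Finset.sum_congr rfl e, Finset.sum_add_distrib, e3, signal]
    simp only [Finset.sum_const, Finset.card_range, nsmul_eq_mul]
    push_cast
    field_simp
  rw [hq] at h3
  refine ⟨_, ?_, h3⟩
  have hj : (j : ℝ) ≤ 2 ^ j := by exact_mod_cast Nat.lt_two_pow_self.le
  have h1 : (1 : ℝ) ≤ 2 ^ j := one_le_pow₀ (by norm_num)
  have hT : ∀ m, (∑ k ∈ Finset.range (2 ^ j),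
      (if k < m then ((11 + 9 * k : ℕ) : ℝ) else 4)) / 2 ^ j ≤ 11 + 9 * 2 ^ j := by
    intro m
    rw [div_le_iff₀ hp]
    refine (Finset.sum_le_card_nsmul _ _ (11 + 9 * 2 ^ j : ℝ) fun k hk => ?_).trans ?_
    · have hk' : (k : ℝ) ≤ 2 ^ j := by exact_mod_cast (Finset.mem_range.1 hk).le
      split_ifs
      · push_cast; linarith
      · linarith
    · rw [Finset.card_range, nsmul_eq_mul, mul_comm]
      push_cast
      exact le_rfl
  have hT2 : (∑ m ∈ Finset.range (2 ^ j), (4 * j + (∑ k ∈ Finset.range (2 ^ j),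
      (if k < m then ((11 + 9 * k : ℕ) : ℝ) else 4)) / 2 ^ j)) / 2 ^ j ≤
        4 * j + (11 + 9 * 2 ^ j) := by
    rw [div_le_iff₀ hp]
    refine (Finset.sum_le_card_nsmul _ _ (4 * j + (11 + 9 * 2 ^ j) : ℝ) fun m _ =>
      add_le_add_right (hT m) _).trans ?_
    rw [Finset.card_range, nsmul_eq_mul, mul_comm]
    push_cast
    exact le_rfl
  -- The total is at most 4 + 8j + 11 + 9·2^j, where j and 1 are at most 2^j.
  have hnn := h2.time_nonneg
  linarith

/-- Repeat a procedure `n` times and return whether the number of outcomes `true` exceeds the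
number of outcomes `false`, where `s` is the initial difference. -/
def vote (F : (Bool → Algorithm) → Algorithm) (next : Bool → Algorithm) : ℕ → ℤ → Algorithm
  | 0, s => next (decide (0 < s))
  | n + 1, s => F fun b => vote F next n (if b then s + 1 else s - 1)

/-- An exponential moment bound with base λ = 1 + 2c: a step multiplies the mean of λ^s by qλ + (1 −
q)/λ, which is 1 − 2c² at q = 1/2 − c. A tie counts as `false`. -/
theorem IsBranch.exists_vote {F : (Bool → Algorithm) → Algorithm} {q T c : ℝ}
    (hF : IsBranch Pi Delta psi F q T) (hc : 0 < c) (n : ℕ) (s : ℤ) :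
    ∃ Q, IsBranch Pi Delta psi (fun next => vote F next n s) Q (n * T) ∧
      (q ≤ 1 / 2 - c → Q ≤ (1 - 2 * c ^ 2) ^ n * (1 + 2 * c) ^ s) ∧
      (1 / 2 + c ≤ q → 1 - Q ≤ (1 - 2 * c ^ 2) ^ n * (1 + 2 * c) ^ (-s)) := by
  have hl : (1 : ℝ) < 1 + 2 * c := by linarith
  have hl0 : (0 : ℝ) < 1 + 2 * c := by linarith
  induction n generalizing s with
  | zero =>
    by_cases hs : 0 < s
    · refine ⟨1, ⟨zero_le_one, le_rfl, by simp, fun a g k => by simp [vote, hs]⟩, fun _ => ?_,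
        fun _ => ?_⟩
      · simpa using one_le_zpow₀ hl.le hs.le
      · simp only [sub_self, pow_zero, one_mul]; positivity
    · refine ⟨0, ⟨le_rfl, zero_le_one, by simp, fun a g k => by simp [vote, hs]⟩, fun _ => ?_,
        fun _ => ?_⟩
      · simp only [pow_zero, one_mul]; positivity
      · simpa using one_le_zpow₀ hl.le (show 0 ≤ -s by omega)
  | succ n ih =>
    obtain ⟨Q1, h1, h1l, h1u⟩ := ih (s + 1)
    obtain ⟨Q2, h2, h2l, h2u⟩ := ih (s - 1)
    have q0 := hF.prob_nonneg
    have q1 := sub_nonneg.2 hF.prob_le_one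
    refine ⟨q * Q1 + (1 - q) * Q2, ⟨?_, ?_, ?_, ?_⟩, ?_, ?_⟩
    · exact add_nonneg (mul_nonneg q0 h1.prob_nonneg) (mul_nonneg q1 h2.prob_nonneg)
    · nlinarith [mul_le_mul_of_nonneg_left h1.prob_le_one q0,
        mul_le_mul_of_nonneg_left h2.prob_le_one q1]
    · exact mul_nonneg (Nat.cast_nonneg _) hF.time_nonneg
    · intro a g k
      rw [vote, hF.value_eq]
      simp only [if_true, Bool.false_eq_true, if_false]
      rw [h1.value_eq, h2.value_eq]
      push_cast
      ring
    · intro hq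
      have hqb : q ≤ 1 / 2 - c := hq
      -- The inequalities 0 ≤ q ≤ 1/2 − c force c ≤ 1/2.
      have hc2 : 0 ≤ 1 - 2 * c ^ 2 := by nlinarith
      have hP : 0 ≤ (1 - 2 * c ^ 2) ^ n := pow_nonneg hc2 n
      have key : q * (1 + 2 * c) + (1 - q) * (1 + 2 * c)⁻¹ ≤ 1 - 2 * c ^ 2 := by
        have hinv : (1 + 2 * c)⁻¹ ≤ 1 := inv_le_one_of_one_le₀ hl.le
        have e : (1 / 2 + c) * (1 + 2 * c)⁻¹ = 1 / 2 := by field_simp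
        nlinarith [mul_le_mul_of_nonneg_right hqb (show 0 ≤ (1 + 2 * c) - (1 + 2 * c)⁻¹ by linarith)]
      calc q * Q1 + (1 - q) * Q2
          ≤ q * ((1 - 2 * c ^ 2) ^ n * (1 + 2 * c) ^ (s + 1)) +
            (1 - q) * ((1 - 2 * c ^ 2) ^ n * (1 + 2 * c) ^ (s - 1)) :=
            add_le_add (mul_le_mul_of_nonneg_left (h1l hq) q0)
              (mul_le_mul_of_nonneg_left (h2l hq) q1)
        _ = (1 - 2 * c ^ 2) ^ n * (1 + 2 * c) ^ s *
            (q * (1 + 2 * c) + (1 - q) * (1 + 2 * c)⁻¹) := by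
            rw [zpow_add_one₀ hl0.ne', zpow_sub_one₀ hl0.ne']; ring
        _ ≤ (1 - 2 * c ^ 2) ^ n * (1 + 2 * c) ^ s * (1 - 2 * c ^ 2) :=
            mul_le_mul_of_nonneg_left key (by positivity)
        _ = _ := by ring
    · intro hq
      have hqb : 1 - q ≤ 1 / 2 - c := by linarith
      have hc2 : 0 ≤ 1 - 2 * c ^ 2 := by nlinarith
      have hP : 0 ≤ (1 - 2 * c ^ 2) ^ n := pow_nonneg hc2 n
      have key : (1 - q) * (1 + 2 * c) + q * (1 + 2 * c)⁻¹ ≤ 1 - 2 * c ^ 2 := by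
        have hinv : (1 + 2 * c)⁻¹ ≤ 1 := inv_le_one_of_one_le₀ hl.le
        have e : (1 / 2 + c) * (1 + 2 * c)⁻¹ = 1 / 2 := by field_simp
        nlinarith [mul_le_mul_of_nonneg_right hqb (show 0 ≤ (1 + 2 * c) - (1 + 2 * c)⁻¹ by linarith)]
      calc 1 - (q * Q1 + (1 - q) * Q2) = q * (1 - Q1) + (1 - q) * (1 - Q2) := by ring
        _ ≤ q * ((1 - 2 * c ^ 2) ^ n * (1 + 2 * c) ^ (-(s + 1))) +
            (1 - q) * ((1 - 2 * c ^ 2) ^ n * (1 + 2 * c) ^ (-(s - 1))) :=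
            add_le_add (mul_le_mul_of_nonneg_left (h1u hq) q0)
              (mul_le_mul_of_nonneg_left (h2u hq) q1)
        _ = (1 - 2 * c ^ 2) ^ n * (1 + 2 * c) ^ (-s) *
            ((1 - q) * (1 + 2 * c) + q * (1 + 2 * c)⁻¹) := by
            have e1 : -(s + 1) = -s - 1 := by ring
            have e2 : -(s - 1) = -s + 1 := by ring
            rw [e1, e2, zpow_add_one₀ hl0.ne', zpow_sub_one₀ hl0.ne']; ring
        _ ≤ (1 - 2 * c ^ 2) ^ n * (1 + 2 * c) ^ (-s) * (1 - 2 * c ^ 2) :=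
            mul_le_mul_of_nonneg_left key (by positivity)
        _ = _ := by ring

/-- The logarithm of the maximal number of steps used by a test with resolution `d`. -/
def depth (sigma d : ℝ) : ℕ := Nat.clog 2 ⌈6 / (scale sigma * d)⌉₊

theorem le_two_pow_clog_ceil (x : ℝ) : x ≤ 2 ^ Nat.clog 2 ⌈x⌉₊ :=
  (Nat.le_ceil x).trans (by exact_mod_cast Nat.le_pow_clog one_lt_two _)

theorem two_pow_clog_ceil_le {x : ℝ} (hx : 1 < x) : (2 ^ Nat.clog 2 ⌈x⌉₊ : ℝ) ≤ 2 * x := by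
  have h1 : 1 < ⌈x⌉₊ := Nat.lt_ceil.2 (by simpa using hx)
  have h2 := Nat.lt_ceil.1 (Nat.pow_pred_clog_lt_self one_lt_two h1)
  obtain ⟨j, hj⟩ := Nat.exists_eq_succ_of_ne_zero (Nat.clog_pos one_lt_two h1).ne'
  rw [hj] at h2 ⊢
  simp only [Nat.pred_succ, Nat.succ_eq_add_one] at h2
  push_cast at h2
  rw [Nat.succ_eq_add_one, pow_succ]
  linarith

/-- The base number of repetitions in a vote. -/
def voteSize : ℕ := 1600000

/-- With c = 1/800 one has 2c² = 1/320000, and 1600000 rounds give e^{-5} ≤ 2^{-5}. -/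
theorem pow_voteSize_le : (1 - 2 * (1 / 800 : ℝ) ^ 2) ^ voteSize ≤ 1 / 32 := by
  have h1 : (1 - 2 * (1 / 800 : ℝ) ^ 2) ≤ Real.exp (-(1 / 320000)) := by
    have := Real.add_one_le_exp (-(1 / 320000 : ℝ))
    linarith
  have h2 : (2 : ℝ) ≤ Real.exp 1 := by linarith [Real.add_one_le_exp (1 : ℝ)]
  calc (1 - 2 * (1 / 800 : ℝ) ^ 2) ^ voteSize
      ≤ Real.exp (-(1 / 320000)) ^ voteSize := pow_le_pow_left₀ (by norm_num) h1 _
    _ = (Real.exp 1 ^ 5)⁻¹ := by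
        rw [← Real.exp_nat_mul, ← Real.exp_nat_mul, ← Real.exp_neg, voteSize]
        norm_num
    _ ≤ ((2 : ℝ) ^ 5)⁻¹ := inv_anti₀ (by norm_num) (pow_le_pow_left₀ (by norm_num) h2 5)
    _ = 1 / 32 := by norm_num

/-- Decide whether the candidate value `v` is too large, with resolution `d` and error
probability at most `32 ^ (-n)`. -/
def decideLarge (sigma v d : ℝ) (n : ℕ) (next : Bool → Algorithm) : Algorithm :=
  vote (trial sigma v (depth sigma d)) next (voteSize * n) 0

/-- The constant in the running time of `decideLarge`. -/
def timeConst : ℝ := voteSize * 3072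

theorem Promise.exists_isBranch_decideLarge {sigma v d : ℝ} (h : Promise sigma Pi Delta psi)
    (hv : 0 ≤ v) (hv' : v ≤ 64 * sigma ^ 2) (hd : 0 < d) (hd' : d ≤ 1 / 2) (n : ℕ) :
    ∃ Q T, IsBranch Pi Delta psi (decideLarge sigma v d n) Q T ∧
      T ≤ timeConst * n * (sigma / d) ∧
      (v * ‖kerPart Pi Delta psi‖ ^ 2 ≤ 1 - d → 1 - 2 * d ≤ v * ‖kerPart Pi Delta psi‖ ^ 2 →
        Q ≤ (1 / 32) ^ n) ∧
      (1 + d ≤ v * ‖kerPart Pi Delta psi‖ ^ 2 → 1 - Q ≤ (1 / 32) ^ n) := by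
  have hs := h.one_le
  have hs0 : 0 < sigma := by linarith
  have ht : 0 < scale sigma := by rw [scale]; positivity
  have htd : 0 < scale sigma * d := mul_pos ht hd
  have e1 : 6 / (scale sigma * d) = 48 * (sigma / d) := by
    rw [scale]; field_simp; norm_num
  have hx : 1 < 6 / (scale sigma * d) := by
    rw [e1]
    have : 1 ≤ sigma / d := by rw [le_div_iff₀ hd]; linarith
    linarith
  have k1 := le_two_pow_clog_ceil (6 / (scale sigma * d))
  have k2 := two_pow_clog_ceil_le hx
  have hK : 6 ≤ ((2 ^ depth sigma d : ℕ) : ℝ) * (scale sigma * d) := by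
    rw [div_le_iff₀ htd] at k1
    push_cast
    exact k1
  have hK' : ((2 ^ depth sigma d : ℕ) : ℝ) * (scale sigma * d) ≤ 12 := by
    rw [mul_div_assoc', le_div_iff₀ htd] at k2
    push_cast
    exact k2.trans (by norm_num)
  obtain ⟨b1, b2⟩ := h.signal_bounds hv hv' hd hd' hK hK'
  obtain ⟨T, hT, hb⟩ := h.exists_isBranch_trial hv hv' (depth sigma d)
  obtain ⟨Q, hQ, hQl, hQu⟩ := hb.exists_vote (c := 1 / 800) (by norm_num) (voteSize * n) 0
  have hpow : (1 - 2 * (1 / 800 : ℝ) ^ 2) ^ (voteSize * n) ≤ (1 / 32) ^ n := by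
    rw [pow_mul]
    exact pow_le_pow_left₀ (pow_nonneg (by norm_num) _) pow_voteSize_le n
  refine ⟨Q, _, hQ, ?_, fun y1 y2 => ?_, fun y1 => ?_⟩
  · rw [e1] at k2
    -- 3072 = 32 · 2 · 48: cost 32 per step, rounding up to a power of two, and 6/τ = 48σ.
    have hT' : T ≤ 3072 * (sigma / d) := by
      have : (2 : ℝ) ^ depth sigma d ≤ 2 * (48 * (sigma / d)) := by
        rw [depth, e1]; exact k2
      linarith
    push_cast
    calc (voteSize : ℝ) * n * T ≤ voteSize * n * (3072 * (sigma / d)) :=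
          mul_le_mul_of_nonneg_left hT' (by positivity)
      _ = timeConst * n * (sigma / d) := by rw [timeConst]; ring
  · have := hQl (by linarith [b1 y1 y2])
    simp only [zpow_zero, mul_one] at this
    exact this.trans hpow
  · have := hQu (by linarith [b2 y1])
    simp only [neg_zero, zpow_zero, mul_one] at this
    exact this.trans hpow

end Votes

/-! ### The search -/

section Search

variable {H : Type*} [NormedAddCommGroup H] [InnerProductSpace ℂ H] [FiniteDimensional ℂ H]
  {Pi Delta : H →ₗ[ℂ] H} {psi : H}

theorem timeConst_pos : 0 < timeConst := by
  rw [timeConst, voteSize]; norm_num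

/-- Decide whether `2 ^ i` is larger than `ω`, up to a constant factor. The outcome `true` is
confirmed `r` times, by votes of doubling sizes. -/
def confirm (sigma : ℝ) (i : ℕ) : ℕ → ℕ → (Bool → Algorithm) → Algorithm
  | 0, j, next => decideLarge sigma (2 ^ i) (1 / 2) (2 ^ j) next
  | r + 1, j, next => decideLarge sigma (2 ^ i) (1 / 2) (2 ^ j) fun b =>
      if b then confirm sigma i r (j + 1) next else next false

/-- For small candidates the last and largest vote alone bounds the error, while the first already
stops the process with probability at least 31/32; the costs of the later ones double but are damped
by 1/32 each. For large candidates the errors add up and the first dominates. -/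
theorem Promise.exists_isBranch_confirm {sigma : ℝ} (h : Promise sigma Pi Delta psi) {i : ℕ}
    (hi : (2 : ℝ) ^ i ≤ 64 * sigma ^ 2) (r j : ℕ) :
    ∃ Q T, IsBranch Pi Delta psi (confirm sigma i r j) Q T ∧
      T ≤ 2 * timeConst * sigma * (2 ^ (j + r + 1) - 2 ^ j) ∧
      (2 ^ i * ‖kerPart Pi Delta psi‖ ^ 2 ≤ 1 / 2 →
        Q ≤ (1 / 32) ^ 2 ^ (j + r) ∧ T ≤ 4 * timeConst * sigma * 2 ^ j) ∧
      (3 / 2 ≤ 2 ^ i * ‖kerPart Pi Delta psi‖ ^ 2 → 1 - Q ≤ 2 * (1 / 32) ^ 2 ^ j) := by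
  have hs : 0 < sigma := by linarith [h.one_le]
  have hD : 0 < timeConst * sigma := mul_pos timeConst_pos hs
  have hy : 0 ≤ 2 ^ i * ‖kerPart Pi Delta psi‖ ^ 2 := by positivity
  induction r generalizing j with
  | zero =>
    obtain ⟨Q, T, hb, hT, hl, hu⟩ := h.exists_isBranch_decideLarge (v := 2 ^ i) (d := 1 / 2)
      (by positivity) hi (by norm_num) le_rfl (2 ^ j)
    have hT' : T ≤ 2 * timeConst * sigma * 2 ^ j := by
      push_cast at hT
      refine hT.trans (le_of_eq ?_)
      ring
    have hp : (0 : ℝ) < 2 ^ j := by positivity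
    refine ⟨Q, T, hb, ?_, fun h1 => ⟨?_, ?_⟩, fun h1 => ?_⟩
    · rw [add_zero, pow_succ]
      linarith
    -- For d = 1/2 the window [1 − 2d, 1 − d] is [0, 1/2], so no candidate is too small for it.
    · exact hl (by linarith) (by linarith)
    · nlinarith [mul_pos hD hp]
    · have := hu (by linarith)
      have h0 : (0 : ℝ) ≤ (1 / 32) ^ 2 ^ j := by positivity
      linarith
  | succ r ih =>
    obtain ⟨Q, T, hb, hT, hl, hu⟩ := h.exists_isBranch_decideLarge (v := 2 ^ i) (d := 1 / 2)
      (by positivity) hi (by norm_num) le_rfl (2 ^ j)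
    obtain ⟨Q', T', hb', hT', hl', hu'⟩ := ih (j + 1)
    have hT1 : T ≤ 2 * timeConst * sigma * 2 ^ j := by
      push_cast at hT
      refine hT.trans (le_of_eq ?_)
      ring
    have hp : (0 : ℝ) < 2 ^ j := by positivity
    have he : j + 1 + r = j + (r + 1) := by ring
    rw [he] at hT' hl'
    refine ⟨_, _, hb.trans_left hb', ?_, fun h1 => ⟨?_, ?_⟩, fun h1 => ?_⟩
    · have h2 : Q * T' ≤ T' := mul_le_of_le_one_left hb'.time_nonneg hb.prob_le_one
      rw [pow_succ 2 j] at hT'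
      linarith
    · exact (mul_le_of_le_one_left hb'.prob_nonneg hb.prob_le_one).trans (hl' h1).1
    · have hQ := hl (by linarith) (by linarith)
      have hQ2 : Q ≤ 1 / 32 := hQ.trans (pow_le_of_le_one (by norm_num) (by norm_num)
        (by positivity))
      have h2 : Q * T' ≤ 1 / 32 * T' := mul_le_mul_of_nonneg_right hQ2 hb'.time_nonneg
      have h3 := (hl' h1).2
      rw [pow_succ] at h3
      nlinarith [mul_pos hD hp]
    · have h2 := hu (by linarith)
      have h3 := hu' h1
      have h4 : ((1 / 32 : ℝ)) ^ 2 ^ (j + 1) ≤ 1 / 32 * (1 / 32) ^ 2 ^ j := by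
        rw [pow_succ, pow_mul, sq]
        exact mul_le_mul_of_nonneg_right (pow_le_of_le_one (by norm_num) (by norm_num)
          (by positivity)) (by positivity)
      have h5 : Q * (1 - Q') ≤ 1 - Q' :=
        mul_le_of_le_one_left (sub_nonneg.2 hb'.prob_le_one) hb.prob_le_one
      have h0 : (0 : ℝ) ≤ (1 / 32) ^ 2 ^ j := by positivity
      linarith

theorem IsBranch.prob_eq {F : (Bool → Algorithm) → Algorithm} {q T : ℝ}
    (hF : IsBranch Pi Delta psi F q T) (S : Set ℝ) (k : Bool → Algorithm) :
    (F k).prob Pi Delta psi S =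
      q * (k true).prob Pi Delta psi S + (1 - q) * (k false).prob Pi Delta psi S := by
  simp only [Algorithm.prob_eq_value, hF.value_eq, zero_mul, zero_add]

theorem IsBranch.expectedTime_eq {F : (Bool → Algorithm) → Algorithm} {q T : ℝ}
    (hF : IsBranch Pi Delta psi F q T) (k : Bool → Algorithm) :
    (F k).expectedTime Pi Delta psi = T + q * (k true).expectedTime Pi Delta psi +
      (1 - q) * (k false).expectedTime Pi Delta psi := by
  simp only [Algorithm.expectedTime_eq_value, hF.value_eq, one_mul]

theorem Algorithm.prob_nonneg (S : Set ℝ) (alg : Algorithm) : 0 ≤ alg.prob Pi Delta psi S := by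
  induction alg with
  | output r => rw [prob]; split_ifs; exacts [zero_le_one, le_rfl]
  | run m circuit next ih =>
    exact Finset.sum_nonneg fun b _ => mul_nonneg (sq_nonneg _) (ih b)

/-- Search for `2 ^ i / ω` in an interval with left end point `a` and length `ε (4 / 3) ^ m`. -/
def bisect (sigma ε : ℝ) (i : ℕ) : ℕ → ℝ → Algorithm
  | 0, a => .output (2 ^ i / (a + ε / 2))
  | m + 1, a => decideLarge sigma (2 ^ i / (a + ε * (4 / 3) ^ (m + 1) / 2))
      (ε * (4 / 3) ^ (m + 1) / (4 * (a + ε * (4 / 3) ^ (m + 1) / 2))) (m + 1) fun b =>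
      if b then bisect sigma ε i m (a + ε * (4 / 3) ^ (m + 1) / 4) else bisect sigma ε i m a

/-- The resolution d is a quarter of the length relative to the midpoint: multiplying the midpoint
by 1 − 2d, 1 − d and 1 + d gives a, a + l/4 and a + 3l/4. -/
theorem Promise.exists_isBranch_bisect_step {sigma a l : ℝ} (h : Promise sigma Pi Delta psi)
    {i : ℕ} (hi : (2 : ℝ) ^ i ≤ 4 * sigma ^ 2) (ha : 1 / 2 ≤ a) (hl : 0 < l) (hal : a + l ≤ 4)
    (n : ℕ) : ∃ Q T, IsBranch Pi Delta psi
      (decideLarge sigma (2 ^ i / (a + l / 2)) (l / (4 * (a + l / 2))) n) Q T ∧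
      T ≤ 16 * timeConst * sigma * (n / l) ∧
      (a ≤ 2 ^ i * ‖kerPart Pi Delta psi‖ ^ 2 →
        2 ^ i * ‖kerPart Pi Delta psi‖ ^ 2 ≤ a + l / 4 → Q ≤ (1 / 32) ^ n) ∧
      (a + 3 * l / 4 ≤ 2 ^ i * ‖kerPart Pi Delta psi‖ ^ 2 → 1 - Q ≤ (1 / 32) ^ n) := by
  have hs : 0 < sigma := by linarith [h.one_le]
  have hy : 0 < a + l / 2 := by linarith
  have hd : l / (4 * (a + l / 2)) ≤ 1 / 2 := by
    rw [div_le_iff₀ (by positivity)]; linarith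
  have hv : 2 ^ i / (a + l / 2) ≤ 64 * sigma ^ 2 := by
    rw [div_le_iff₀ hy]
    nlinarith [sq_nonneg sigma]
  obtain ⟨Q, T, hb, hT, hl', hu⟩ := h.exists_isBranch_decideLarge
    (v := 2 ^ i / (a + l / 2)) (by positivity) hv (d := l / (4 * (a + l / 2)))
    (by positivity) hd n
  have e : 2 ^ i / (a + l / 2) * ‖kerPart Pi Delta psi‖ ^ 2 =
      2 ^ i * ‖kerPart Pi Delta psi‖ ^ 2 / (a + l / 2) := by ring
  rw [e] at hl' hu
  refine ⟨Q, T, hb, hT.trans ?_, fun h1 h2 => hl' ?_ ?_, fun h1 => hu ?_⟩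
  · have e2 : timeConst * n * (sigma / (l / (4 * (a + l / 2)))) =
        timeConst * sigma * (n / l) * (4 * (a + l / 2)) := by
      field_simp
    have h0 : 0 ≤ timeConst * sigma * (n / l) :=
      mul_nonneg (mul_pos timeConst_pos hs).le (by positivity)
    rw [e2]
    nlinarith [mul_le_mul_of_nonneg_left (show 4 * (a + l / 2) ≤ 16 by linarith) h0]
  · rw [div_le_iff₀ hy]
    have : (1 - l / (4 * (a + l / 2))) * (a + l / 2) = a + l / 4 := by field_simp; ring
    linarith
  · rw [le_div_iff₀ hy]
    have : (1 - 2 * (l / (4 * (a + l / 2)))) * (a + l / 2) = a := by field_simp; ring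
    linarith
  · rw [le_div_iff₀ hy]
    have : (1 + l / (4 * (a + l / 2))) * (a + l / 2) = a + 3 * l / 4 := by field_simp; ring
    linarith

/-- In the middle half of the interval both answers keep the target; in the outer quarters the wrong
one has probability at most 32^{-(m+1)}, below the summand 2^{-(m+1)}/16 of a geometric series. -/
theorem Promise.le_prob_bisect {sigma ε : ℝ} (h : Promise sigma Pi Delta psi) (hε : 0 < ε)
    {i : ℕ} (hi : (2 : ℝ) ^ i ≤ 4 * sigma ^ 2) (m : ℕ) {a : ℝ} (ha : 1 / 2 ≤ a)
    (ham : a + ε * (4 / 3) ^ m ≤ 4) (hy : a ≤ 2 ^ i * ‖kerPart Pi Delta psi‖ ^ 2)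
    (hy' : 2 ^ i * ‖kerPart Pi Delta psi‖ ^ 2 ≤ a + ε * (4 / 3) ^ m) :
    1 - 1 / 16 * (1 - (1 / 2) ^ m) ≤ (bisect sigma ε i m a).prob Pi Delta psi
      {r | |r - omega Pi Delta psi| ≤ ε * omega Pi Delta psi} := by
  induction m generalizing a with
  | zero =>
    rw [bisect, Algorithm.prob, if_pos]
    · norm_num
    · have hp := h.norm_kerPart_sq_pos
      rw [pow_zero, mul_one] at hy'
      have hz : 0 < a + ε / 2 := by linarith
      rw [Set.mem_ofPred_eq, omega]
      have e : 2 ^ i / (a + ε / 2) - 1 / ‖kerPart Pi Delta psi‖ ^ 2 =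
          (2 ^ i * ‖kerPart Pi Delta psi‖ ^ 2 - (a + ε / 2)) / (a + ε / 2) *
            (1 / ‖kerPart Pi Delta psi‖ ^ 2) := by
        have h1 := hp.ne'
        have h2 := hz.ne'
        generalize ‖kerPart Pi Delta psi‖ ^ 2 = p at h1
        generalize a + ε / 2 = z at h2
        field_simp
      rw [e, abs_mul, abs_of_pos (one_div_pos.2 hp), abs_div, abs_of_pos hz]
      refine mul_le_mul_of_nonneg_right ?_ (one_div_pos.2 hp).le
      -- The midpoint is off by at most ε/2, and ε/2 ≤ ε(a + ε/2) because a ≥ 1/2.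
      rw [div_le_iff₀ hz, abs_le]
      constructor <;> nlinarith
  | succ m ih =>
    have hl : 0 < ε * (4 / 3) ^ (m + 1) := by positivity
    obtain ⟨Q, T, hb, -, hlo, hup⟩ :=
      h.exists_isBranch_bisect_step hi ha hl ham (m + 1)
    have el : ε * (4 / 3) ^ m = 3 / 4 * (ε * (4 / 3) ^ (m + 1)) := by rw [pow_succ]; ring
    rw [bisect, hb.prob_eq]
    simp only [if_true, Bool.false_eq_true, if_false]
    set S := {r | |r - omega Pi Delta psi| ≤ ε * omega Pi Delta psi}
    set l := ε * (4 / 3) ^ (m + 1)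
    set y := 2 ^ i * ‖kerPart Pi Delta psi‖ ^ 2
    have n1 := (bisect sigma ε i m (a + l / 4)).prob_nonneg (Pi := Pi) (Delta := Delta)
      (psi := psi) S
    have n2 := (bisect sigma ε i m a).prob_nonneg (Pi := Pi) (Delta := Delta) (psi := psi) S
    have hk : (1 / 32 : ℝ) ^ (m + 1) ≤ 1 / 16 * (1 / 2) ^ (m + 1) := by
      have : (1 / 32 : ℝ) ^ m ≤ (1 / 2) ^ m :=
        pow_le_pow_left₀ (by norm_num) (by norm_num) m
      rw [pow_succ, pow_succ]
      linarith
    have hk2 : (0 : ℝ) < (1 / 2) ^ m := by positivity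
    have hk3 : (1 / 2 : ℝ) ^ m ≤ 1 := pow_le_one₀ (by norm_num) (by norm_num)
    have q0 := hb.prob_nonneg
    have q1 := hb.prob_le_one
    have hk4 : (1 / 2 : ℝ) ^ (m + 1) = 1 / 2 * (1 / 2) ^ m := by rw [pow_succ]; ring
    rw [hk4] at hk ⊢
    have i1 : a + l / 4 ≤ y → 1 - 1 / 16 * (1 - (1 / 2) ^ m) ≤
        (bisect sigma ε i m (a + l / 4)).prob Pi Delta psi S := fun hc =>
      ih (by linarith) (by rw [el]; linarith) hc (by rw [el]; linarith)
    have i2 : y ≤ a + 3 * l / 4 → 1 - 1 / 16 * (1 - (1 / 2) ^ m) ≤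
        (bisect sigma ε i m a).prob Pi Delta psi S := fun hc =>
      ih ha (by rw [el]; linarith) hy (by rw [el]; linarith)
    rcases le_total y (a + l / 4) with c1 | c1
    · have h1 := hlo hy c1
      have h2 := i2 (by linarith)
      nlinarith [mul_nonneg q0 n1, mul_le_mul_of_nonneg_left h2 (sub_nonneg.2 q1)]
    · rcases le_total (a + 3 * l / 4) y with c2 | c2
      · have h1 := hup c2
        have h2 := i1 c1
        nlinarith [mul_nonneg (sub_nonneg.2 q1) n2, mul_le_mul_of_nonneg_left h2 q0]
      · have h1 := i1 c1
        have h2 := i2 c2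
        nlinarith [mul_le_mul_of_nonneg_left h1 q0,
          mul_le_mul_of_nonneg_left h2 (sub_nonneg.2 q1)]

/-- The bracket is ∑_{k ≤ m} k (3/4)^k, with limit 12: the stage of length ε(4/3)^k costs k (3/4)^k
in units of σ/ε. -/
theorem Promise.expectedTime_bisect_le {sigma ε : ℝ} (h : Promise sigma Pi Delta psi)
    (hε : 0 < ε) {i : ℕ} (hi : (2 : ℝ) ^ i ≤ 4 * sigma ^ 2) (m : ℕ) {a : ℝ} (ha : 1 / 2 ≤ a)
    (ham : a + ε * (4 / 3) ^ m ≤ 4) :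
    (bisect sigma ε i m a).expectedTime Pi Delta psi ≤
      16 * timeConst * sigma / ε * (12 - (12 + 3 * m) * (3 / 4) ^ m) := by
  induction m generalizing a with
  | zero => simp [bisect, Algorithm.expectedTime]
  | succ m ih =>
    have hl : 0 < ε * (4 / 3) ^ (m + 1) := by positivity
    obtain ⟨Q, T, hb, hT, -, -⟩ := h.exists_isBranch_bisect_step hi ha hl ham (m + 1)
    have el : ε * (4 / 3) ^ m = 3 / 4 * (ε * (4 / 3) ^ (m + 1)) := by rw [pow_succ]; ring
    rw [bisect, hb.expectedTime_eq]
    simp only [if_true, Bool.false_eq_true, if_false]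
    have h1 := ih (a := a + ε * (4 / 3) ^ (m + 1) / 4) (by linarith) (by rw [el]; linarith)
    have h2 := ih ha (by rw [el]; linarith)
    have e : 16 * timeConst * sigma * (((m + 1 : ℕ) : ℝ) / (ε * (4 / 3) ^ (m + 1))) =
        16 * timeConst * sigma / ε * ((m + 1) * (3 / 4) ^ (m + 1)) := by
      have : ((3 : ℝ) / 4) ^ (m + 1) = ((4 / 3) ^ (m + 1))⁻¹ := by
        rw [← inv_pow]; norm_num
      rw [this]
      push_cast
      field_simp
    rw [e] at hT
    have e2 : 16 * timeConst * sigma / ε * ((m + 1) * (3 / 4) ^ (m + 1)) +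
        16 * timeConst * sigma / ε * (12 - (12 + 3 * m) * (3 / 4) ^ m) =
        16 * timeConst * sigma / ε * (12 - (12 + 3 * ((m + 1 : ℕ) : ℝ)) * (3 / 4) ^ (m + 1)) := by
      rw [pow_succ]
      push_cast
      ring
    rw [← e2]
    have h3 := mul_le_mul_of_nonneg_left h1 hb.prob_nonneg
    have h4 := mul_le_mul_of_nonneg_left h2 (sub_nonneg.2 hb.prob_le_one)
    linarith

/-- Increase `i` until `2 ^ i` is confirmed to be larger than `ω` up to a constant factor, or
the maximal number of steps is reached, and then continue with `fin i`. -/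
def climb (sigma : ℝ) (fin : ℕ → Algorithm) : ℕ → ℕ → Algorithm
  | 0, i => fin i
  | f + 1, i => confirm sigma i (Nat.clog 2 (i + 1)) 0 fun b =>
      if b then fin i else climb sigma fin f (i + 1)

theorem two_pow_clog_succ_le (i : ℕ) : 2 ^ Nat.clog 2 (i + 1) ≤ 2 * (i + 1) := by
  rcases Nat.eq_zero_or_pos i with rfl | hi
  · simp
  · have h1 : 1 < i + 1 := by omega
    have h2 := Nat.pow_pred_clog_lt_self one_lt_two h1
    obtain ⟨j, hj⟩ := Nat.exists_eq_succ_of_ne_zero (Nat.clog_pos one_lt_two h1).ne'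
    rw [hj] at h2 ⊢
    simp only [Nat.pred_succ, Nat.succ_eq_add_one] at h2
    rw [Nat.succ_eq_add_one, pow_succ]
    omega

/-- The largest vote has size between i + 1 and 2(i + 1): enough for error 32^{-(i+1)}, while a
typical rejection costs only O(σ). -/
theorem Promise.exists_isBranch_climb_step {sigma : ℝ} (h : Promise sigma Pi Delta psi) {i : ℕ}
    (hi : (2 : ℝ) ^ i ≤ 4 * sigma ^ 2) :
    ∃ Q T, IsBranch Pi Delta psi (confirm sigma i (Nat.clog 2 (i + 1)) 0) Q T ∧
      T ≤ 4 * (2 * timeConst * sigma) * (i + 1) ∧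
      (2 ^ i * ‖kerPart Pi Delta psi‖ ^ 2 ≤ 1 / 2 →
        Q ≤ (1 / 32) ^ (i + 1) ∧ T ≤ 2 * (2 * timeConst * sigma)) ∧
      (3 / 2 ≤ 2 ^ i * ‖kerPart Pi Delta psi‖ ^ 2 → 1 - Q ≤ 1 / 16) := by
  have hD : 0 < timeConst * sigma := mul_pos timeConst_pos (by linarith [h.one_le])
  obtain ⟨Q, T, hb, hT, hl, hu⟩ := h.exists_isBranch_confirm (i := i)
    (by nlinarith [sq_nonneg sigma]) (Nat.clog 2 (i + 1)) 0
  have h1 : ((2 : ℝ) ^ Nat.clog 2 (i + 1)) ≤ 2 * (i + 1) := by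
    exact_mod_cast two_pow_clog_succ_le i
  rw [zero_add] at hT hl
  refine ⟨Q, T, hb, hT.trans ?_, fun h2 => ⟨(hl h2).1.trans ?_, (hl h2).2.trans ?_⟩,
    fun h2 => (hu h2).trans ?_⟩
  · rw [pow_succ, pow_zero]
    nlinarith [mul_le_mul_of_nonneg_left h1 hD.le]
  · exact pow_le_pow_of_le_one (by norm_num) (by norm_num) (Nat.le_pow_clog one_lt_two _)
  · rw [pow_zero]; linarith
  · norm_num

/-- With y = 2^i/ω: accepting at y ≤ 1/2 is wrong and costs 32^{-(i+1)}, which the term 2 ·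
32^{-(i+1)} absorbs; between 1/2 and 3/2 both answers are harmless, as doubling keeps y ≤ 3; from
3/2 on a rejection is counted as failure, with probability at most 1/16. The last 1/16 is the
failure of `fin`. -/
theorem Promise.le_prob_climb {sigma : ℝ} (h : Promise sigma Pi Delta psi) {L : ℕ}
    (hL : 2 * sigma ^ 2 ≤ 2 ^ L) (hL' : (2 : ℝ) ^ L ≤ 4 * sigma ^ 2) {S : Set ℝ}
    {fin : ℕ → Algorithm} (hfin : ∀ i ≤ L, 1 / 2 ≤ 2 ^ i * ‖kerPart Pi Delta psi‖ ^ 2 →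
      2 ^ i * ‖kerPart Pi Delta psi‖ ^ 2 ≤ 3 → 15 / 16 ≤ (fin i).prob Pi Delta psi S)
    (f i : ℕ) (hfi : i + f = L) (hi : 2 ^ i * ‖kerPart Pi Delta psi‖ ^ 2 ≤ 3) :
    7 / 8 - 2 * (1 / 32) ^ (i + 1) ≤ (climb sigma fin f i).prob Pi Delta psi S := by
  induction f generalizing i with
  | zero =>
    -- At the top, 2^L ≥ 2σ² ≥ 2ω.
    have h1 : 1 / 2 ≤ 2 ^ i * ‖kerPart Pi Delta psi‖ ^ 2 := by
      rw [add_zero] at hfi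
      subst hfi
      have := h.omega_mul
      nlinarith [mul_le_mul_of_nonneg_right (hL.trans' (mul_le_mul_of_nonneg_left h.omega_le
        zero_le_two)) h.norm_kerPart_sq_pos.le]
    have h2 := hfin i (by omega) h1 hi
    have h3 : (0 : ℝ) ≤ (1 / 32) ^ (i + 1) := by positivity
    rw [climb]
    linarith
  | succ f ih =>
    have hi4 : (2 : ℝ) ^ i ≤ 4 * sigma ^ 2 :=
      (pow_le_pow_right₀ one_le_two (by omega)).trans hL'
    obtain ⟨Q, T, hb, -, hl, hu⟩ := h.exists_isBranch_climb_step hi4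
    rw [climb, hb.prob_eq]
    simp only [if_true, Bool.false_eq_true, if_false]
    have n1 := (fin i).prob_nonneg (Pi := Pi) (Delta := Delta) (psi := psi) S
    have n2 := (climb sigma fin f (i + 1)).prob_nonneg (Pi := Pi) (Delta := Delta) (psi := psi) S
    have q0 := hb.prob_nonneg
    have q1 := sub_nonneg.2 hb.prob_le_one
    have hp : (0 : ℝ) < (1 / 32) ^ (i + 1) := by positivity
    have hp1 : (1 / 32 : ℝ) ^ (i + 1) ≤ 1 := pow_le_one₀ (by norm_num) (by norm_num)
    have hs : (2 : ℝ) ^ (i + 1) * ‖kerPart Pi Delta psi‖ ^ 2 =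
      2 * (2 ^ i * ‖kerPart Pi Delta psi‖ ^ 2) := by rw [pow_succ]; ring
    have ih' := ih (i + 1) (by omega)
    rw [pow_succ (1 / 32 : ℝ) (i + 1), hs] at ih'
    rcases le_total (3 / 2) (2 ^ i * ‖kerPart Pi Delta psi‖ ^ 2) with c | c
    · have h1 := hfin i (by omega) (by linarith) hi
      nlinarith [hu c, mul_le_mul_of_nonneg_left h1 q0, mul_nonneg q1 n2]
    · have h2 := mul_le_mul_of_nonneg_left (ih' (by linarith)) q1
      rcases le_total (1 / 2) (2 ^ i * ‖kerPart Pi Delta psi‖ ^ 2) with c' | c'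
      · have h1 := mul_le_mul_of_nonneg_left (hfin i (by omega) c' hi) q0
        nlinarith [mul_nonneg q0 hp.le, mul_nonneg q1 hp.le]
      · nlinarith [(hl c').1, mul_nonneg q0 n1, mul_nonneg q0 hp.le, mul_nonneg q1 hp.le]

/-- The climb goes on with probability at most 1/16, and 4(i + 1) + 5(i + 2)/16 ≤ 5(i + 1). -/
theorem Promise.expectedTime_climb_le_of_large {sigma R : ℝ} (h : Promise sigma Pi Delta psi)
    {L : ℕ} (hL : (2 : ℝ) ^ L ≤ 4 * sigma ^ 2) {fin : ℕ → Algorithm}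
    (hfin : ∀ i ≤ L, (fin i).expectedTime Pi Delta psi ≤ R) (f i : ℕ) (hfi : i + f = L)
    (hi : 3 / 2 ≤ 2 ^ i * ‖kerPart Pi Delta psi‖ ^ 2) :
    (climb sigma fin f i).expectedTime Pi Delta psi ≤
      R + 5 * (2 * timeConst * sigma) * (i + 1) := by
  have hD : 0 < 2 * timeConst * sigma := by
    have := mul_pos timeConst_pos (show 0 < sigma by linarith [h.one_le])
    linarith
  set D := 2 * timeConst * sigma with hDdef
  induction f generalizing i with
  | zero =>
    rw [climb]
    have : 0 ≤ 5 * D * (i + 1) := by positivity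
    linarith [hfin i (by omega)]
  | succ f ih =>
    have hi4 : (2 : ℝ) ^ i ≤ 4 * sigma ^ 2 :=
      (pow_le_pow_right₀ one_le_two (by omega)).trans hL
    obtain ⟨Q, T, hb, hT, -, hu⟩ := h.exists_isBranch_climb_step hi4
    rw [← hDdef] at hT
    have hs : (2 : ℝ) ^ (i + 1) * ‖kerPart Pi Delta psi‖ ^ 2 =
      2 * (2 ^ i * ‖kerPart Pi Delta psi‖ ^ 2) := by rw [pow_succ]; ring
    rw [climb, hb.expectedTime_eq]
    simp only [if_true, Bool.false_eq_true, if_false]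
    have h1 := mul_le_mul_of_nonneg_left (hfin i (by omega)) hb.prob_nonneg
    have h2 := mul_le_mul_of_nonneg_left (ih (i + 1) (by omega) (by rw [hs]; linarith))
      (sub_nonneg.2 hb.prob_le_one)
    push_cast at h2
    have h3 : 0 ≤ 5 * D * ((i : ℝ) + 1 + 1) := by positivity
    have h4 := mul_le_mul_of_nonneg_right (hu hi) h3
    have h5 : 0 ≤ D * i := by positivity
    linarith

/-- From 1/2, two doublings lead past 3/2. Two steps at full cost and the bound beyond sum to 4(i +
1) + 4(i + 2) + 5(i + 3) ≤ 13(i + 3). -/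
theorem Promise.expectedTime_climb_le_of_half_le {sigma R : ℝ} (h : Promise sigma Pi Delta psi)
    {L : ℕ} (hL : (2 : ℝ) ^ L ≤ 4 * sigma ^ 2) {fin : ℕ → Algorithm}
    (hfin : ∀ i ≤ L, (fin i).expectedTime Pi Delta psi ≤ R) (f i : ℕ) (hfi : i + f = L)
    (hi : 1 / 2 ≤ 2 ^ i * ‖kerPart Pi Delta psi‖ ^ 2) :
    (climb sigma fin f i).expectedTime Pi Delta psi ≤
      R + 13 * (2 * timeConst * sigma) * (i + 3) := by
  have hD : 0 < 2 * timeConst * sigma := by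
    have := mul_pos timeConst_pos (show 0 < sigma by linarith [h.one_le])
    linarith
  have step : ∀ (f i : ℕ) (B : ℝ), i + f = L → R ≤ B →
      (∀ g, g + 1 = f → (climb sigma fin g (i + 1)).expectedTime Pi Delta psi ≤ B) →
      (climb sigma fin f i).expectedTime Pi Delta psi ≤
        B + 4 * (2 * timeConst * sigma) * (i + 1) := by
    intro f i B hfi hB hg
    have hnn : 0 ≤ 4 * (2 * timeConst * sigma) * ((i : ℝ) + 1) := by positivity
    cases f with
    | zero => rw [climb]; linarith [hfin i (by omega)]
    | succ f =>
      have hi4 : (2 : ℝ) ^ i ≤ 4 * sigma ^ 2 :=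
        (pow_le_pow_right₀ one_le_two (by omega)).trans hL
      obtain ⟨Q, T, hb, hT, -, -⟩ := h.exists_isBranch_climb_step hi4
      rw [climb, hb.expectedTime_eq]
      simp only [if_true, Bool.false_eq_true, if_false]
      have h1 := mul_le_mul_of_nonneg_left ((hfin i (by omega)).trans hB) hb.prob_nonneg
      have h2 := mul_le_mul_of_nonneg_left (hg f rfl) (sub_nonneg.2 hb.prob_le_one)
      linarith
  have hs : ∀ i : ℕ, (2 : ℝ) ^ (i + 1) * ‖kerPart Pi Delta psi‖ ^ 2 =
    2 * (2 ^ i * ‖kerPart Pi Delta psi‖ ^ 2) := fun i => by rw [pow_succ]; ring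
  have hn : 0 ≤ 2 * timeConst * sigma * i := by positivity
  have key := step f i (R + 9 * (2 * timeConst * sigma) * (i + 3)) hfi
    (by nlinarith) fun g hgf => by
      have := step g (i + 1) (R + 5 * (2 * timeConst * sigma) * (i + 3)) (by omega)
        (by nlinarith) fun g' hg' => by
          have := h.expectedTime_climb_le_of_large hL hfin g' (i + 1 + 1) (by omega)
            (by rw [hs, hs]; linarith)
          push_cast at this
          linarith
      push_cast at this
      linarith
  linarith

/-- The maximum bounds the number of stages with 2^i/ω ≤ 1/2, each of cost O(σ). After them i ≤ log₂
ω + 2, and the preceding bound applies. -/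
theorem Promise.expectedTime_climb_le {sigma R : ℝ} (h : Promise sigma Pi Delta psi)
    {L : ℕ} (hL : (2 : ℝ) ^ L ≤ 4 * sigma ^ 2) {fin : ℕ → Algorithm}
    (hfin : ∀ i ≤ L, (fin i).expectedTime Pi Delta psi ≤ R) (f i : ℕ) (hfi : i + f = L)
    (hi : 2 ^ i * ‖kerPart Pi Delta psi‖ ^ 2 ≤ 3) :
    (climb sigma fin f i).expectedTime Pi Delta psi ≤
      R + 13 * (2 * timeConst * sigma) * (Real.logb 2 (omega Pi Delta psi) + 5) +
        2 * (2 * timeConst * sigma) * max (Real.logb 2 (omega Pi Delta psi) - i) 0 := by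
  have hD : 0 < 2 * timeConst * sigma := by
    have := mul_pos timeConst_pos (show 0 < sigma by linarith [h.one_le])
    linarith
  have hp := h.norm_kerPart_sq_pos
  have hω := h.omega_mul
  have hω1 := h.one_le_omega
  set D := 2 * timeConst * sigma with hDdef
  have large : ∀ (f i : ℕ), i + f = L → 1 / 2 ≤ 2 ^ i * ‖kerPart Pi Delta psi‖ ^ 2 →
      2 ^ i * ‖kerPart Pi Delta psi‖ ^ 2 ≤ 3 → (climb sigma fin f i).expectedTime Pi Delta psi ≤
      R + 13 * D * (Real.logb 2 (omega Pi Delta psi) + 5) := by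
    intro f i hfi h1 h2
    have h3 := h.expectedTime_climb_le_of_half_le hL hfin f i hfi h1
    rw [← hDdef] at h3
    have h4 : (2 : ℝ) ^ i ≤ 2 ^ 2 * omega Pi Delta psi := by
      by_contra! hc
      nlinarith [mul_lt_mul_of_pos_right hc hp]
    have h5 : (i : ℝ) ≤ Real.logb 2 (omega Pi Delta psi) + 2 := by
      have := Real.logb_le_logb_of_le one_lt_two (by positivity) h4
      rw [Real.logb_mul (by norm_num) (by linarith), Real.logb_pow, Real.logb_pow,
        Real.logb_self_eq_one one_lt_two] at this
      push_cast at this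
      linarith
    nlinarith
  induction f generalizing i with
  | zero =>
    have h2 : 0 ≤ 2 * D * max (Real.logb 2 (omega Pi Delta psi) - i) 0 :=
      mul_nonneg (by linarith) (le_max_right _ _)
    have h3 : 0 ≤ 13 * D * (Real.logb 2 (omega Pi Delta psi) + 5) :=
      mul_nonneg (by linarith) (by linarith [Real.logb_nonneg one_lt_two hω1])
    rw [climb]
    linarith [hfin i (by omega)]
  | succ f ih =>
    rcases le_total (1 / 2) (2 ^ i * ‖kerPart Pi Delta psi‖ ^ 2) with c | c
    · have h2 : 0 ≤ 2 * D * max (Real.logb 2 (omega Pi Delta psi) - i) 0 :=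
        mul_nonneg (by linarith) (le_max_right _ _)
      linarith [large (f + 1) i hfi c hi]
    · have hi4 : (2 : ℝ) ^ i ≤ 4 * sigma ^ 2 :=
        (pow_le_pow_right₀ one_le_two (by omega)).trans hL
      obtain ⟨Q, T, hb, -, hT, -⟩ := h.exists_isBranch_climb_step hi4
      have hs : (2 : ℝ) ^ (i + 1) * ‖kerPart Pi Delta psi‖ ^ 2 =
        2 * (2 ^ i * ‖kerPart Pi Delta psi‖ ^ 2) := by rw [pow_succ]; ring
      have h4 : (2 : ℝ) ^ (i + 1) ≤ omega Pi Delta psi := by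
        by_contra! hc
        nlinarith [mul_lt_mul_of_pos_right hc hp]
      have h5 : (i : ℝ) + 1 ≤ Real.logb 2 (omega Pi Delta psi) := by
        have := Real.logb_le_logb_of_le one_lt_two (by positivity) h4
        rw [Real.logb_pow, Real.logb_self_eq_one one_lt_two] at this
        push_cast at this
        linarith
      have h6 := ih (i + 1) (by omega) (by rw [hs]; linarith)
      rw [climb, hb.expectedTime_eq]
      simp only [if_true, Bool.false_eq_true, if_false]
      rw [max_eq_left (by linarith)]
      rw [max_eq_left (by push_cast; linarith)] at h6
      push_cast at h6
      have h7 := (hT c).2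
      rw [← hDdef] at h7
      have h8 : R ≤ R + 13 * D * (Real.logb 2 (omega Pi Delta psi) + 5) +
          2 * D * (Real.logb 2 (omega Pi Delta psi) - (i + 1)) := by
        have h9 : 0 ≤ 13 * D * (Real.logb 2 (omega Pi Delta psi) + 5) :=
          mul_nonneg (by linarith) (by linarith [Real.logb_nonneg one_lt_two hω1])
        have h10 : 0 ≤ 2 * D * (Real.logb 2 (omega Pi Delta psi) - (i + 1)) :=
          mul_nonneg (by linarith) (by linarith)
        linarith
      have h9 := mul_le_mul_of_nonneg_left ((hfin i (by omega)).trans h8) hb.prob_nonneg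
      have h10 := mul_le_mul_of_nonneg_left h6 (sub_nonneg.2 hb.prob_le_one)
      linarith

end Search

/-! ### The estimation algorithm -/

section Estimator

variable {H : Type*} [NormedAddCommGroup H] [InnerProductSpace ℂ H] [FiniteDimensional ℂ H]
  {Pi Delta : H →ₗ[ℂ] H} {psi : H}

/-- An interval of such a length starting at 1/2 covers [1/2, 3] and stays below 4. -/
theorem exists_mul_pow_mem_Icc {ε : ℝ} (hε : 0 < ε) (hε1 : ε < 1) :
    ∃ m : ℕ, 5 / 2 ≤ ε * (4 / 3) ^ m ∧ ε * (4 / 3) ^ m ≤ 10 / 3 := by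
  obtain ⟨n, h1, h2⟩ := exists_nat_pow_near (x := 5 / 2 / ε) (y := (4 / 3 : ℝ))
    (by rw [le_div_iff₀ hε]; linarith) (by norm_num)
  rw [le_div_iff₀ hε] at h1
  rw [div_lt_iff₀ hε] at h2
  refine ⟨n + 1, by linarith, ?_⟩
  rw [pow_succ]
  linarith

/-- The algorithm for estimating `ω` with precision `ε`, given the bound `sigma`. -/
def estimator (sigma ε : ℝ) : Algorithm :=
  open Classical in
  if h : 0 < ε ∧ ε < 1 then
    climb sigma (fun i => bisect sigma ε i (exists_mul_pow_mem_Icc h.1 h.2).choose (1 / 2))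
      (Nat.clog 2 ⌈2 * sigma ^ 2⌉₊) 0
  else .output 0

theorem Promise.estimates {sigma ε : ℝ} (h : Promise sigma Pi Delta psi) (hε : 0 < ε) :
    (estimator sigma ε).Estimates Pi Delta psi (omega Pi Delta psi) ε
      (322 * timeConst * (sigma * (1 / ε + Real.log (omega Pi Delta psi))))
      (322 * timeConst * (sigma * (1 / ε + Real.log (omega Pi Delta psi)) *
        Real.log (2 + sigma * (1 / ε + Real.log (omega Pi Delta psi))))) := by
  have hs := h.one_le
  have hω := h.one_le_omega
  have hlog := Real.log_nonneg hω
  have hC := timeConst_pos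
  have hN : 0 ≤ sigma * (1 / ε + Real.log (omega Pi Delta psi)) := by positivity
  rcases le_or_gt 1 ε with hε1 | hε1
  -- For ε ≥ 1 the output 0, of relative error 1, suffices.
  · rw [estimator, dif_neg (by simp [hε1])]
    refine ⟨?_, ?_, ?_⟩
    · rw [Algorithm.prob, if_pos]
      · norm_num
      · rw [Set.mem_ofPred_eq, zero_sub, abs_neg, abs_of_pos (by linarith)]
        exact le_mul_of_one_le_left (by linarith) hε1
    · rw [Algorithm.expectedCalls]; positivity
    · have := Real.log_nonneg (show 1 ≤ 2 + sigma * (1 / ε + Real.log (omega Pi Delta psi)) by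
        linarith)
      rw [Algorithm.expectedTime]; positivity
  · have hx : 1 < 2 * sigma ^ 2 := by nlinarith
    have hL := le_two_pow_clog_ceil (2 * sigma ^ 2)
    have hL' : (2 : ℝ) ^ Nat.clog 2 ⌈2 * sigma ^ 2⌉₊ ≤ 4 * sigma ^ 2 :=
      (two_pow_clog_ceil_le hx).trans (by linarith)
    have hp1 : ‖kerPart Pi Delta psi‖ ^ 2 ≤ 1 := by
      nlinarith [h.omega_mul, h.norm_kerPart_sq_pos]
    have h0 : (2 : ℝ) ^ 0 * ‖kerPart Pi Delta psi‖ ^ 2 ≤ 3 := by linarith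
    rw [estimator, dif_pos ⟨hε, hε1⟩]
    obtain ⟨m1, m2⟩ := (exists_mul_pow_mem_Icc hε hε1).choose_spec
    set m := (exists_mul_pow_mem_Icc hε hε1).choose
    have hi : ∀ i ≤ Nat.clog 2 ⌈2 * sigma ^ 2⌉₊, (2 : ℝ) ^ i ≤ 4 * sigma ^ 2 := fun i hi =>
      (pow_le_pow_right₀ one_le_two hi).trans hL'
    have hprob := h.le_prob_climb hL hL'
      (S := {r | |r - omega Pi Delta psi| ≤ ε * omega Pi Delta psi})
      (fin := fun i => bisect sigma ε i m (1 / 2)) (fun i hiL y1 y2 => by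
        have := h.le_prob_bisect hε (hi i hiL) m le_rfl (by linarith) y1 (by linarith)
        have h2 : (0 : ℝ) ≤ (1 / 2) ^ m := by positivity
        linarith) _ 0 (zero_add _) h0
    have htime := h.expectedTime_climb_le hL' (R := 192 * timeConst * sigma / ε)
      (fin := fun i => bisect sigma ε i m (1 / 2)) (fun i hiL => by
        refine (h.expectedTime_bisect_le hε (hi i hiL) m le_rfl (by linarith)).trans ?_
        have h1 : 0 ≤ 16 * timeConst * sigma / ε := by positivity
        have h2 : (0 : ℝ) ≤ (12 + 3 * m) * (3 / 4) ^ m := by positivity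
        calc _ ≤ 16 * timeConst * sigma / ε * 12 :=
              mul_le_mul_of_nonneg_left (by linarith) h1
          _ = _ := by ring) _ 0 (zero_add _) h0
    have hT : (climb sigma (fun i => bisect sigma ε i m (1 / 2))
        (Nat.clog 2 ⌈2 * sigma ^ 2⌉₊) 0).expectedTime Pi Delta psi ≤
        322 * timeConst * (sigma * (1 / ε + Real.log (omega Pi Delta psi))) := by
      refine htime.trans ?_
      have hlb := Real.logb_nonneg one_lt_two hω
      have hlb2 : Real.logb 2 (omega Pi Delta psi) ≤ 2 * Real.log (omega Pi Delta psi) := by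
        rw [Real.logb, div_le_iff₀ (Real.log_pos one_lt_two)]
        nlinarith [Real.log_two_gt_d9]
      have hε2 : 1 ≤ 1 / ε := (one_le_div₀ hε).2 hε1.le
      rw [Nat.cast_zero, sub_zero, max_eq_left hlb]
      have hD : 0 < timeConst * sigma := by positivity
      have e : 192 * timeConst * sigma / ε = timeConst * sigma * (192 * (1 / ε)) := by ring
      rw [e]
      -- The constant 130 is absorbed by 1/ε ≥ 1, giving 322 = 192 + 130; and 30 log₂ ω ≤ 60 ln ω.
      calc _ = timeConst * sigma *
            (192 * (1 / ε) + 130 + 30 * Real.logb 2 (omega Pi Delta psi)) := by ring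
        _ ≤ timeConst * sigma *
            (322 * (1 / ε) + 322 * Real.log (omega Pi Delta psi)) :=
            mul_le_mul_of_nonneg_left (by linarith) hD.le
        _ = _ := by ring
    refine ⟨?_, (Algorithm.expectedCalls_le_expectedTime _).trans hT, hT.trans ?_⟩
    · norm_num at hprob ⊢
      linarith
    · have hε2 : 1 ≤ 1 / ε := (one_le_div₀ hε).2 hε1.le
      -- The time is already O(N); the factor log(2 + N) ≥ log 3 > 1 is pure slack.
      have hN1 : 1 ≤ sigma * (1 / ε + Real.log (omega Pi Delta psi)) := by nlinarith
      refine mul_le_mul_of_nonneg_left (le_mul_of_one_le_right hN ?_) (by positivity)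
      rw [Real.le_log_iff_exp_le (by linarith)]
      linarith [Real.exp_one_lt_d9]

end Estimator

end

end WitnessSize

theorem mainTheorem5 :
    (∃ C : ℝ, 0 < C ∧ ∀ σ ε : ℝ, 0 < ε → ∃ alg : WitnessSize.Algorithm,
      (∀ (H : Type*) [NormedAddCommGroup H] [InnerProductSpace ℂ H] [FiniteDimensional ℂ H]
        (Pi Delta : H →ₗ[ℂ] H) (psi : H) (ω W N : ℝ),
        Pi.IsSymmetricProjection → Delta.IsSymmetricProjection →
        ‖psi‖ = 1 → Pi psi = 0 →
        WitnessSize.kerPart Pi Delta psi ≠ 0 →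
        ω = WitnessSize.omega Pi Delta psi →
        W = WitnessSize.transductionComplexity Pi Delta psi →
        Real.sqrt (ω * W) ≤ σ → Real.sqrt ω ≤ σ →
        N = σ * (1 / ε + Real.log ω) →
        alg.Estimates Pi Delta psi ω ε (C * N) (C * (N * Real.log (2 + N)))) ∧
      (∀ (H V : Type*) [NormedAddCommGroup H] [InnerProductSpace ℂ H] [FiniteDimensional ℂ H]
        [NormedAddCommGroup V] [InnerProductSpace ℂ V] [FiniteDimensional ℂ V]
        (n q : ℕ) (P : WitnessSize.SpanProgram n q H V) (x : Fin n → Fin q) (N : ℝ),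
        P.IsNormalized → P.IsPositive x →
        Real.sqrt (P.posWitnessSize x * P.negWitnessSize x) ≤ σ →
        N = σ * (1 / ε + Real.log (P.posWitnessSize x)) →
        alg.Estimates P.Pi (P.Delta x) P.w0 (P.posWitnessSize x) ε
          (C * N) (C * (N * Real.log (2 + N))))) ∧
    (∀ (H V : Type*) [NormedAddCommGroup H] [InnerProductSpace ℂ H] [FiniteDimensional ℂ H]
        [NormedAddCommGroup V] [InnerProductSpace ℂ V] [FiniteDimensional ℂ V]
        (n q : ℕ) (P : WitnessSize.SpanProgram n q H V) (x : Fin n → Fin q),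
        P.IsNormalized → P.IsPositive x →
        WitnessSize.omega P.Pi (P.Delta x) P.w0 = P.posWitnessSize x ∧
        P.negWitnessSize x =
          1 + WitnessSize.transductionComplexity P.Pi (P.Delta x) P.w0) := by
  refine ⟨⟨322 * WitnessSize.timeConst, by linarith [WitnessSize.timeConst_pos],
    fun σ ε hε => ⟨WitnessSize.estimator σ ε, ?_, ?_⟩⟩, ?_⟩
  · intro H _ _ _ Pi Delta psi ω W N hPi hDelta hnorm hpsi hker hω hW h1 h2 hN
    subst hω hW hN
    exact (WitnessSize.Promise.mk hPi hDelta hnorm hpsi hker h1 h2).estimates hε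
  · intro H V _ _ _ _ _ _ n q P x N hP hx h1 hN
    subst hN
    rw [← P.omega_eq_posWitnessSize hP hx] at h1 ⊢
    rw [P.negWitnessSize_eq hP hx] at h1
    have hω : 0 ≤ WitnessSize.omega P.Pi (P.Delta x) P.w0 := by
      rw [WitnessSize.omega]; positivity
    have hW : 0 ≤ WitnessSize.transductionComplexity P.Pi (P.Delta x) P.w0 := sq_nonneg _
    -- Since the negative witness size is 1 + W, it dominates both W and 1, and the single
    -- hypothesis on σ yields both bounds of the promise.
    have h : WitnessSize.Promise σ P.Pi (P.Delta x) P.w0 :=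
      ⟨WitnessSize.proj_isSymmetricProjection _, WitnessSize.proj_isSymmetricProjection _, hP,
        P.Pi_w0, P.kerPart_w0_ne_zero hP hx,
        (Real.sqrt_le_sqrt (mul_le_mul_of_nonneg_left (by linarith) hω)).trans h1,
        (Real.sqrt_le_sqrt (le_mul_of_one_le_right hω (by linarith))).trans h1⟩
    exact h.estimates hε
  · intro H V _ _ _ _ _ _ n q P x hP hx
    exact ⟨P.omega_eq_posWitnessSize hP hx, P.negWitnessSize_eq hP hx⟩
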